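/- Let $F$ be a number field, $D$ a quaternion algebra over $F$, $G=D^\times/F^\times$, $q$ the number of Archimedean places at which $D$ is split, $G(F)^+\subseteq G(F)$ the subgroup of elements lying in the identity component of $G_\infty$, and $\epsilon\colon \pi_0(G_\infty)\to\{\pm1\}$ a character. Let $\mathfrak p$ be a prime of $F$ above $p$ at which $D$ is split, so that $G(F_{\mathfrak p})\cong \mathrm{PGL}_2(F_{\mathfrak p})$, and let $\Omega$ be a finite extension of $\mathbb Q_p$ that contains the images of all embeddings $\sigma\colon F\to\overline{\mathbb Q}_p$ and such that $D\otimes_{F,\sigma}\Omega\cong M_2(\Omega)$ for all $\sigma\colon F\to \Omega$. Let $k=(k_\sigma)_{\sigma\colon F\to\Omega}$ be a family of even integers $\ge 0$. For even $n\geq 0$ let $V_n$ be the space of homogeneous polynomials of degree $n$ in $X,Y$ over $\Omega$ with $(g.f)(X,Y)=\det(g)^{-n/2}f(dX+bY,cX+aY)$ for $g=\begin{pmatrix}a&b\\c&d\end{pmatrix}$. Put $V_{k_{\mathfrak p}}=\bigotimes_{\sigma\mid\mathfrak p}V_{k_\sigma}$, a representation of $\mathrm{PGL}_2(F_{\mathfrak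 p})$, and $V_{k^{\mathfrak p}}=\bigotimes_{\sigma\nmid\mathfrak p}V_{k_\sigma}$, a representation of $G(F)$. Let $K=\prod_{\mathfrak q\ne\mathfrak p}K_{\mathfrak q}\subseteq G(\mathbb A^{\mathfrak p,\infty})$ be a compact open subgroup and $S$ a finite set of primes that contains $\mathfrak p$ and every $\mathfrak q$ for which $K_{\mathfrak q}$ is not maximal compact. Let $\pi$ be a smooth irreducible representation of $G(\mathbb A^{\mathfrak p,\infty})$ over $\Omega$ with $\pi^{K}\ne0$ (for instance the part away from $\mathfrak p$ and $\infty$ of a cohomological cuspidal automorphic representation of weight $k$ that is Steinberg at $\mathfrak p$), and let $\mathfrak m=\mathfrak m_\pi^S$ be the kernel of the action of the Hecke algebra $\mathbb T^S=\Omega[K^S\backslash G(\mathbb A^{S,\infty})/K^S]$ on $\pi^K$. For a commutative Banach algebra $A$ over $\Omega$, a topological $A$-module $M$ with an $A$-linear continuous action of $\mathrm{PGL}_2(F_{\mathfrak p})$ and an $A[G(F)]$-module $N$ that is finite free over $A$ put $$H^i_{A}(M,N)=H^i\bigl(G(F)^+,\mathcal F(G(\mathbb A^{\mathfrak p,\infty})/K,\mathrm{Hom}_{A,\mathrm{cont}}(M,N))\bigr);$$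 $\mathbb T^S$ and $\pi_0(G_\infty)$ act on it, and $(\cdot)^\epsilon_{\mathfrak m}$ denotes the localization at $\mathfrak m$ of the $\epsilon$-part. Let $B\subseteq \mathrm{PGL}_2(F_{\mathfrak p})$ be the subgroup of upper triangular matrices. Representations of $F_{\mathfrak p}^\times$ are inflated to $B$ by $\begin{pmatrix}a&u\\0&d\end{pmatrix}\mapsto a/d$, and for a locally analytic representation $\tau$ of $B$ let $\mathbb I_B(\tau)$ be the space of locally $\mathbb Q_p$-analytic functions $f$ on $\mathrm{PGL}_2(F_{\mathfrak p})$ with $f(bg)=\tau(b)f(g)$, with $\mathrm{PGL}_2(F_{\mathfrak p})$ acting by right translation. Let $1_{k_{\mathfrak p}}(y)=\prod_{\sigma\mid\mathfrak p}\sigma(y)^{-k_\sigma/2}$. The map $\bigotimes f_\sigma\mapsto\bigl(g\mapsto\prod_\sigma(\sigma(g).f_\sigma)(1,0)\bigr)$ embeds $V_{k_{\mathfrak p}}$ into $\mathbb I_B(1_{k_{\mathfrak p}})$; let $\mathrm{St}^{\mathrm{an}}$ be the quotient. For a continuous homomorphism $\lambda\colon F_{\mathfrak p}^\times\to\Omega$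 (automatically locally analytic) let $\tau_\lambda(y)=1_{k_{\mathfrak p}}(y)\begin{pmatrix}1&\lambda(y)\\0&1\end{pmatrix}$. Pulling back $0\to\mathbb I_B(1_{k_{\mathfrak p}})\to\mathbb I_B(\tau_\lambda)\to\mathbb I_B(1_{k_{\mathfrak p}})\to0$ along $V_{k_{\mathfrak p}}\to\mathbb I_B(1_{k_{\mathfrak p}})$ and pushing out along $\mathbb I_B(1_{k_{\mathfrak p}})\to\mathrm{St}^{\mathrm{an}}$ gives an exact sequence $0\to\mathrm{St}^{\mathrm{an}}\to\mathcal E_\lambda\to V_{k_{\mathfrak p}}\to0$. Let $$c_\lambda^\epsilon\colon H^q_\Omega(\mathrm{St}^{\mathrm{an}},V_{k^{\mathfrak p}}^\vee)^\epsilon_{\mathfrak m}\to H^{q+1}_\Omega(V_{k_{\mathfrak p}},V_{k^{\mathfrak p}}^\vee)^\epsilon_{\mathfrak m}$$ be the boundary map of the dual sequence, and let $\mathcal L_{\mathfrak p}(\pi)^\epsilon$ be the set of all continuous homomorphisms $\lambda\colon F_{\mathfrak p}^\times\to\Omega$ with $c_\lambda^\epsilon=0$. Let $A$ be a commutative ultrametric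 Banach algebra over $\Omega$ (for instance $A=\mathcal O(\mathcal U)$ for an affinoid $\mathcal U$ in weight space), $x\colon A\to\Omega$ a continuous homomorphism of $\Omega$-algebras (for instance the point $k_{\mathfrak p}\in\mathcal U$), and $\chi\colon F_{\mathfrak p}^\times\to A^\times$ a locally analytic character with $x\circ\chi=1_{k_{\mathfrak p}}$. Suppose that the reduction map $$\mathrm{red}_\chi\colon H^q_A(\mathbb I_B(\chi),V_{k^{\mathfrak p}}^\vee\otimes_\Omega A)^\epsilon_{\mathfrak m}\to H^q_\Omega(\mathbb I_B(1_{k_{\mathfrak p}}),V_{k^{\mathfrak p}}^\vee)^\epsilon_{\mathfrak m}$$ induced by $\mathrm{Hom}_{A,\mathrm{cont}}(\mathbb I_B(\chi),V_{k^{\mathfrak p}}^\vee\otimes A)\to\mathrm{Hom}_{A,\mathrm{cont}}(\mathbb I_B(\chi),V_{k^{\mathfrak p}}^\vee)=\mathrm{Hom}_{\Omega,\mathrm{cont}}(\mathbb I_B(1_{k_{\mathfrak p}}),V_{k^{\mathfrak p}}^\vee)$ is surjective. Then for every tangent vector at $x$, i.e. every continuous homomorphism of $\Omega$-algebras $v\colon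 A\to\Omega[\varepsilon]=\Omega[X]/(X^2)$ that reduces to $x$ modulo $\varepsilon$, the homomorphism $\partial_v(\chi)\colon F_{\mathfrak p}^\times\to\Omega$ defined by $v\circ\chi=1_{k_{\mathfrak p}}(1+\partial_v(\chi)\varepsilon)$ belongs to $\mathcal L_{\mathfrak p}(\pi)^\epsilon$. -/

import Mathlib

open scoped TensorProduct RestrictedProduct
open NumberField IsDedekindDomain CategoryTheory

noncomputable section

namespace AutL

set_option linter.unusedSectionVars false

/-! ### Projective unit groups `Aˣ / kˣ` -/

section PU

variable (k A : Type) [CommRing k] [Ring A] [Algebra k A]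

/-- The scalar units `kˣ → Aˣ` of a `k`-algebra `A`. -/
def scalarUnits : Subgroup Aˣ := (Units.map (algebraMap k A : k →* A)).range

instance scalarUnits_normal : (scalarUnits k A).Normal where
  conj_mem := by
    rintro _ ⟨x, rfl⟩ g
    refine ⟨x, ?_⟩
    ext
    have h := Algebra.commutes (x : k) (g : A)
    simp only [Units.coe_map, MonoidHom.coe_coe, Units.val_mul]
    rw [← h, mul_assoc, Units.mul_inv, mul_one]

/-- `Aˣ / kˣ`. -/
abbrev PU : Type := Aˣ ⧸ scalarUnits k A

variable {k A}

/-- The homomorphism `Aˣ / kˣ → A'ˣ / k'ˣ` induced by a ring homomorphism `A → A'` that maps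
scalars to scalars. -/
def PU.map {k' A' : Type} [CommRing k'] [Ring A'] [Algebra k' A'] (f : A →+* A') (g : k →+* k')
    (h : ∀ x, f (algebraMap k A x) = algebraMap k' A' (g x)) : PU k A →* PU k' A' :=
  QuotientGroup.map _ _ (Units.map (f : A →* A')) (by
    rintro _ ⟨x, rfl⟩
    refine ⟨Units.map (g : k →* k') x, ?_⟩
    ext
    simp [h])

end PU

/-! ### The group `G = Dˣ/F^×` and its adelic points -/

section Global

variable (F : Type) [Field F] [NumberField F] (D : Type) [Ring D] [Algebra F D]

/-- `G(F) = Dˣ / Fˣ`. -/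
abbrev GF : Type := PU F D

/-- The finite adeles of `F` away from the prime `𝔭`. -/
abbrev Adeles (𝔭 : HeightOneSpectrum (𝓞 F)) : Type :=
  Πʳ v : {v : HeightOneSpectrum (𝓞 F) // v ≠ 𝔭},
    [v.1.adicCompletion F, v.1.adicCompletionIntegers F]

variable (𝔭 : HeightOneSpectrum (𝓞 F))

/-- The diagonal embedding of `F` into the finite adeles away from `𝔭`. -/
def Adeles.diag : F →+* Adeles F 𝔭 where
  toFun x := ⟨fun v => algebraMap F (FiniteAdeleRing (𝓞 F) F) x v.1,
    Subtype.val_injective.tendsto_cofinite.eventually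
      (algebraMap F (FiniteAdeleRing (𝓞 F) F) x).2⟩
  map_one' := by rw [map_one]; rfl
  map_mul' x y := by simp only [map_mul]; rfl
  map_zero' := by rw [map_zero]; rfl
  map_add' x y := by simp only [map_add]; rfl

instance : Algebra F (Adeles F 𝔭) := (Adeles.diag F 𝔭).toAlgebra

/-- The projection from the adeles to the completion at `v`. -/
def Adeles.eval (v : {v : HeightOneSpectrum (𝓞 F) // v ≠ 𝔭}) :
    Adeles F 𝔭 →ₐ[F] v.1.adicCompletion F where
  toFun a := a v
  map_one' := rfl
  map_mul' _ _ := rfl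
  map_zero' := rfl
  map_add' _ _ := rfl
  commutes' _ := rfl

/-- `D ⊗ 𝔸` for the finite adeles `𝔸` away from `𝔭`, with its topology of a finite free
`𝔸`-module. -/
def DA : Type := Adeles F 𝔭 ⊗[F] D
instance : Ring (DA F D 𝔭) := inferInstanceAs (Ring (Adeles F 𝔭 ⊗[F] D))
instance : Algebra (Adeles F 𝔭) (DA F D 𝔭) :=
  inferInstanceAs (Algebra (Adeles F 𝔭) (Adeles F 𝔭 ⊗[F] D))
instance : TopologicalSpace (DA F D 𝔭) := moduleTopology (Adeles F 𝔭) (DA F D 𝔭)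

/-- `D_v = D ⊗ F_v`, with its topology of a finite-dimensional `F_v`-vector space. -/
def Dv (v : HeightOneSpectrum (𝓞 F)) : Type := v.adicCompletion F ⊗[F] D
instance (v : HeightOneSpectrum (𝓞 F)) : Ring (Dv F D v) :=
  inferInstanceAs (Ring (v.adicCompletion F ⊗[F] D))
instance (v : HeightOneSpectrum (𝓞 F)) : Algebra (v.adicCompletion F) (Dv F D v) :=
  inferInstanceAs (Algebra (v.adicCompletion F) (v.adicCompletion F ⊗[F] D))
instance (v : HeightOneSpectrum (𝓞 F)) : TopologicalSpace (Dv F D v) :=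
  moduleTopology (v.adicCompletion F) (Dv F D v)

/-- The points of `G` in the finite adeles away from `𝔭`, with the quotient topology. -/
abbrev GA : Type := PU (Adeles F 𝔭) (DA F D 𝔭)

/-- `G_v = G(F_v)`. -/
abbrev Gv (v : HeightOneSpectrum (𝓞 F)) : Type := PU (v.adicCompletion F) (Dv F D v)

/-- The diagonal embedding of `G(F)` into the adelic points of `G` away from `𝔭`. -/
def GF.toGA : GF F D →* GA F D 𝔭 :=
  PU.map (Algebra.TensorProduct.includeRight : D →ₐ[F] Adeles F 𝔭 ⊗[F] D).toRingHom
    (algebraMap F (Adeles F 𝔭)) fun x =>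
      ((Algebra.TensorProduct.includeRight : D →ₐ[F] Adeles F 𝔭 ⊗[F] D).commutes x).trans
        (IsScalarTower.algebraMap_apply F (Adeles F 𝔭) (Adeles F 𝔭 ⊗[F] D) x)

/-- The component at `v` of an adelic point. -/
def GA.proj (v : {v : HeightOneSpectrum (𝓞 F) // v ≠ 𝔭}) : GA F D 𝔭 →* Gv F D v.1 :=
  PU.map (Algebra.TensorProduct.map (Adeles.eval F 𝔭 v) (AlgHom.id F D)).toRingHom
    (Adeles.eval F 𝔭 v).toRingHom fun a => by
      change Algebra.TensorProduct.map (Adeles.eval F 𝔭 v) (AlgHom.id F D) (a ⊗ₜ[F] 1)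
        = (Adeles.eval F 𝔭 v a) ⊗ₜ[F] 1
      simp

/-- The level `K = ∏ K_v` away from `𝔭` attached to subgroups `K_v ⊆ G_v`. -/
def level (Kv : ∀ v : {v : HeightOneSpectrum (𝓞 F) // v ≠ 𝔭}, Subgroup (Gv F D v.1)) :
    Subgroup (GA F D 𝔭) :=
  ⨅ v, (Kv v).comap (GA.proj F D 𝔭 v)

/-- The adelic points of `G` away from `𝔭` whose components at the primes in `S` are trivial,
i.e. the adelic points of `G` away from `S` (if `𝔭 ∈ S`). -/
def awayFrom (S : Finset (HeightOneSpectrum (𝓞 F))) : Subgroup (GA F D 𝔭) :=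
  ⨅ v : {v : HeightOneSpectrum (𝓞 F) // v ≠ 𝔭}, ⨅ _ : v.1 ∈ S, (GA.proj F D 𝔭 v).ker

/-- A splitting of `D` over `R` along `σ : F → R`: a ring homomorphism `D → M₂(R)` that is `σ`
on the centre `F`. -/
def IsSplitting {F D R : Type} [Field F] [Ring D] [Algebra F D] [CommRing R] (σ : F →+* R)
    (f : D →+* Matrix (Fin 2) (Fin 2) R) : Prop :=
  ∀ x, f (algebraMap F D x) = algebraMap R (Matrix (Fin 2) (Fin 2) R) (σ x)

/-- The real places of `F` (real embeddings) at which `D` is split. -/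
abbrev RealSplit : Type :=
  {σ : F →+* ℝ // ∃ f : D →+* Matrix (Fin 2) (Fin 2) ℝ, IsSplitting σ f}

/-- The number `q` of Archimedean places of `F` at which `D` is split; `D` is split at every
complex place. -/
def numSplit : ℕ := Nat.card (RealSplit F D) + InfinitePlace.nrComplexPlaces F

/-- The component group `π₀(G_∞) = {±1}^{real split places}`. -/
abbrev Pi0 : Type := RealSplit F D → SignTypeˣ

/-- `Dˣ → π₀(G_∞)`: at a real split place, the sign of the determinant (the reduced norm). -/
def unitsSign : Dˣ →* Pi0 F D :=
  MonoidHom.pi fun σ =>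
    (Units.map ((signHom : ℝ →*₀ SignType) : ℝ →* SignType)).comp
      ((Units.map (Matrix.detMonoidHom : Matrix (Fin 2) (Fin 2) ℝ →* ℝ)).comp
        (Units.map (σ.2.choose : D →* Matrix (Fin 2) (Fin 2) ℝ)))

/-- The map `G(F) → π₀(G_∞)`. -/
def sgn : GF F D →* Pi0 F D :=
  QuotientGroup.lift _ (unitsSign F D) (by
    rintro _ ⟨x, rfl⟩
    funext σ
    ext
    have h := σ.2.choose_spec (x : F)
    have hx : σ.1 (x : F) ≠ 0 := by simp
    change SignType.sign (Matrix.det (σ.2.choose (algebraMap F D (x : F)))) = 1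
    rw [h, Matrix.algebraMap_eq_diagonal, Matrix.det_diagonal]
    simpa using sign_pos (pow_pos (abs_pos.2 hx) 2))

/-- `G(F)⁺`: the elements of `G(F)` in the identity component of `G_∞`. -/
def GFplus : Subgroup (GF F D) := (sgn F D).ker

instance : (GFplus F D).Normal := inferInstanceAs (sgn F D).ker.Normal

end Global

/-! ### Hecke algebras -/

section Hecke

variable (Ω : Type) [Field Ω] {G : Type} [Group G] (K : Subgroup G)

/-- The left translation action of `G` on `Ω[G/K]` (the compact induction of the trivial
representation of `K`). -/
def transl : Representation Ω G ((G ⧸ K) →₀ Ω) where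
  toFun g := Finsupp.lmapDomain Ω Ω (g • ·)
  map_one' := by ext; simp
  map_mul' g h := by ext; simp [mul_smul]

/-- The Hecke algebra `Ω[K\G/K]`, as the algebra of `G`-equivariant endomorphisms of `Ω[G/K]`.
The double coset `K h K = ⨆ hᵢ K` is the endomorphism with `g K ↦ ∑ g hᵢ K`. -/
def heckeAlg : Subring (Module.End Ω ((G ⧸ K) →₀ Ω)) :=
  Subring.centralizer (Set.range (transl Ω K))

/-- The central Hecke operators that come from a subgroup `H` of `G`, i.e. those in the span of
the double cosets of elements of `H`. If `G = G' × H` and `K = K' × K_H`, then the Hecke operators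
coming from `H` form the Hecke algebra `Ω[K_H\H/K_H]`; all of them are central in the Hecke
algebra `Ω[K\G/K]` as soon as `Ω[K_H\H/K_H]` is commutative. -/
def heckeFrom (H : Subgroup G) : Subring (Module.End Ω ((G ⧸ K) →₀ Ω)) where
  carrier := {t | t ∈ heckeAlg Ω K ∧ (∀ s ∈ heckeAlg Ω K, s * t = t * s) ∧
    ∀ g : G ⧸ K, t (Finsupp.single ((1 : G) : G ⧸ K) 1) g ≠ 0 → ∃ h ∈ H, (h : G ⧸ K) = g}
  mul_mem' := by
    rintro S T ⟨hS, hSc, hs⟩ ⟨hT, hTc, ht⟩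
    refine ⟨mul_mem hS hT, fun s hs => by rw [← mul_assoc, hSc s hs, mul_assoc, hTc s hs, mul_assoc],
      fun g hg => ?_⟩
    have hcomm : ∀ (h : G) (c : Ω), S (Finsupp.single (h : G ⧸ K) c)
        = c • transl Ω K h (S (Finsupp.single ((1 : G) : G ⧸ K) 1)) := by
      intro h c
      have h1 := Subring.mem_centralizer_iff.1 hS (transl Ω K h) ⟨h, rfl⟩
      have h2 := LinearMap.congr_fun h1 (Finsupp.single ((1 : G) : G ⧸ K) c)
      have h3 : Finsupp.single ((1 : G) : G ⧸ K) c
          = c • Finsupp.single ((1 : G) : G ⧸ K) (1 : Ω) := by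
        simp
      have h4 : transl Ω K h (Finsupp.single ((1 : G) : G ⧸ K) c)
          = Finsupp.single (h : G ⧸ K) c := by
        simp [transl, MulAction.Quotient.smul_mk]
      simp only [Module.End.mul_apply] at h2
      rw [h4] at h2
      rw [← h2, h3, map_smul, map_smul]
    rw [Module.End.mul_apply, ← Finsupp.sum_single (T (Finsupp.single ((1 : G) : G ⧸ K) 1)),
      Finsupp.sum, map_sum, Finsupp.finsetSum_apply] at hg
    obtain ⟨a, ha, hga⟩ := Finset.exists_ne_zero_of_sum_ne_zero hg
    obtain ⟨h, hH, rfl⟩ := ht a (Finsupp.mem_support_iff.1 ha)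
    rw [hcomm, Finsupp.smul_apply] at hga
    have hga' := right_ne_zero_of_smul hga
    have hinj : Function.Injective (fun x : G ⧸ K => h • x) := MulAction.injective h
    have hg' : g = h • (h⁻¹ • g) := by simp
    rw [hg'] at hga'
    have : (transl Ω K h (S (Finsupp.single ((1 : G) : G ⧸ K) 1))) (h • (h⁻¹ • g))
        = S (Finsupp.single ((1 : G) : G ⧸ K) 1) (h⁻¹ • g) :=
      Finsupp.mapDomain_apply hinj _ _
    rw [this] at hga'
    obtain ⟨h', hH', e⟩ := hs _ hga'
    refine ⟨h * h', H.mul_mem hH hH', ?_⟩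
    rw [hg', ← e]
    rfl
  add_mem' := by
    rintro S T ⟨hS, hSc, hs⟩ ⟨hT, hTc, ht⟩
    refine ⟨add_mem hS hT, fun s hs => by rw [mul_add, add_mul, hSc s hs, hTc s hs],
      fun g hg => ?_⟩
    by_contra hcon
    apply hg
    rw [LinearMap.add_apply, Finsupp.add_apply, not_not.1 (mt (hs g) hcon),
      not_not.1 (mt (ht g) hcon), add_zero]
  neg_mem' := by
    rintro S ⟨hS, hSc, hs⟩
    refine ⟨neg_mem hS, fun s hs => ?_, fun g hg => hs g ?_⟩
    · refine LinearMap.ext fun x => ?_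
      exact (map_neg s (S x)).trans (congrArg Neg.neg (LinearMap.congr_fun (hSc s hs) x))
    rwa [LinearMap.neg_apply, Finsupp.neg_apply, neg_ne_zero] at hg
  zero_mem' := ⟨zero_mem _, fun s _ => by rw [mul_zero, zero_mul], fun g hg => (hg rfl).elim⟩
  one_mem' := by
    refine ⟨one_mem _, fun s _ => by rw [mul_one, one_mul], fun g hg => ⟨1, H.one_mem, ?_⟩⟩
    by_contra hne
    exact hg (Finsupp.single_eq_of_ne (Ne.symm hne))

/-- The commutative ring of Hecke operators coming from `H`. -/
abbrev HeckeT (H : Subgroup G) : Type := heckeFrom Ω K H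

instance (H : Subgroup G) : CommRing (HeckeT Ω K H) :=
  { (inferInstance : Ring (heckeFrom Ω K H)) with
    mul_comm := fun s t => Subtype.ext (t.2.2.1 s.1 s.2.1) }

variable {Ω K} in
lemma HeckeT.comm {H : Subgroup G} (t : HeckeT Ω K H) (g : G) :
    transl Ω K g * t.1 = t.1 * transl Ω K g :=
  Subring.mem_centralizer_iff.1 t.2.1 (transl Ω K g) ⟨g, rfl⟩

/-- The ideal of a representation `π` of `G`: the kernel of the action of the Hecke operators
coming from `H` on `π^K = Hom_G(Ω[G/K], π)`. -/
def heckeIdeal (H : Subgroup G) {W : Type} [AddCommGroup W] [Module Ω W]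
    (π : Representation Ω G W) : Ideal (HeckeT Ω K H) where
  carrier := {t | ∀ w : ((G ⧸ K) →₀ Ω) →ₗ[Ω] W,
    (∀ g, w ∘ₗ transl Ω K g = π g ∘ₗ w) → w ∘ₗ t.1 = 0}
  zero_mem' := fun w _ => LinearMap.comp_zero w
  add_mem' := fun {s t} hs ht w hw => by
    have : (s + t).1 = s.1 + t.1 := rfl
    rw [this, LinearMap.comp_add, hs w hw, ht w hw, add_zero]
  smul_mem' := fun s t ht w hw => by
    have : (s • t).1 = t.1 ∘ₗ s.1 := by
      rw [smul_eq_mul, mul_comm]; rfl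
    rw [this, ← LinearMap.comp_assoc, ht w hw, LinearMap.zero_comp]

/-- `𝓕(G/K, X) = Hom_Ω(Ω[G/K], X)`. -/
def CoeffMod (X : Type) [AddCommGroup X] [Module Ω X] : Type := ((G ⧸ K) →₀ Ω) →ₗ[Ω] X

variable {X : Type} [AddCommGroup X] [Module Ω X]

variable {Ω K} in
/-- An element of `𝓕(G/K, X)` as a linear map. -/
def CoeffMod.lin (f : CoeffMod Ω K X) : ((G ⧸ K) →₀ Ω) →ₗ[Ω] X := f

instance : AddCommGroup (CoeffMod Ω K X) :=
  inferInstanceAs (AddCommGroup (((G ⧸ K) →₀ Ω) →ₗ[Ω] X))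

/-- Hecke operators act on `𝓕(G/K, X)` by right translation, i.e. by composition. -/
instance (H : Subgroup G) : Module (HeckeT Ω K H) (CoeffMod Ω K X) where
  smul t f := f.lin ∘ₗ t.1
  one_smul f := LinearMap.comp_id f.lin
  mul_smul s t f := by
    have h : (s * t).1 = t.1 ∘ₗ s.1 := congrArg Subtype.val (mul_comm s t)
    exact (congrArg (fun u => f.lin ∘ₗ u) h).trans (LinearMap.comp_assoc _ _ _).symm
  smul_zero t := LinearMap.zero_comp _
  smul_add t f g := LinearMap.add_comp _ _ _
  add_smul s t f := LinearMap.comp_add _ _ _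
  zero_smul f := LinearMap.comp_zero _

variable {Γ : Type} [Group Γ]

/-- The representation of `Γ` on `𝓕(G/K, X)`, `(γ f)(g) = γ (f (γ⁻¹ g))`; it commutes with the
Hecke operators. -/
def coeffRep (H : Subgroup G) (j : Γ →* G) (ρ : Representation Ω Γ X) :
    Representation (HeckeT Ω K H) Γ (CoeffMod Ω K X) where
  toFun γ :=
    { toFun := fun f => ρ γ ∘ₗ f.lin ∘ₗ transl Ω K (j γ⁻¹)
      map_add' := fun f g => by
        refine LinearMap.ext fun x => ?_
        exact map_add (ρ γ) _ _
      map_smul' := fun t f => by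
        refine LinearMap.ext fun x => ?_
        have h := LinearMap.congr_fun (HeckeT.comm t (j γ⁻¹)) x
        exact congrArg (fun y => ρ γ (f.lin y)) h.symm }
  map_one' := by
    refine LinearMap.ext fun f => LinearMap.ext fun x => ?_
    change ρ 1 (f.lin (transl Ω K (j 1⁻¹) x)) = _
    simp only [inv_one, map_one]
    rfl
  map_mul' γ γ' := by
    refine LinearMap.ext fun f => LinearMap.ext fun x => ?_
    change ρ (γ * γ') (f.lin (transl Ω K (j (γ * γ')⁻¹) x)) =
      ρ γ (ρ γ' (f.lin (transl Ω K (j γ'⁻¹) (transl Ω K (j γ⁻¹) x))))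
    simp only [mul_inv_rev, map_mul]
    rfl

/-- The coefficient module `𝓕(G/K, X)` with its actions of `Γ` and of the Hecke operators. -/
def coeff (H : Subgroup G) (j : Γ →* G) (ρ : Representation Ω Γ X) : Rep (HeckeT Ω K H) Γ :=
  Rep.of (coeffRep Ω K H j ρ)

variable {Y : Type} [AddCommGroup Y] [Module Ω Y]

/-- Functoriality of `𝓕(G/K, X)` in `X`. -/
def coeffMap (H : Subgroup G) (j : Γ →* G) {ρ : Representation Ω Γ X} {ρ' : Representation Ω Γ Y}
    (φ : X →ₗ[Ω] Y) (hφ : ∀ γ x, φ (ρ γ x) = ρ' γ (φ x)) :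
    coeff Ω K H j ρ ⟶ coeff Ω K H j ρ' :=
  Rep.ofHom
    { toFun := fun f => φ ∘ₗ f.lin
      map_add' := fun _ _ => LinearMap.comp_add _ _ _
      map_smul' := fun _ _ => rfl
      isIntertwining' := fun γ => LinearMap.ext fun _ => LinearMap.ext fun _ => hφ γ _ }

end Hecke

/-! ### Isotypic parts of the cohomology of a normal subgroup -/

section Conj

variable {k Γ : Type} [CommRing k] [Group Γ] (N : Subgroup Γ) [N.Normal]

/-- The cohomology `Hⁿ(N, M)` of a subgroup `N` of `Γ` with values in a representation of `Γ`. -/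
abbrev coh (M : Rep k Γ) (n : ℕ) : ModuleCat k := groupCohomology (Rep.res N.subtype M) n

/-- The map in cohomology induced by a homomorphism of coefficients. -/
def cohMap {M M' : Rep k Γ} (f : M ⟶ M') (n : ℕ) : coh N M n →ₗ[k] coh N M' n :=
  (groupCohomology.map (MonoidHom.id N) ((Rep.resFunctor N.subtype).map f) n).hom

/-- The action of `γ ∈ Γ` on `Hⁿ(N, M)`, induced by `x ↦ γ⁻¹ x γ` on `N` and `m ↦ γ m` on `M`. -/
def conjAct (M : Rep k Γ) (n : ℕ) (γ : Γ) : coh N M n →ₗ[k] coh N M n :=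
  (groupCohomology.map (A := Rep.res N.subtype M) (B := Rep.res N.subtype M)
    (MulAut.conjNormal γ⁻¹ : MulAut N).toMonoidHom
    (Rep.ofHom
      { toLinearMap := M.ρ γ
        isIntertwining' := fun x => by
          change M.ρ γ * M.ρ ((MulAut.conjNormal γ⁻¹ x : N) : Γ) = M.ρ (x : Γ) * M.ρ γ
          rw [← map_mul, ← map_mul, MulAut.conjNormal_apply]
          congr 1
          group }) n).hom

/-- The part of `Hⁿ(N, M)` on which `Γ` acts through the sign character `e`. -/
def signPart (e : Γ →* ℤˣ) (M : Rep k Γ) (n : ℕ) : Submodule k (coh N M n) :=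
  ⨅ γ, LinearMap.ker (conjAct N M n γ - ((e γ : ℤˣ) : ℤ) • LinearMap.id)

end Conj

/-! ### Locally analytic functions on `PGL₂(F_𝔭)` -/

/-- `2 × 2`-matrices. -/
abbrev M2 (R : Type) [CommRing R] : Type := Matrix (Fin 2) (Fin 2) R

/-- `PGL₂(R) = GL₂(R)/Rˣ`. -/
abbrev PGL2 (R : Type) [CommRing R] : Type := PU R (M2 R)

/-- The map `PGL₂(R) → PGL₂(R')` induced by a ring homomorphism. -/
def PGL2.map {R R' : Type} [CommRing R] [CommRing R'] (σ : R →+* R') : PGL2 R →* PGL2 R' :=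
  PU.map σ.mapMatrix σ fun x => by
    ext i j
    simp only [Matrix.algebraMap_eq_diagonal, RingHom.mapMatrix_apply, Matrix.map_apply,
      Matrix.diagonal_apply]
    split <;> simp


section LocAn

variable (p : ℕ) [Fact p.Prime] {Fp : Type} [NormedField Fp] [NormedAlgebra ℚ_[p] Fp]
  {W : Type} [NormedAddCommGroup W] [NormedSpace ℚ_[p] W]
  {W' : Type} [NormedAddCommGroup W'] [NormedSpace ℚ_[p] W']

open Classical in
/-- A function on `PGL₂(F_𝔭)`, viewed as a function on the open subset `GL₂(F_𝔭)` of `M₂(F_𝔭)`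
(and extended by zero). -/
def onMatrices (f : PGL2 Fp → W) (X : Fin 2 → Fin 2 → Fp) : W :=
  if h : IsUnit (Matrix.of X) then f (QuotientGroup.mk h.unit) else 0

/-- The entries of an invertible matrix. -/
def entries (g : (M2 Fp)ˣ) : Fin 2 → Fin 2 → Fp := fun i j => g.1 i j

/-- `f` is locally `ℚ_p`-analytic: near every point of `GL₂(F_𝔭) ⊆ M₂(F_𝔭)` it is given by a
convergent power series over `ℚ_p` (the map `GL₂(F_𝔭) → PGL₂(F_𝔭)` is a submersion). -/
def IsLocAn (f : PGL2 Fp → W) : Prop :=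
  ∀ g : (M2 Fp)ˣ, AnalyticAt ℚ_[p] (onMatrices f) (entries g)

/-- A set of functions is bounded if near every point there is a common radius `r` on which all
its members are given by power series that are uniformly bounded for the norm
`sup_n ‖P_n‖ rⁿ`. On spaces of locally analytic functions on a compact manifold these are the
sets that are contained and bounded in one of the Banach spaces of functions that are analytic on
the members of a fixed covering, of which the space is the locally convex inductive limit. -/
def IsLocBdd (S : Set (PGL2 Fp → W)) : Prop :=
  ∀ g : (M2 Fp)ˣ, ∃ r : ℝ, 0 < r ∧ ∃ C : ℝ, ∀ f ∈ S,
    ∃ P : FormalMultilinearSeries ℚ_[p] (Fin 2 → Fin 2 → Fp) W,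
      HasFPowerSeriesOnBall (onMatrices f) P (entries g) (ENNReal.ofReal r) ∧
        ∀ n, ‖P n‖ * r ^ n ≤ C

lemma onMatrices_of (f : PGL2 Fp → W) (X : Fin 2 → Fin 2 → Fp) (h : IsUnit (Matrix.of X)) :
    onMatrices f X = f (QuotientGroup.mk h.unit) := dif_pos h

lemma onMatrices_of_not (f : PGL2 Fp → W) (X : Fin 2 → Fin 2 → Fp) (h : ¬ IsUnit (Matrix.of X)) :
    onMatrices f X = 0 := dif_neg h

lemma onMatrices_add (f h : PGL2 Fp → W) : onMatrices (f + h) = onMatrices f + onMatrices h := by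
  funext X
  by_cases hX : IsUnit (Matrix.of X)
  · simp [onMatrices_of _ _ hX]
  · simp [onMatrices_of_not _ _ hX]

lemma onMatrices_comp (T : W →L[ℚ_[p]] W') (f : PGL2 Fp → W) :
    onMatrices (T ∘ f) = T ∘ onMatrices f := by
  funext X
  by_cases hX : IsUnit (Matrix.of X)
  · simp [onMatrices_of _ _ hX]
  · simp [onMatrices_of_not _ _ hX]

/-- Right multiplication by a matrix. -/
def rightMul (g : M2 Fp) : (Fin 2 → Fin 2 → Fp) →L[ℚ_[p]] (Fin 2 → Fin 2 → Fp) where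
  toFun X i j := X i 0 * g 0 j + X i 1 * g 1 j
  map_add' X Y := by ext i j; simp; ring
  map_smul' c X := by ext i j; simp
  cont := by fun_prop

lemma of_rightMul (g : M2 Fp) (X : Fin 2 → Fin 2 → Fp) :
    Matrix.of (rightMul p g X) = Matrix.of X * g := by
  ext i j
  simp [rightMul, Matrix.mul_apply, Fin.sum_univ_two]

lemma rightMul_entries (g h : (M2 Fp)ˣ) : rightMul p h.1 (entries g) = entries (g * h) := by
  ext i j
  simp [rightMul, entries, Matrix.mul_apply, Fin.sum_univ_two]

lemma onMatrices_translate (f : PGL2 Fp → W) (h : (M2 Fp)ˣ) :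
    onMatrices (fun x => f (x * QuotientGroup.mk h)) = onMatrices f ∘ rightMul p h.1 := by
  funext X
  by_cases hX : IsUnit (Matrix.of X)
  · have hX' : IsUnit (Matrix.of (rightMul p h.1 X)) := by
      rw [of_rightMul]; exact hX.mul h.isUnit
    rw [onMatrices_of _ _ hX, Function.comp_apply, onMatrices_of _ _ hX', ← QuotientGroup.mk_mul]
    congr 2
    ext1
    simp [of_rightMul]
  · have hX' : ¬ IsUnit (Matrix.of (rightMul p h.1 X)) := by
      rw [of_rightMul]
      intro h1
      apply hX
      have := h1.mul (h⁻¹).isUnit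
      rwa [mul_assoc, Units.mul_inv, mul_one] at this
    rw [onMatrices_of_not _ _ hX, Function.comp_apply, onMatrices_of_not _ _ hX']

variable {p}

lemma IsLocAn.add {f h : PGL2 Fp → W} (hf : IsLocAn p f) (hh : IsLocAn p h) :
    IsLocAn p (f + h) := fun g => by
  rw [onMatrices_add]; exact (hf g).add (hh g)

lemma IsLocAn.comp (T : W →L[ℚ_[p]] W') {f : PGL2 Fp → W} (hf : IsLocAn p f) :
    IsLocAn p (T ∘ f) := fun g => by
  rw [onMatrices_comp]; exact (T.analyticAt _).comp (hf g)

lemma IsLocAn.translate {f : PGL2 Fp → W} (hf : IsLocAn p f) (y : PGL2 Fp) :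
    IsLocAn p (fun x => f (x * y)) := by
  obtain ⟨h, rfl⟩ := QuotientGroup.mk_surjective y
  intro g
  rw [onMatrices_translate p]
  refine AnalyticAt.comp ?_ ((rightMul p h.1).analyticAt _)
  rw [rightMul_entries]
  exact hf _

lemma IsLocBdd.mono {S T : Set (PGL2 Fp → W)} (hT : IsLocBdd p T) (h : S ⊆ T) : IsLocBdd p S :=
  fun g => by
    obtain ⟨r, hr, C, hC⟩ := hT g
    exact ⟨r, hr, C, fun f hf => hC f (h hf)⟩

lemma IsLocBdd.comp (T : W →L[ℚ_[p]] W') {S : Set (PGL2 Fp → W)} (hS : IsLocBdd p S) :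
    IsLocBdd p ((fun f => T ∘ f) '' S) := fun g => by
  obtain ⟨r, hr, C, hC⟩ := hS g
  refine ⟨r, hr, ‖T‖ * C, ?_⟩
  rintro _ ⟨f, hf, rfl⟩
  obtain ⟨P, hP, hPC⟩ := hC f hf
  refine ⟨T.compFormalMultilinearSeries P, ?_, fun n => ?_⟩
  · rw [onMatrices_comp]
    exact T.comp_hasFPowerSeriesOnBall hP
  · calc ‖T.compFormalMultilinearSeries P n‖ * r ^ n ≤ (‖T‖ * ‖P n‖) * r ^ n := by
          gcongr; exact T.norm_compContinuousMultilinearMap_le (P n)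
      _ = ‖T‖ * (‖P n‖ * r ^ n) := by ring
      _ ≤ ‖T‖ * C := by gcongr; exact hPC n

lemma IsLocBdd.translate {S : Set (PGL2 Fp → W)} (hS : IsLocBdd p S) (y : PGL2 Fp) :
    IsLocBdd p ((fun f x => f (x * y)) '' S) := by
  obtain ⟨h, rfl⟩ := QuotientGroup.mk_surjective y
  intro g
  obtain ⟨r, hr, C, hC⟩ := hS (g * h)
  set u := rightMul p (Fp := Fp) h.1 with hu
  have hu0 : 0 < ‖u‖ + 1 := by positivity
  refine ⟨r / (‖u‖ + 1), by positivity, C, ?_⟩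
  rintro _ ⟨f, hf, rfl⟩
  obtain ⟨P, hP, hPC⟩ := hC f hf
  rw [← rightMul_entries p] at hP
  refine ⟨P.compContinuousLinearMap u, ?_, fun n => ?_⟩
  · rw [onMatrices_translate p]
    refine hP.compContinuousLinearMap.mono (ENNReal.ofReal_pos.2 (by positivity)) ?_
    rw [ENNReal.ofReal_div_of_pos hu0]
    gcongr
    rw [← ofReal_norm]
    exact ENNReal.ofReal_le_ofReal (le_add_of_nonneg_right zero_le_one)
  · calc ‖P.compContinuousLinearMap u n‖ * (r / (‖u‖ + 1)) ^ n
        ≤ (‖P n‖ * ‖u‖ ^ n) * (r / (‖u‖ + 1)) ^ n := by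
          gcongr
          exact ((P n).norm_compContinuousLinearMap_le (fun _ => u)).trans_eq (by simp)
      _ ≤ (‖P n‖ * (‖u‖ + 1) ^ n) * (r / (‖u‖ + 1)) ^ n := by gcongr; simp
      _ = ‖P n‖ * r ^ n := by rw [div_pow]; field_simp
      _ ≤ C := hPC n

lemma IsLocBdd.add {S T : Set (PGL2 Fp → W)} (hS : IsLocBdd p S) (hT : IsLocBdd p T) :
    IsLocBdd p (Set.image2 (· + ·) S T) := fun g => by
  obtain ⟨r, hr, C, hC⟩ := hS g
  obtain ⟨r', hr', C', hC'⟩ := hT g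
  refine ⟨min r r', lt_min hr hr', C + C', ?_⟩
  rintro _ ⟨f, hf, f', hf', rfl⟩
  obtain ⟨P, hP, hPC⟩ := hC f hf
  obtain ⟨P', hP', hPC'⟩ := hC' f' hf'
  refine ⟨P + P', ?_, fun n => ?_⟩
  · change HasFPowerSeriesOnBall (onMatrices (f + f')) _ _ _
    rw [onMatrices_add]
    exact (hP.mono (by simp [hr, hr']) (ENNReal.ofReal_le_ofReal (min_le_left _ _))).add
      (hP'.mono (by simp [hr, hr']) (ENNReal.ofReal_le_ofReal (min_le_right _ _)))
  · have h0 : 0 ≤ min r r' := (lt_min hr hr').le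
    calc ‖(P + P') n‖ * min r r' ^ n ≤ (‖P n‖ + ‖P' n‖) * min r r' ^ n := by
          gcongr; exact norm_add_le _ _
      _ = ‖P n‖ * min r r' ^ n + ‖P' n‖ * min r r' ^ n := by ring
      _ ≤ ‖P n‖ * r ^ n + ‖P' n‖ * r' ^ n := by
          gcongr
          · exact min_le_left _ _
          · exact min_le_right _ _
      _ ≤ C + C' := add_le_add (hPC n) (hPC' n)

end LocAn

section Ind

variable {p : ℕ} [Fact p.Prime] {Fp : Type} [NormedField Fp] [NormedAlgebra ℚ_[p] Fp]
  {W : Type} [NormedAddCommGroup W] [NormedSpace ℚ_[p] W]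
  {R : Type} [NormedCommRing R] [NormedAlgebra ℚ_[p] R] [Module R W] [IsBoundedSMul R W]
  [IsScalarTower ℚ_[p] R W]

lemma onMatrices_zero : onMatrices (0 : PGL2 Fp → W) = 0 := by
  funext X
  by_cases hX : IsUnit (Matrix.of X)
  · simp [onMatrices_of _ _ hX]
  · simp [onMatrices_of_not _ _ hX]

lemma IsLocAn.zero : IsLocAn p (0 : PGL2 Fp → W) := fun g => by
  rw [onMatrices_zero]; exact analyticAt_const

variable (p W) in
/-- Multiplication by a scalar. -/
def scal (c : R) : W →L[ℚ_[p]] W where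
  toFun w := c • w
  map_add' := smul_add c
  map_smul' a w := (smul_comm a c w).symm
  cont := continuous_const_smul c

variable (p W) in
lemma norm_scal_le (c : R) : ‖scal p W c‖ ≤ ‖c‖ :=
  ContinuousLinearMap.opNorm_le_bound _ (norm_nonneg _) fun w => norm_smul_le c w

lemma IsLocAn.smul (c : R) {f : PGL2 Fp → W} (hf : IsLocAn p f) : IsLocAn p (c • f) :=
  hf.comp (scal p W c)

/-- The multiples of one locally analytic function by a bounded set of scalars are bounded. -/
lemma IsLocAn.isLocBdd_smul {f : PGL2 Fp → W} (hf : IsLocAn p f) (C : ℝ) :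
    IsLocBdd p {h : PGL2 Fp → W | ∃ c : R, ‖c‖ ≤ C ∧ h = c • f} := fun g => by
  obtain ⟨P, ρ, hP⟩ := hf g
  obtain ⟨r, hr0, hr⟩ := ENNReal.lt_iff_exists_nnreal_btwn.1 hP.r_pos
  obtain ⟨C', hC', hb⟩ := P.norm_mul_pow_le_of_lt_radius (hr.trans_le hP.r_le)
  have hr0' : (0 : ℝ) < r := by exact_mod_cast hr0
  refine ⟨r, hr0', C * C', ?_⟩
  rintro _ ⟨c, hc, rfl⟩
  refine ⟨(scal p W c).compFormalMultilinearSeries P, ?_, fun n => ?_⟩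
  · have h1 := (scal p W c).comp_hasFPowerSeriesOnBall (hP.mono hr0 hr.le)
    rw [ENNReal.ofReal_coe_nnreal]
    have h2 := onMatrices_comp p (scal p W c) f
    have h3 : (c • f) = (scal p W c) ∘ f := rfl
    rw [h3, h2]
    exact h1
  · calc ‖(scal p W c).compFormalMultilinearSeries P n‖ * (r : ℝ) ^ n
        ≤ (‖c‖ * ‖P n‖) * (r : ℝ) ^ n := by
          gcongr
          exact ((scal p W c).norm_compContinuousMultilinearMap_le (P n)).trans
            (by gcongr; exact norm_scal_le p W c)
      _ = ‖c‖ * (‖P n‖ * (r : ℝ) ^ n) := by ring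
      _ ≤ C * C' := by
          have := hb n
          have h0 : 0 ≤ ‖P n‖ * (r : ℝ) ^ n := by positivity
          exact mul_le_mul hc this h0 ((norm_nonneg _).trans hc)

/-- The upper triangular matrix with diagonal entries `a`, `d` and upper right entry `u`. -/
def borelUnit (a d : Fpˣ) (u : Fp) : (M2 Fp)ˣ where
  val := !![(a : Fp), u; 0, d]
  inv := !![((a⁻¹ : Fpˣ) : Fp), -((a⁻¹ : Fpˣ) : Fp) * u * ((d⁻¹ : Fpˣ) : Fp); 0, ((d⁻¹ : Fpˣ) : Fp)]
  val_inv := by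
    ext i j
    fin_cases i <;> fin_cases j <;> simp [Matrix.mul_apply, Fin.sum_univ_two]
    have ha : (a : Fp) ≠ 0 := a.ne_zero
    field_simp
    ring
  inv_val := by
    ext i j
    fin_cases i <;> fin_cases j <;> simp [Matrix.mul_apply, Fin.sum_univ_two]

/-- Its class in `PGL₂(F_𝔭)`; these classes form the Borel subgroup `B`. -/
def borel (a d : Fpˣ) (u : Fp) : PGL2 Fp := QuotientGroup.mk (borelUnit a d u)

variable (p) in
/-- The locally analytic induction `I_B(ρ)` of a representation `ρ` of `F_𝔭ˣ` on `W`, inflated to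
the Borel subgroup `B` by `(a, u; 0, d) ↦ a/d`: the locally analytic functions
`f : PGL₂(F_𝔭) → W` with `f (b g) = ρ(b) f(g)`. -/
def Ind (ρ : Representation R Fpˣ W) : Submodule R (PGL2 Fp → W) where
  carrier := {f | IsLocAn p f ∧ ∀ a d u g, f (borel a d u * g) = ρ (a / d) (f g)}
  zero_mem' := ⟨IsLocAn.zero, fun _ _ _ _ => by simp⟩
  add_mem' := fun hf hh => ⟨hf.1.add hh.1, fun a d u g => by
    simp only [Pi.add_apply, hf.2 a d u g, hh.2 a d u g, map_add]⟩
  smul_mem' := fun c _ hf => ⟨hf.1.smul c, fun a d u g => by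
    simp only [Pi.smul_apply, hf.2 a d u g, map_smul]⟩

/-- `PGL₂(F_𝔭)` acts on `I_B(ρ)` by right translation. -/
def indRep (ρ : Representation R Fpˣ W) : Representation R (PGL2 Fp) (Ind p ρ) where
  toFun y :=
    { toFun := fun f => ⟨fun x => f.1 (x * y), f.2.1.translate y, fun a d u g => by
        change f.1 (borel a d u * g * y) = ρ (a / d) (f.1 (g * y))
        rw [mul_assoc, f.2.2]⟩
      map_add' := fun _ _ => rfl
      map_smul' := fun _ _ => rfl }
  map_one' := LinearMap.ext fun f => Subtype.ext (funext fun x => by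
    change f.1 (x * 1) = f.1 x
    rw [mul_one])
  map_mul' y z := LinearMap.ext fun f => Subtype.ext (funext fun x => by
    change f.1 (x * (y * z)) = f.1 (x * y * z)
    rw [mul_assoc])

end Ind

/-! ### Continuous duals -/

/-- A representation of `Γ` on an `R`-module together with a family of bounded subsets that is
stable under `Γ`. -/
structure BornRep (R Γ : Type) [CommRing R] [Group Γ] where
  /-- the module -/
  M : Type
  /-- its addition -/
  [grp : AddCommGroup M]
  /-- its scalar multiplication -/
  [mod : Module R M]
  /-- the action -/
  ρ : Representation R Γ M
  /-- the bounded subsets -/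
  IsBdd : Set M → Prop
  bdd_map : ∀ γ S, IsBdd S → IsBdd (ρ γ '' S)

attribute [instance] BornRep.grp BornRep.mod

section CHom

variable {Ω : Type} [Field Ω] {R R' Γ Γ' : Type} [CommRing R] [NormedCommRing R'] [Algebra Ω R']
  [Group Γ] [Group Γ']

/-- The continuous homomorphisms from `X` to `V^∨ ⊗ R' = Hom_Ω(V, R')`, for a finite-dimensional
`V`, that are semilinear along `s : R → R'` (linear if `s` is the identity). All the spaces `X`
that occur are locally convex inductive limits of Banach spaces, so that a linear map is continuous
if and only if it maps bounded sets to bounded sets. -/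
def CHom (s : R →+* R') (X : BornRep R Γ) (V : Type) [AddCommMonoid V] [Module Ω V] :
    Submodule Ω (X.M →ₛₗ[s] (V →ₗ[Ω] R')) where
  carrier := {φ | ∀ S, X.IsBdd S → ∀ w : V, ∃ C : ℝ, ∀ m ∈ S, ‖φ m w‖ ≤ C}
  zero_mem' := fun S _ w => ⟨0, fun m _ => by simp⟩
  add_mem' := fun {φ ψ} hφ hψ S hS w => by
    obtain ⟨C, hC⟩ := hφ S hS w
    obtain ⟨C', hC'⟩ := hψ S hS w
    exact ⟨C + C', fun m hm => (norm_add_le _ _).trans (add_le_add (hC m hm) (hC' m hm))⟩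
  smul_mem' := fun c φ hφ S hS w => by
    obtain ⟨C, hC⟩ := hφ S hS w
    refine ⟨‖algebraMap Ω R' c‖ * C, fun m hm => ?_⟩
    have : (c • φ) m w = algebraMap Ω R' c * φ m w := by
      rw [LinearMap.smul_apply, LinearMap.smul_apply, Algebra.smul_def]
    rw [this]
    exact (norm_mul_le _ _).trans (by gcongr; exact hC m hm)

variable {V : Type} [AddCommMonoid V] [Module Ω V]

instance (s : R →+* R') (X : BornRep R Γ) : AddCommGroup (CHom (Ω := Ω) s X V) :=
  Module.addCommMonoidToAddCommGroup Ω

/-- The action of `Γ'` on `Hom(X, V^∨ ⊗ R')`: `(γ φ)(m)(w) = φ(γ⁻¹ m)(γ⁻¹ w)`. -/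
def CHomRep (s : R →+* R') (X : BornRep R Γ) (j : Γ' →* Γ) (τ : Representation Ω Γ' V) :
    Representation Ω Γ' (CHom (Ω := Ω) s X V) where
  toFun γ :=
    { toFun := fun φ => ⟨
        { toFun := fun m => φ.1 (X.ρ (j γ⁻¹) m) ∘ₗ τ γ⁻¹
          map_add' := fun m m' => by rw [map_add, map_add, LinearMap.add_comp]
          map_smul' := fun c m => by
            rw [map_smul, LinearMap.map_smulₛₗ, LinearMap.smul_comp] },
        fun S hS w => by
          obtain ⟨C, hC⟩ := φ.2 _ (X.bdd_map (j γ⁻¹) S hS) (τ γ⁻¹ w)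
          exact ⟨C, fun m hm => hC _ ⟨m, hm, rfl⟩⟩⟩
      map_add' := fun _ _ => rfl
      map_smul' := fun _ _ => rfl }
  map_one' := LinearMap.ext fun φ => Subtype.ext (LinearMap.ext fun m => LinearMap.ext fun w => by
    change φ.1 (X.ρ (j 1⁻¹) m) (τ 1⁻¹ w) = φ.1 m w
    simp)
  map_mul' γ γ' := LinearMap.ext fun φ => Subtype.ext (LinearMap.ext fun m =>
    LinearMap.ext fun w => by
      change φ.1 (X.ρ (j (γ * γ')⁻¹) m) (τ (γ * γ')⁻¹ w)
        = φ.1 (X.ρ (j γ'⁻¹) (X.ρ (j γ⁻¹) m)) (τ γ'⁻¹ (τ γ⁻¹ w))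
      simp only [mul_inv_rev, map_mul, Module.End.mul_apply])

end CHom

/-! ### Algebraic representations -/

section Alg

variable (Ω : Type) [Field Ω]

/-- Homogeneous polynomials of degree `2m` in two variables. -/
abbrev Vk (m : ℕ) : Type := MvPolynomial.homogeneousSubmodule (Fin 2) Ω (2 * m)

variable {Ω}

/-- The substitution `f(X, Y) ↦ f(dX + bY, cX + aY)` for the matrix `(a, b; c, d)`. -/
def polyAct (g : M2 Ω) : MvPolynomial (Fin 2) Ω →ₐ[Ω] MvPolynomial (Fin 2) Ω :=
  MvPolynomial.aeval ![MvPolynomial.C (g 1 1) * MvPolynomial.X 0 + MvPolynomial.C (g 0 1) *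
      MvPolynomial.X 1, MvPolynomial.C (g 1 0) * MvPolynomial.X 0 + MvPolynomial.C (g 0 0) *
      MvPolynomial.X 1]

lemma polyAct_one : polyAct (1 : M2 Ω) = AlgHom.id Ω _ := by
  ext i : 1
  fin_cases i <;> simp [polyAct]

lemma polyAct_mul (g h : M2 Ω) : polyAct (g * h) = (polyAct g).comp (polyAct h) := by
  ext i : 1
  fin_cases i <;> simp [polyAct, Matrix.mul_apply, Fin.sum_univ_two] <;> ring

lemma polyAct_mem {n : ℕ} (g : M2 Ω) {f : MvPolynomial (Fin 2) Ω}
    (hf : f ∈ MvPolynomial.homogeneousSubmodule (Fin 2) Ω n) :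
    polyAct g f ∈ MvPolynomial.homogeneousSubmodule (Fin 2) Ω n := by
  rw [MvPolynomial.mem_homogeneousSubmodule] at hf ⊢
  unfold polyAct
  have := MvPolynomial.IsHomogeneous.aeval (S := Ω) (τ := Fin 2) hf
    ![MvPolynomial.C (g 1 1) * MvPolynomial.X 0 + MvPolynomial.C (g 0 1) *
      MvPolynomial.X 1, MvPolynomial.C (g 1 0) * MvPolynomial.X 0 + MvPolynomial.C (g 0 0) *
      MvPolynomial.X 1] (n := 1) (fun i => by
        fin_cases i
        · exact (MvPolynomial.isHomogeneous_C_mul_X _ _).add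
            (MvPolynomial.isHomogeneous_C_mul_X _ _)
        · exact (MvPolynomial.isHomogeneous_C_mul_X _ _).add
            (MvPolynomial.isHomogeneous_C_mul_X _ _))
  rw [one_mul] at this
  exact this

lemma aeval_scale {B : Type} [CommRing B] [Algebra Ω B] {n : ℕ} {f : MvPolynomial (Fin 2) Ω}
    (hf : f.IsHomogeneous n) (c : B) (x : Fin 2 → B) :
    MvPolynomial.aeval (fun i => c * x i) f = c ^ n * MvPolynomial.aeval x f := by
  rw [MvPolynomial.aeval_def, MvPolynomial.aeval_def, MvPolynomial.eval₂_eq', MvPolynomial.eval₂_eq',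
    Finset.mul_sum]
  refine Finset.sum_congr rfl fun d hd => ?_
  have h := hf.degree_eq_sum_deg_support hd
  rw [show ∑ i ∈ d.support, d i = ∑ i, d i from Finset.sum_subset (Finset.subset_univ _)
    (fun i _ hi => Finsupp.notMem_support_iff.1 hi), Fin.sum_univ_two] at h
  rw [Fin.prod_univ_two, Fin.prod_univ_two, mul_pow, mul_pow, h]
  ring

/-- The action `g ↦ det(g)^{-m} f(dX + bY, cX + aY)` of `GL₂` on `Vk m`. -/
def glRep (m : ℕ) : (M2 Ω)ˣ →* (Vk Ω m →ₗ[Ω] Vk Ω m) where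
  toFun g := ((Matrix.det g.1)⁻¹ ^ m) • (polyAct g.1).toLinearMap.restrict fun _ h => polyAct_mem _ h
  map_one' := LinearMap.ext fun f => Subtype.ext (by
    simp [polyAct_one])
  map_mul' g h := LinearMap.ext fun f => Subtype.ext (by
    change (Matrix.det (g.1 * h.1))⁻¹ ^ m • polyAct (g.1 * h.1) f.1
      = (Matrix.det g.1)⁻¹ ^ m • polyAct g.1 ((Matrix.det h.1)⁻¹ ^ m • polyAct h.1 f.1)
    rw [polyAct_mul, map_smul, smul_smul, Matrix.det_mul, mul_inv, mul_pow]
    rfl)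

/-- The representation of `PGL₂` on `Vk m`. -/
def VkRep (m : ℕ) : Representation Ω (PGL2 Ω) (Vk Ω m) :=
  QuotientGroup.lift _ (glRep m) (by
    rintro _ ⟨z, rfl⟩
    refine LinearMap.ext fun f => Subtype.ext ?_
    have hz : (z : Ω) ≠ 0 := z.ne_zero
    have hd : Matrix.det (algebraMap Ω (M2 Ω) z) = (z : Ω) ^ 2 := by
      rw [Matrix.algebraMap_eq_diagonal, Matrix.det_diagonal]
      simp
    have hp : polyAct (algebraMap Ω (M2 Ω) z)
        = MvPolynomial.aeval (fun i => MvPolynomial.C (z : Ω) * MvPolynomial.X i) := by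
      ext i : 1
      fin_cases i <;> simp [polyAct, Matrix.algebraMap_matrix_apply]
    change ((Matrix.det (algebraMap Ω (M2 Ω) z))⁻¹ ^ m) •
      polyAct (algebraMap Ω (M2 Ω) z) f.1 = f.1
    rw [hd, hp, aeval_scale ((MvPolynomial.mem_homogeneousSubmodule _ _).1 f.2),
      MvPolynomial.aeval_X_left_apply, ← map_pow, ← MvPolynomial.smul_eq_C_mul, smul_smul, inv_pow,
      pow_mul, inv_mul_cancel₀ (by positivity), one_smul])

/-- The tensor product of the representations `Vk (m i)` along homomorphisms `h i : Γ → PGL₂`. -/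
def tensorRep {ι Γ : Type} [Group Γ] (m : ι → ℕ) (h : ι → Γ →* PGL2 Ω) :
    Representation Ω Γ (⨂[Ω] i, Vk Ω (m i)) :=
  (PiTensorProduct.mapMonoidHom (R := Ω) (s := fun i => Vk Ω (m i))).comp
    (MonoidHom.pi fun i => (VkRep (m i)).comp (h i))

/-- `ψ_f(g) = (g f)(1, 0)`. -/
def psi (m : ℕ) (g : PGL2 Ω) : Vk Ω m →ₗ[Ω] Ω :=
  (MvPolynomial.aeval ![(1 : Ω), 0]).toLinearMap ∘ₗ (Submodule.subtype _) ∘ₗ VkRep m g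

lemma psi_mk (m : ℕ) (g : (M2 Ω)ˣ) (f : Vk Ω m) :
    psi m (QuotientGroup.mk g) f
      = (Matrix.det g.1)⁻¹ ^ m * MvPolynomial.aeval ![g.1 1 1, g.1 1 0] f.1 := by
  have h : (MvPolynomial.aeval ![(1 : Ω), 0]).comp (polyAct g.1)
      = MvPolynomial.aeval ![g.1 1 1, g.1 1 0] := by
    ext i
    fin_cases i <;> simp [polyAct]
  rw [← h]
  change MvPolynomial.aeval ![(1 : Ω), 0] (((Matrix.det g.1)⁻¹ ^ m) • polyAct g.1 f.1) = _
  rw [map_smul, smul_eq_mul]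
  rfl

end Alg

section Entries

variable {p : ℕ} [Fact p.Prime] {Fp : Type} [NormedField Fp] [NormedAlgebra ℚ_[p] Fp]

lemma isOpen_unitSet : IsOpen {X : Fin 2 → Fin 2 → Fp | IsUnit (Matrix.of X)} := by
  have : {X : Fin 2 → Fin 2 → Fp | IsUnit (Matrix.of X)}
      = {X | X 0 0 * X 1 1 - X 0 1 * X 1 0 ≠ 0} := by
    ext X
    simp [Matrix.isUnit_iff_isUnit_det, Matrix.det_fin_two]
  rw [this]
  exact isOpen_ne_fun (by fun_prop) (by fun_prop)

lemma isUnit_of_entries (g : (M2 Fp)ˣ) : IsUnit (Matrix.of (entries g)) := g.isUnit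

lemma analyticAt_entry (i j : Fin 2) (X : Fin 2 → Fin 2 → Fp) :
    AnalyticAt ℚ_[p] (fun Y : Fin 2 → Fin 2 → Fp => Y i j) X :=
  ((ContinuousLinearMap.proj (R := ℚ_[p]) (φ := fun _ : Fin 2 => Fp) j).comp
    (ContinuousLinearMap.proj (R := ℚ_[p]) (φ := fun _ : Fin 2 => Fin 2 → Fp) i)).analyticAt X

end Entries

section Beta

variable {p : ℕ} [Fact p.Prime] {Fp : Type} [NormedField Fp] [NormedAlgebra ℚ_[p] Fp]
  [FiniteDimensional ℚ_[p] Fp] {Ω : Type} [NormedField Ω] [NormedAlgebra ℚ_[p] Ω]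
  (m : (Fp →ₐ[ℚ_[p]] Ω) → ℕ)

/-- The one-dimensional representation attached to a character. -/
def charRep {R : Type} [CommRing R] (χ : Fpˣ →* Rˣ) : Representation R Fpˣ R where
  toFun y := (χ y : R) • LinearMap.id
  map_one' := by ext; simp
  map_mul' y z := by ext; simp [mul_comm]

/-- The character `1_k(y) = ∏_σ σ(y)^{-m_σ}` of `F_𝔭ˣ` (of weight `k_σ = 2 m_σ`). -/
def oneK : Fpˣ →* Ωˣ where
  toFun y := ∏ σ : Fp →ₐ[ℚ_[p]] Ω, (Units.map (σ : Fp →* Ω) y)⁻¹ ^ m σ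
  map_one' := by simp
  map_mul' y z := by simp [mul_pow, mul_comm, Finset.prod_mul_distrib]

/-- The representation `V_𝔭 = ⨂_σ V_{k_σ}` of `PGL₂(F_𝔭)`, where `σ` runs through the embeddings
of `F_𝔭`. -/
abbrev Vp : Type := ⨂[Ω] σ, Vk Ω (m σ)

/-- The action of `PGL₂(F_𝔭)` on `V_𝔭`. -/
def VpRep : Representation Ω (PGL2 Fp) (Vp m) :=
  tensorRep m fun σ => PGL2.map (σ : Fp →+* Ω)

/-- `⨂ f_σ ↦ (g ↦ ∏_σ ψ_{f_σ}(σ g))`. -/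
def betaFun : Vp m →ₗ[Ω] (PGL2 Fp → Ω) :=
  LinearMap.pi fun g => PiTensorProduct.lift
    ((MultilinearMap.mkPiAlgebra Ω (Fp →ₐ[ℚ_[p]] Ω) Ω).compLinearMap
      fun σ => psi (m σ) (PGL2.map (σ : Fp →+* Ω) g))

lemma betaFun_tprod (f : ∀ σ, Vk Ω (m σ)) (g : PGL2 Fp) :
    betaFun m (PiTensorProduct.tprod Ω f) g
      = ∏ σ, psi (m σ) (PGL2.map (σ : Fp →+* Ω) g) (f σ) := by
  simp [betaFun]

lemma analyticAt_emb_entry (σ : Fp →ₐ[ℚ_[p]] Ω) (i j : Fin 2) (X : Fin 2 → Fin 2 → Fp) :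
    AnalyticAt ℚ_[p] (fun Y : Fin 2 → Fin 2 → Fp => σ (Y i j)) X :=
  AnalyticAt.comp (f := fun Y : Fin 2 → Fin 2 → Fp => Y i j)
    ((LinearMap.toContinuousLinearMap σ.toLinearMap).analyticAt (X i j)) (analyticAt_entry i j X)

lemma betaFun_isLocAn (w : Vp m) : IsLocAn p (betaFun m w) := by
  induction w using PiTensorProduct.induction_on with
  | smul_tprod c f =>
    rw [map_smul]
    refine IsLocAn.smul c fun g => ?_
    have hev : onMatrices (betaFun m (PiTensorProduct.tprod Ω f)) =ᶠ[nhds (entries g)]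
        fun X => ∏ σ, ((σ (X 0 0) * σ (X 1 1) - σ (X 0 1) * σ (X 1 0))⁻¹ ^ m σ *
          MvPolynomial.aeval ![σ (X 1 1), σ (X 1 0)] (f σ).1) := by
      filter_upwards [isOpen_unitSet.mem_nhds (isUnit_of_entries g)] with X hX
      rw [onMatrices_of _ _ hX, betaFun_tprod]
      refine Finset.prod_congr rfl fun σ _ => ?_
      refine (psi_mk (m σ) _ (f σ)).trans ?_
      simp [Matrix.det_fin_two]
    refine AnalyticAt.congr ?_ hev.symm
    refine Finset.analyticAt_fun_prod _ fun σ _ => ?_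
    refine AnalyticAt.mul (AnalyticAt.pow (AnalyticAt.fun_inv ?_ ?_) _)
      (AnalyticAt.aeval_mvPolynomial (fun i => ?_) _)
    · exact ((analyticAt_emb_entry σ 0 0 _).mul (analyticAt_emb_entry σ 1 1 _)).sub
        ((analyticAt_emb_entry σ 0 1 _).mul (analyticAt_emb_entry σ 1 0 _))
    · have h := (Matrix.isUnit_iff_isUnit_det _).1 (isUnit_of_entries g)
      rw [Matrix.det_fin_two] at h
      rw [← map_mul, ← map_mul, ← map_sub]
      exact (map_ne_zero σ).2 h.ne_zero
    · fin_cases i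
      · exact analyticAt_emb_entry σ 1 1 _
      · exact analyticAt_emb_entry σ 1 0 _
  | add v w hv hw => rw [map_add]; exact hv.add hw

lemma psi_borel (n : ℕ) (a d : Ωˣ) (u : Ω) (b : (M2 Ω)ˣ) (hb : b.1 = !![(a : Ω), u; 0, d])
    (g : PGL2 Ω) (f : Vk Ω n) :
    psi n (QuotientGroup.mk b * g) f = (((a / d)⁻¹ ^ n : Ωˣ) : Ω) * psi n g f := by
  have h1 : psi n (QuotientGroup.mk b * g) f = psi n (QuotientGroup.mk b) (VkRep n g f) := by
    simp only [psi, map_mul]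
    rfl
  have h2 : psi n g f = MvPolynomial.aeval ![(1 : Ω), 0] (VkRep n g f).1 := rfl
  have ha : (a : Ω) ≠ 0 := a.ne_zero
  have hd : (d : Ω) ≠ 0 := d.ne_zero
  rw [h1, h2, psi_mk, hb]
  have h3 : (![!![(a : Ω), u; 0, d] 1 1, !![(a : Ω), u; 0, d] 1 0] : Fin 2 → Ω)
      = fun i => (d : Ω) * (![(1 : Ω), 0] : Fin 2 → Ω) i := by
    funext i
    fin_cases i <;> simp
  rw [h3, aeval_scale ((MvPolynomial.mem_homogeneousSubmodule _ _).1 (VkRep n g f).2), ← mul_assoc]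
  congr 1
  simp only [Matrix.det_fin_two_of, mul_zero, sub_zero, Units.val_pow_eq_pow_val, inv_div,
    Units.val_div_eq_div_val, pow_mul, ← mul_pow]
  congr 1
  field_simp

/-- The embedding `β : V_𝔭 → I_B(1_k)`. -/
def beta : Vp m →ₗ[Ω] Ind p (charRep (oneK m)) :=
  LinearMap.codRestrict _ (betaFun m) fun w => ⟨betaFun_isLocAn m w, fun a d u g => by
    induction w using PiTensorProduct.induction_on with
    | smul_tprod c f =>
      simp only [map_smul, Pi.smul_apply, betaFun_tprod]
      congr 1
      have h : ∀ σ : Fp →ₐ[ℚ_[p]] Ω, psi (m σ) (PGL2.map (σ : Fp →+* Ω) (borel a d u * g)) (f σ)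
          = (((Units.map (σ : Fp →* Ω) (a / d))⁻¹ ^ m σ : Ωˣ) : Ω) *
            psi (m σ) (PGL2.map (σ : Fp →+* Ω) g) (f σ) := fun σ => by
        rw [map_mul, map_div]
        refine psi_borel (m σ) _ _ (σ u) _ ?_ _ _
        ext i j
        fin_cases i <;> fin_cases j <;> simp [borelUnit]
      simp only [h, Finset.prod_mul_distrib]
      have h2 : ((oneK m (a / d) : Ωˣ) : Ω) = ∏ σ : Fp →ₐ[ℚ_[p]] Ω,
          (((Units.map (σ : Fp →* Ω) (a / d))⁻¹ ^ m σ : Ωˣ) : Ω) := by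
        rw [← Units.coe_prod]
        rfl
      rw [← h2]
      rfl
    | add v w hv hw => simp only [map_add, Pi.add_apply, hv, hw]⟩

lemma beta_equivariant (y : PGL2 Fp) (w : Vp m) :
    beta m (VpRep m y w) = indRep (charRep (oneK m)) y (beta m w) := by
  refine Subtype.ext (funext fun x => ?_)
  change betaFun m (VpRep m y w) x = betaFun m w (x * y)
  induction w using PiTensorProduct.induction_on with
  | smul_tprod c f =>
    have h : VpRep m y (PiTensorProduct.tprod Ω f)
        = PiTensorProduct.tprod Ω fun σ => VkRep (m σ) (PGL2.map (σ : Fp →+* Ω) y) (f σ) :=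
      PiTensorProduct.map_tprod _ _
    simp only [map_smul, Pi.smul_apply, h, betaFun_tprod]
    congr 1
    refine Finset.prod_congr rfl fun σ _ => ?_
    simp only [psi, map_mul]
    rfl
  | add v w hv hw => simp only [map_add, Pi.add_apply, hv, hw]

end Beta

section BornHom

variable {R Γ : Type} [CommRing R] [Group Γ]

/-- Linear maps that preserve boundedness, i.e. continuous linear maps. -/
structure BornLin (X Y : BornRep R Γ) where
  /-- the linear map -/
  lin : X.M →ₗ[R] Y.M
  bdd : ∀ S, X.IsBdd S → Y.IsBdd (lin '' S)

/-- Continuous homomorphisms of representations. -/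
structure BornHom (X Y : BornRep R Γ) extends BornLin X Y where
  equivariant : ∀ γ m, lin (X.ρ γ m) = Y.ρ γ (lin m)

/-- The quotient of a representation by a stable submodule: a set is bounded if it is contained in
the image of a bounded set. -/
def BornRep.quot (X : BornRep R Γ) (N : Submodule R X.M) (hN : ∀ γ, N ≤ N.comap (X.ρ γ)) :
    BornRep R Γ where
  M := X.M ⧸ N
  ρ :=
    { toFun := fun γ => N.mapQ N (X.ρ γ) (hN γ)
      map_one' := by ext m; simp
      map_mul' := fun γ γ' => by ext m; simp }
  IsBdd S := ∃ T, X.IsBdd T ∧ S ⊆ N.mkQ '' T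
  bdd_map := by
    rintro γ S ⟨T, hT, hST⟩
    refine ⟨_, X.bdd_map γ T hT, ?_⟩
    rintro _ ⟨x, hx, rfl⟩
    obtain ⟨t, ht, rfl⟩ := hST hx
    exact ⟨_, ⟨t, ht, rfl⟩, rfl⟩

lemma BornRep.quot_split {A P Z : BornRep R Γ} {N : Submodule R A.M} {N' : Submodule R P.M}
    {hN : ∀ γ, N ≤ N.comap (A.ρ γ)} {hN' : ∀ γ, N' ≤ N'.comap (P.ρ γ)}
    (I : BornHom (A.quot N hN) (P.quot N' hN')) (Q : BornHom (P.quot N' hN') Z)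
    (i : A.M →ₗ[R] P.M) (q : P.M →ₗ[R] Z.M) (hI : ∀ f, I.lin (N.mkQ f) = N'.mkQ (i f))
    (hQ : ∀ x, Q.lin (N'.mkQ x) = q x) (t : BornLin P A) (r : BornLin Z P)
    (ht : N' ≤ N.comap t.lin) (h1 : ∀ x, t.lin (i x) = x)
    (h2 : ∀ z, q (r.lin z) = z) (h3 : ∀ y, i (t.lin y) + r.lin (q y) = y) :
    ∃ (t' : BornLin (P.quot N' hN') (A.quot N hN)) (r' : BornLin Z (P.quot N' hN')),
      (∀ x, t'.lin (I.lin x) = x) ∧ (∀ z, Q.lin (r'.lin z) = z) ∧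
        ∀ y, I.lin (t'.lin y) + r'.lin (Q.lin y) = y := by
  refine ⟨⟨N'.mapQ N t.lin ht, ?_⟩, ⟨N'.mkQ ∘ₗ r.lin, ?_⟩, ?_, ?_, ?_⟩
  · rintro S ⟨U, hU, hSU⟩
    refine ⟨t.lin '' U, t.bdd U hU, ?_⟩
    rintro _ ⟨x, hx, rfl⟩
    obtain ⟨u, hu, rfl⟩ := hSU hx
    exact ⟨_, ⟨u, hu, rfl⟩, rfl⟩
  · intro S hS
    refine ⟨r.lin '' S, r.bdd S hS, ?_⟩
    rintro _ ⟨w, hw, rfl⟩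
    exact ⟨_, ⟨w, hw, rfl⟩, rfl⟩
  · intro x
    obtain ⟨f, rfl⟩ := N.mkQ_surjective x
    rw [hI]
    exact congrArg N.mkQ (h1 f)
  · intro z
    exact (hQ (r.lin z)).trans (h2 z)
  · intro y
    obtain ⟨x, rfl⟩ := N'.mkQ_surjective y
    rw [hQ]
    exact (congrArg (fun u : P.M ⧸ N' => u + N'.mkQ (r.lin (q x))) (hI (t.lin x))).trans
      (congrArg N'.mkQ (h3 x))

variable {Ω : Type} [Field Ω] {R' Γ' : Type} [NormedCommRing R'] [Algebra Ω R'] [Group Γ']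
  {V : Type} [AddCommMonoid V] [Module Ω V]

/-- Precomposition with a continuous linear map. -/
def BornLin.pre {X Y : BornRep R Γ} (s : R →+* R') (f : BornLin X Y) :
    CHom (Ω := Ω) s Y V →ₗ[Ω] CHom (Ω := Ω) s X V where
  toFun φ := ⟨φ.1 ∘ₛₗ f.lin, fun S hS w => by
    obtain ⟨C, hC⟩ := φ.2 _ (f.bdd S hS) w
    exact ⟨C, fun m hm => hC _ ⟨m, hm, rfl⟩⟩⟩
  map_add' _ _ := rfl
  map_smul' _ _ := rfl

lemma BornHom.pre_equivariant {X Y : BornRep R Γ} (s : R →+* R') (f : BornHom X Y) (j : Γ' →* Γ)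
    (τ : Representation Ω Γ' V) (γ : Γ') (φ : CHom (Ω := Ω) s Y V) :
    f.toBornLin.pre s (CHomRep s Y j τ γ φ) = CHomRep s X j τ γ (f.toBornLin.pre s φ) := by
  refine Subtype.ext (LinearMap.ext fun m => LinearMap.ext fun w => ?_)
  change φ.1 (Y.ρ (j γ⁻¹) (f.lin m)) (τ γ⁻¹ w) = φ.1 (f.lin (X.ρ (j γ⁻¹) m)) (τ γ⁻¹ w)
  rw [f.equivariant]

variable {G : Type} [Group G]

/-- The modules of coefficients `𝓕(G/K, Hom(X, V^∨ ⊗ R'))`. -/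
def dualCoeff (K H : Subgroup G) (j : Γ' →* G) (s : R →+* R') (X : BornRep R Γ) (jp : Γ' →* Γ)
    (τ : Representation Ω Γ' V) : Rep (HeckeT Ω K H) Γ' :=
  coeff Ω K H j (X := CHom (Ω := Ω) s X V) (CHomRep s X jp τ)

/-- An element of the module of coefficients as a linear map. -/
def dualCoeff.lin {K H : Subgroup G} {j : Γ' →* G} {s : R →+* R'} {X : BornRep R Γ} {jp : Γ' →* Γ}
    {τ : Representation Ω Γ' V} (f : dualCoeff K H j s X jp τ) :
    ((G ⧸ K) →₀ Ω) →ₗ[Ω] CHom (Ω := Ω) s X V := f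

lemma dualCoeff.ext {K H : Subgroup G} {j : Γ' →* G} {s : R →+* R'} {X : BornRep R Γ}
    {jp : Γ' →* Γ} {τ : Representation Ω Γ' V} {f g : dualCoeff K H j s X jp τ}
    (h : ∀ x m, (dualCoeff.lin f x).1 m = (dualCoeff.lin g x).1 m) : f = g :=
  LinearMap.ext (f := dualCoeff.lin f) (g := dualCoeff.lin g) fun x => Subtype.ext (LinearMap.ext (h x))

/-- The homomorphism of coefficients induced by `f : X → Y`. -/
def dualCoeffMap (K H : Subgroup G) (j : Γ' →* G) (s : R →+* R') {X Y : BornRep R Γ}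
    (f : BornHom X Y) (jp : Γ' →* Γ) (τ : Representation Ω Γ' V) :
    dualCoeff K H j s Y jp τ ⟶ dualCoeff K H j s X jp τ :=
  coeffMap Ω K H j (X := CHom (Ω := Ω) s Y V) (Y := CHom (Ω := Ω) s X V) (f.toBornLin.pre s) (f.pre_equivariant s jp τ)

/-- A short exact sequence `0 → X → Y → Z → 0` of representations that is split as a sequence
of topological vector spaces. -/
structure StrictSES (X Y Z : BornRep R Γ) where
  /-- `X → Y` -/
  i : BornHom X Y
  /-- `Y → Z` -/
  q : BornHom Y Z
  comp_eq_zero : ∀ x, q.lin (i.lin x) = 0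
  exists_split : ∃ (t : BornLin Y X) (r : BornLin Z Y), (∀ x, t.lin (i.lin x) = x) ∧
    (∀ z, q.lin (r.lin z) = z) ∧ ∀ y, i.lin (t.lin y) + r.lin (q.lin y) = y

variable {X Y Z : BornRep R Γ}

/-- The dual of a short exact sequence, with coefficients `𝓕(G/K, Hom(·, V^∨ ⊗ R'))`. -/
def StrictSES.dual (E : StrictSES X Y Z) (K H : Subgroup G) (j : Γ' →* G) (s : R →+* R')
    (jp : Γ' →* Γ) (τ : Representation Ω Γ' V) : ShortComplex (Rep (HeckeT Ω K H) Γ') :=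
  ShortComplex.mk (dualCoeffMap K H j s E.q jp τ) (dualCoeffMap K H j s E.i jp τ) (by
    ext f
    refine dualCoeff.ext fun x m => ?_
    exact (congrArg (dualCoeff.lin f x).1 (E.comp_eq_zero m)).trans (map_zero _))

lemma StrictSES.dual_shortExact (E : StrictSES X Y Z) (K H : Subgroup G) (j : Γ' →* G)
    (s : R →+* R') (jp : Γ' →* Γ) (τ : Representation Ω Γ' V) :
    (E.dual K H j s jp τ).ShortExact := by
  obtain ⟨t, r, hti, hqr, hadd⟩ := E.exists_split
  refine { exact := ?_, mono_f := ?_, epi_g := ?_ }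
  · rw [← ShortComplex.exact_map_iff_of_faithful _ (forget₂ (Rep (HeckeT Ω K H) Γ')
      (ModuleCat (HeckeT Ω K H))), ShortComplex.moduleCat_exact_iff]
    intro (f : dualCoeff K H j s Y jp τ) hf
    refine ⟨(r.pre s ∘ₗ dualCoeff.lin f : ((G ⧸ K) →₀ Ω) →ₗ[Ω] CHom (Ω := Ω) s Z V), ?_⟩
    refine dualCoeff.ext fun x m => ?_
    have h1 : (dualCoeff.lin f x).1 (E.i.lin (t.lin m)) = 0 :=
      LinearMap.congr_fun (congrArg Subtype.val (LinearMap.congr_fun hf x)) (t.lin m)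
    change (dualCoeff.lin f x).1 (r.lin (E.q.lin m)) = (dualCoeff.lin f x).1 m
    conv_rhs => rw [← hadd m, map_add, h1, zero_add]
  · rw [Rep.mono_iff_injective]
    intro (f : dualCoeff K H j s Z jp τ) (g : dualCoeff K H j s Z jp τ) hfg
    refine dualCoeff.ext fun x z => ?_
    have h := LinearMap.congr_fun (congrArg Subtype.val (LinearMap.congr_fun hfg x)) (r.lin z)
    change (dualCoeff.lin f x).1 (E.q.lin (r.lin z)) = (dualCoeff.lin g x).1 (E.q.lin (r.lin z)) at h
    rwa [hqr] at h
  · rw [Rep.epi_iff_surjective]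
    intro (f : dualCoeff K H j s X jp τ)
    refine ⟨(t.pre s ∘ₗ dualCoeff.lin f : ((G ⧸ K) →₀ Ω) →ₗ[Ω] CHom (Ω := Ω) s Y V), ?_⟩
    refine dualCoeff.ext fun x m => ?_
    exact congrArg (dualCoeff.lin f x).1 (hti m)

/-- The boundary map `Hⁿ(N, 𝓕(G/K, Hom(X, V^∨ ⊗ R'))) → Hⁿ⁺¹(N, 𝓕(G/K, Hom(Z, V^∨ ⊗ R')))` of the
dual of a short exact sequence `0 → X → Y → Z → 0`. -/
def StrictSES.boundary (E : StrictSES X Y Z) (K H : Subgroup G) (j : Γ' →* G) (s : R →+* R')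
    (jp : Γ' →* Γ) (τ : Representation Ω Γ' V) (N : Subgroup Γ') (n : ℕ) :
    coh N (dualCoeff K H j s X jp τ) n →ₗ[HeckeT Ω K H]
      coh N (dualCoeff K H j s Z jp τ) (n + 1) :=
  (groupCohomology.δ ((Rep.shortExact_res N.subtype).2 (E.dual_shortExact K H j s jp τ))
    n (n + 1) rfl).hom

end BornHom

/-! ### Extensions attached to logarithms -/

section Lambda

variable (p : ℕ) [Fact p.Prime] {Fp : Type} [NormedField Fp] [NormedAlgebra ℚ_[p] Fp]

open Classical in
/-- A function on `F_𝔭ˣ`, extended by zero. -/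
def onField {W : Type} [Zero W] (f : Fpˣ → W) (z : Fp) : W :=
  if h : z ≠ 0 then f (Units.mk0 z h) else 0

/-- `f` is a locally `ℚ_p`-analytic function on `F_𝔭ˣ`. -/
def IsLocAnUnits {W : Type} [NormedAddCommGroup W] [NormedSpace ℚ_[p] W] (f : Fpˣ → W) : Prop :=
  ∀ y : Fpˣ, AnalyticAt ℚ_[p] (onField f) (y : Fp)

lemma onField_unit {W : Type} [Zero W] (f : Fpˣ → W) (z : Fp) (y : Fpˣ) (h : z = y) :
    onField f z = f y := by
  subst h
  rw [onField, dif_pos y.ne_zero]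
  congr 1
  ext
  rfl

variable {Ω : Type} [NormedField Ω] [NormedAlgebra ℚ_[p] Ω]

lemma isUltra (p : ℕ) [Fact p.Prime] (Fp : Type) [NormedField Fp] [NormedAlgebra ℚ_[p] Fp] :
    IsUltrametricDist Fp := by
  refine IsUltrametricDist.isUltrametricDist_of_forall_norm_natCast_le_one fun n => ?_
  have h : ((n : ℚ_[p]) • (1 : Fp)) = (n : Fp) := by
    rw [← Algebra.algebraMap_eq_smul_one, map_natCast]
  rw [← h, norm_smul, norm_one, mul_one]
  exact Padic.norm_int_le_one (n : ℤ)

open Classical in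
/-- The function `λ(det/c²)` if `|d| ≤ |c|` and `λ(det/d²)` otherwise, for a matrix with lower row
`(c, d)`. -/
def logMat (l : Fpˣ → Ω) (X : Fin 2 → Fin 2 → Fp) : Ω :=
  onField l ((X 0 0 * X 1 1 - X 0 1 * X 1 0) *
    (if ‖X 1 1‖ ≤ ‖X 1 0‖ then X 1 0 else X 1 1)⁻¹ ^ 2)

lemma logMat_analyticAt {l : Fpˣ → Ω} (hl : IsLocAnUnits p l) (g : (M2 Fp)ˣ) :
    AnalyticAt ℚ_[p] (logMat l) (entries g) := by
  have : IsUltrametricDist Fp := isUltra p Fp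
  have hdet : entries g 0 0 * entries g 1 1 - entries g 0 1 * entries g 1 0 ≠ 0 := by
    have h := (Matrix.isUnit_iff_isUnit_det _).1 g.isUnit
    rw [Matrix.det_fin_two] at h
    exact h.ne_zero
  have key : ∀ j : Fin 2, entries g 1 j ≠ 0 → AnalyticAt ℚ_[p] (fun X : Fin 2 → Fin 2 → Fp =>
      onField l ((X 0 0 * X 1 1 - X 0 1 * X 1 0) * (X 1 j)⁻¹ ^ 2)) (entries g) := by
    intro j hj
    have hne : (entries g 0 0 * entries g 1 1 - entries g 0 1 * entries g 1 0) *
        (entries g 1 j)⁻¹ ^ 2 ≠ 0 := mul_ne_zero hdet (pow_ne_zero _ (inv_ne_zero hj))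
    refine AnalyticAt.comp (g := onField l) (f := fun X : Fin 2 → Fin 2 → Fp =>
      ((X 0 0 * X 1 1 - X 0 1 * X 1 0) * (X 1 j)⁻¹ ^ 2)) (hl (Units.mk0 _ hne)) ?_
    exact (((analyticAt_entry 0 0 _).mul (analyticAt_entry 1 1 _)).sub
      ((analyticAt_entry 0 1 _).mul (analyticAt_entry 1 0 _))).mul
        ((AnalyticAt.fun_inv (f := fun X : Fin 2 → Fin 2 → Fp => X 1 j)
          (analyticAt_entry 1 j _) hj).pow 2)
  have hcont : ∀ j : Fin 2, Continuous fun X : Fin 2 → Fin 2 → Fp => X 1 j := fun j => by fun_prop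
  have hloc : ∀ z : Fp, z ≠ 0 → ∀ᶠ y in nhds z, ‖y‖ = ‖z‖ := fun z hz => by
    filter_upwards [Metric.ball_mem_nhds z (norm_pos_iff.2 hz)] with y hy
    rw [Metric.mem_ball, dist_eq_norm] at hy
    have h : ‖y + -z‖ < max ‖y‖ ‖-z‖ := by
      rw [← sub_eq_add_neg, norm_neg]
      exact lt_max_of_lt_right hy
    simpa using IsUltrametricDist.norm_eq_of_add_norm_lt_max h
  by_cases hcd : ‖entries g 1 1‖ ≤ ‖entries g 1 0‖
  · have hc : entries g 1 0 ≠ 0 := by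
      intro h
      rw [h, norm_zero, norm_le_zero_iff] at hcd
      exact hdet (by rw [h, hcd]; ring)
    refine (key 0 hc).congr ?_
    have h1 := (hcont 0).continuousAt.eventually (hloc _ hc)
    have h2 : ∀ᶠ y in nhds (entries g 1 1), ‖y‖ ≤ ‖entries g 1 0‖ := by
      have := (IsUltrametricDist.isOpen_closedBall (0 : Fp) (norm_ne_zero_iff.2 hc)).mem_nhds
        (show entries g 1 1 ∈ Metric.closedBall 0 ‖entries g 1 0‖ by simpa using hcd)
      filter_upwards [this] with y hy
      simpa using hy
    filter_upwards [h1, (hcont 1).continuousAt.eventually h2] with X hX1 hX2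
    rw [logMat, if_pos (by rw [hX1]; exact hX2)]
  · have hd : entries g 1 1 ≠ 0 := fun h => hcd (by rw [h, norm_zero]; exact norm_nonneg _)
    refine (key 1 hd).congr ?_
    have h1 := (hcont 1).continuousAt.eventually (hloc _ hd)
    have h2 : ∀ᶠ y in nhds (entries g 1 0), ‖y‖ < ‖entries g 1 1‖ :=
      continuous_norm.continuousAt.eventually (gt_mem_nhds (not_le.1 hcd))
    filter_upwards [h1, (hcont 0).continuousAt.eventually h2] with X hX1 hX2
    rw [logMat, if_neg (by rw [hX1, not_le]; exact hX2)]

lemma logMat_mul (l : Additive Fpˣ →+ Ω) (a d : Fpˣ) (u : Fp) (g : (M2 Fp)ˣ) :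
    logMat (fun y => l (Additive.ofMul y)) (entries (borelUnit a d u * g))
      = l (Additive.ofMul (a / d)) + logMat (fun y => l (Additive.ofMul y)) (entries g) := by
  have hdet : entries g 0 0 * entries g 1 1 - entries g 0 1 * entries g 1 0 ≠ 0 := by
    have h := (Matrix.isUnit_iff_isUnit_det _).1 g.isUnit
    rw [Matrix.det_fin_two] at h
    exact h.ne_zero
  have e1 : ∀ j, entries (borelUnit a d u * g) 1 j = d * entries g 1 j := fun j => by
    simp [entries, borelUnit, Matrix.mul_apply, Fin.sum_univ_two]
  have e0 : ∀ j, entries (borelUnit a d u * g) 0 j = a * entries g 0 j + u * entries g 1 j :=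
    fun j => by simp [entries, borelUnit, Matrix.mul_apply, Fin.sum_univ_two]
  have hd : (d : Fp) ≠ 0 := d.ne_zero
  have hiff : ‖entries (borelUnit a d u * g) 1 1‖ ≤ ‖entries (borelUnit a d u * g) 1 0‖ ↔
      ‖entries g 1 1‖ ≤ ‖entries g 1 0‖ := by
    rw [e1, e1, norm_mul, norm_mul, mul_le_mul_iff_right₀ (norm_pos_iff.2 hd)]
  have main : ∀ z : Fp, z ≠ 0 →
      onField (fun y => l (Additive.ofMul y)) ((entries (borelUnit a d u * g) 0 0 *
        entries (borelUnit a d u * g) 1 1 - entries (borelUnit a d u * g) 0 1 *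
        entries (borelUnit a d u * g) 1 0) * (d * z)⁻¹ ^ 2)
      = l (Additive.ofMul (a / d)) + onField (fun y => l (Additive.ofMul y))
        ((entries g 0 0 * entries g 1 1 - entries g 0 1 * entries g 1 0) * z⁻¹ ^ 2) := by
    intro z hz
    have hne := mul_ne_zero hdet (pow_ne_zero 2 (inv_ne_zero hz))
    rw [onField_unit (fun y => l (Additive.ofMul y)) ((entries g 0 0 * entries g 1 1 -
        entries g 0 1 * entries g 1 0) * z⁻¹ ^ 2) (Units.mk0 _ hne) rfl,
      onField_unit _ _ (a / d * Units.mk0 _ hne), ofMul_mul, map_add]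
    rw [e0, e0, e1, e1, Units.val_mul, Units.val_div_eq_div_val, Units.val_mk0]
    field_simp
    ring
  by_cases hcd : ‖entries g 1 1‖ ≤ ‖entries g 1 0‖
  · have hc : entries g 1 0 ≠ 0 := by
      intro h
      rw [h, norm_zero, norm_le_zero_iff] at hcd
      exact hdet (by rw [h, hcd]; ring)
    rw [logMat, logMat, if_pos (hiff.2 hcd), if_pos hcd]
    have := main _ hc
    rw [← e1 0] at this
    exact this
  · have hd' : entries g 1 1 ≠ 0 := fun h => hcd (by rw [h, norm_zero]; exact norm_nonneg _)
    rw [logMat, logMat, if_neg (mt hiff.1 hcd), if_neg hcd]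
    have := main _ hd'
    rw [← e1 1] at this
    exact this

/-- There is a locally analytic function `Λ` on `PGL₂(F_𝔭)` with `Λ(b g) = λ(b) + Λ(g)`. -/
lemma exists_log (l : Additive Fpˣ →+ Ω) (hl : IsLocAnUnits p fun y => l (Additive.ofMul y)) :
    ∃ L : PGL2 Fp → Ω, IsLocAn p L ∧
      ∀ a d u g, L (borel a d u * g) = l (Additive.ofMul (a / d)) + L g := by
  have hsc : ∀ (g z : (M2 Fp)ˣ), z ∈ scalarUnits Fp (M2 Fp) →
      logMat (fun y => l (Additive.ofMul y)) (entries (g * z))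
        = logMat (fun y => l (Additive.ofMul y)) (entries g) := by
    rintro g _ ⟨z, rfl⟩
    have h : g * Units.map (algebraMap Fp (M2 Fp) : Fp →* M2 Fp) z = borelUnit z z 0 * g := by
      have hb : borelUnit z z 0 = Units.map (algebraMap Fp (M2 Fp) : Fp →* M2 Fp) z := by
        ext i j
        fin_cases i <;> fin_cases j <;> simp [borelUnit, Matrix.algebraMap_matrix_apply]
      rw [hb]
      ext1
      exact (Algebra.commutes (z : Fp) g.1).symm
    rw [h, logMat_mul, div_self']
    simp
  refine ⟨fun g => Quotient.liftOn' g (fun h => logMat (fun y => l (Additive.ofMul y)) (entries h))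
    fun x y hxy => ?_, fun g => ?_, fun a d u g => ?_⟩
  · rw [QuotientGroup.leftRel_apply] at hxy
    have := hsc x _ hxy
    rw [mul_inv_cancel_left] at this
    exact this.symm
  · refine (logMat_analyticAt p hl g).congr ?_
    filter_upwards [isOpen_unitSet.mem_nhds (isUnit_of_entries g)] with X hX
    rw [onMatrices_of _ _ hX]
    rfl
  · obtain ⟨g, rfl⟩ := QuotientGroup.mk_surjective g
    exact logMat_mul l a d u g

end Lambda

section Ext

variable {p : ℕ} [Fact p.Prime] {Fp : Type} [NormedField Fp] [NormedAlgebra ℚ_[p] Fp]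

section

variable {W : Type} [NormedAddCommGroup W] [NormedSpace ℚ_[p] W]
  {R : Type} [NormedCommRing R] [NormedAlgebra ℚ_[p] R] [Module R W] [IsBoundedSMul R W]
  [IsScalarTower ℚ_[p] R W]

/-- `I_B(ρ)` with its bounded sets. -/
def indB (ρ : Representation R Fpˣ W) : BornRep R (PGL2 Fp) where
  M := Ind p ρ
  ρ := indRep ρ
  IsBdd S := IsLocBdd p (Subtype.val '' S)
  bdd_map y S hS := (hS.translate y).mono (by
    rintro _ ⟨_, ⟨f, hf, rfl⟩, rfl⟩
    exact ⟨f.1, ⟨f, hf, rfl⟩, rfl⟩)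

lemma isLocBdd_sum (C : ℝ) : ∀ (n : ℕ) (f : Fin n → PGL2 Fp → W), (∀ i, IsLocAn p (f i)) →
    IsLocBdd p {h | ∃ c : Fin n → R, (∀ i, ‖c i‖ ≤ C) ∧ h = ∑ i, c i • f i}
  | 0, _, _ => ((IsLocAn.zero (W := W)).isLocBdd_smul (R := R) ‖(0 : R)‖).mono (by
      rintro _ ⟨c, -, rfl⟩
      exact ⟨0, le_rfl, by simp⟩)
  | n + 1, f, hf => (((hf 0).isLocBdd_smul (R := R) C).add
      (isLocBdd_sum C n (fun i => f i.succ) fun i => hf i.succ)).mono (by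
        rintro _ ⟨c, hc, rfl⟩
        rw [Fin.sum_univ_succ]
        exact ⟨_, ⟨c 0, hc 0, rfl⟩, _, ⟨fun i => c i.succ, fun i => hc i.succ, rfl⟩, rfl⟩)

end

variable [FiniteDimensional ℚ_[p] Fp] {Ω : Type} [NormedField Ω] [NormedAlgebra ℚ_[p] Ω]
  (m : (Fp →ₐ[ℚ_[p]] Ω) → ℕ)

/-- The finite-dimensional space `V_𝔭`: a set is bounded if it consists of linear combinations of
finitely many vectors with bounded coefficients. -/
def VpB : BornRep Ω (PGL2 Fp) where
  M := Vp m
  ρ := VpRep m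
  IsBdd S := ∃ (n : ℕ) (v : Fin n → Vp m) (C : ℝ), ∀ w ∈ S,
    ∃ c : Fin n → Ω, (∀ i, ‖c i‖ ≤ C) ∧ w = ∑ i, c i • v i
  bdd_map := by
    rintro y S ⟨n, v, C, h⟩
    refine ⟨n, fun i => VpRep m y (v i), C, ?_⟩
    rintro _ ⟨w, hw, rfl⟩
    obtain ⟨c, hc, rfl⟩ := h w hw
    exact ⟨c, hc, by simp⟩

lemma VpB_mono {S T : Set (Vp m)} (hT : (VpB m).IsBdd T) (h : S ⊆ T) : (VpB m).IsBdd S := by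
  obtain ⟨n, v, C, hC⟩ := hT
  exact ⟨n, v, C, fun w hw => hC w (h hw)⟩

lemma VpB_image {W : Type} [NormedAddCommGroup W] [NormedSpace ℚ_[p] W] [Module Ω W]
    [IsBoundedSMul Ω W] [IsScalarTower ℚ_[p] Ω W] (T : Vp m →ₗ[Ω] (PGL2 Fp → W))
    (hT : ∀ w, IsLocAn p (T w)) {S : Set (Vp m)} (hS : (VpB m).IsBdd S) : IsLocBdd p (T '' S) := by
  obtain ⟨n, v, C, h⟩ := hS
  refine (isLocBdd_sum (R := Ω) C n (fun i => T (v i)) fun i => hT _).mono ?_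
  rintro _ ⟨w, hw, rfl⟩
  obtain ⟨c, hc, rfl⟩ := h w hw
  exact ⟨c, hc, by simp⟩

/-- `I_B(1_k)`. -/
def indOne : BornRep Ω (PGL2 Fp) := indB (p := p) (charRep (oneK m))

/-- The locally analytic Steinberg representation `St^an = I_B(1_k) / V_𝔭`. -/
def steinberg : BornRep Ω (PGL2 Fp) :=
  (indOne m).quot (LinearMap.range (beta m)) (by
    rintro y _ ⟨w, rfl⟩
    exact ⟨VpRep m y w, beta_equivariant m y w⟩)

variable (l : Additive Fpˣ →+ Ω)

/-- The representation `τ_λ ⊗ 1_k` on `Ω²`, where `τ_λ(y)` is the unipotent matrix with upper right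
entry `λ(y)`. -/
def tauRep : Representation Ω Fpˣ (Ω × Ω) where
  toFun y := (oneK m y : Ω) • LinearMap.prod
    (LinearMap.fst Ω Ω Ω + l (Additive.ofMul y) • LinearMap.snd Ω Ω Ω) (LinearMap.snd Ω Ω Ω)
  map_one' := by
    refine LinearMap.ext fun w => ?_
    simp
  map_mul' y z := by
    refine LinearMap.ext fun w => Prod.ext ?_ ?_
    · simp
      ring
    · simp
      ring

lemma tauRep_fst (y : Fpˣ) (w : Ω × Ω) :
    (tauRep m l y w).1 = oneK m y * (w.1 + l (Additive.ofMul y) * w.2) := rfl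

lemma tauRep_snd (y : Fpˣ) (w : Ω × Ω) : (tauRep m l y w).2 = oneK m y * w.2 := rfl

/-- The pullback of `0 → I_B(1_k) → I_B(τ_λ ⊗ 1_k) → I_B(1_k) → 0` along `β : V_𝔭 → I_B(1_k)`. -/
def pullMod : Submodule Ω (Ind p (tauRep m l) × Vp m) where
  carrier := {x | ∀ g, (x.1.1 g).2 = (beta m x.2).1 g}
  zero_mem' := fun g => by simp
  add_mem' := fun {x y} hx hy g => by
    have h1 := hx g
    have h2 := hy g
    simp only [Prod.snd_add, Prod.fst_add, map_add, Submodule.coe_add, Pi.add_apply] at h1 h2 ⊢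
    rw [h1, h2]
  smul_mem' := fun c x hx g => by
    have h1 := hx g
    simp only [Prod.smul_snd, Prod.smul_fst, map_smul, Submodule.coe_smul, Pi.smul_apply] at h1 ⊢
    rw [h1]

instance : AddCommGroup (pullMod m l) := Module.addCommMonoidToAddCommGroup Ω

/-- The action on this pullback. -/
def pullRep : Representation Ω (PGL2 Fp) (pullMod m l) where
  toFun y := LinearMap.restrict (p := pullMod m l) (q := pullMod m l)
    (LinearMap.prodMap (indRep (tauRep m l) y) (VpRep m y)) fun x hx g => by
      change (x.1.1 (g * y)).2 = (beta m (VpRep m y x.2)).1 g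
      rw [beta_equivariant]
      exact hx (g * y)
  map_one' := LinearMap.ext fun x => Subtype.ext (Prod.ext
    (LinearMap.congr_fun (map_one (indRep (tauRep m l))) x.1.1)
    (LinearMap.congr_fun (map_one (VpRep m)) x.1.2))
  map_mul' y z := LinearMap.ext fun x => Subtype.ext (Prod.ext
    (LinearMap.congr_fun (map_mul (indRep (tauRep m l)) y z) x.1.1)
    (LinearMap.congr_fun (map_mul (VpRep m) y z) x.1.2))

/-- This pullback as a representation: a set is bounded if both its projections are. -/
def pullB : BornRep Ω (PGL2 Fp) where
  M := pullMod m l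
  ρ := pullRep m l
  IsBdd S := (indB (p := p) (tauRep m l)).IsBdd ((fun x => x.1.1) '' S) ∧
    (VpB m).IsBdd ((fun x => x.1.2) '' S)
  bdd_map y S hS := by
    refine ⟨IsLocBdd.mono ((indB (p := p) (tauRep m l)).bdd_map y _ hS.1) ?_,
      VpB_mono m ((VpB m).bdd_map y _ hS.2) ?_⟩
    · rintro _ ⟨_, ⟨_, ⟨x, hx, rfl⟩, rfl⟩, rfl⟩
      exact ⟨_, ⟨_, ⟨x, hx, rfl⟩, rfl⟩, rfl⟩
    · rintro _ ⟨_, ⟨x, hx, rfl⟩, rfl⟩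
      exact ⟨_, ⟨x, hx, rfl⟩, rfl⟩

/-- `I_B(1_k) → I_B(τ_λ ⊗ 1_k)`, `f ↦ (f, 0)`, as a map to the pullback. -/
def inclPull : Ind p (charRep (oneK m)) →ₗ[Ω] pullMod m l where
  toFun f := ⟨(⟨fun g => (f.1 g, 0), f.2.1.comp (ContinuousLinearMap.inl ℚ_[p] Ω Ω),
    fun a d u g => by
      refine Prod.ext ?_ ?_
      · rw [tauRep_fst, mul_zero, add_zero]
        exact f.2.2 a d u g
      · rw [tauRep_snd, mul_zero]⟩, 0), fun g => by
      simp⟩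
  map_add' f h := by
    refine Subtype.ext (Prod.ext (Subtype.ext (funext fun g => ?_)) ?_)
    · exact Prod.ext rfl (add_zero 0).symm
    · exact (add_zero 0).symm
  map_smul' c f := by
    refine Subtype.ext (Prod.ext (Subtype.ext (funext fun g => ?_)) ?_)
    · exact Prod.ext rfl (mul_zero c).symm
    · exact (smul_zero c).symm

/-- The extension `E_λ` of `V_𝔭` by `St^an`: the pushout of the pullback along
`I_B(1_k) → St^an`. -/
def extB : BornRep Ω (PGL2 Fp) :=
  (pullB m l).quot (LinearMap.range (inclPull m l ∘ₗ beta m)) (by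
    rintro y _ ⟨w, rfl⟩
    refine ⟨VpRep m y w, ?_⟩
    change inclPull m l (beta m (VpRep m y w)) = (pullB m l).ρ y (inclPull m l (beta m w))
    rw [beta_equivariant]
    exact Subtype.ext (Prod.ext rfl (map_zero (VpRep m y)).symm))

/-- `St^an → E_λ`. -/
def extIncl : BornHom (steinberg m) (extB m l) where
  lin := Submodule.mapQ _ _ (inclPull m l) (by
    rintro _ ⟨w, rfl⟩
    exact ⟨w, rfl⟩)
  bdd := by
    rintro S ⟨T, hT, hST⟩
    refine ⟨inclPull m l '' T, ⟨?_, ?_⟩, ?_⟩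
    · refine (IsLocBdd.comp (ContinuousLinearMap.inl ℚ_[p] Ω Ω) hT).mono ?_
      rintro _ ⟨_, ⟨_, ⟨f, hf, rfl⟩, rfl⟩, rfl⟩
      exact ⟨f.1, ⟨f, hf, rfl⟩, rfl⟩
    · refine ⟨0, fun i => i.elim0, 0, ?_⟩
      rintro _ ⟨_, ⟨f, hf, rfl⟩, rfl⟩
      exact ⟨fun i => i.elim0, fun i => i.elim0, rfl⟩
    · rintro _ ⟨x, hx, rfl⟩
      obtain ⟨t, ht, rfl⟩ := hST hx
      exact ⟨_, ⟨t, ht, rfl⟩, rfl⟩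
  equivariant y x := by
    obtain ⟨f, rfl⟩ := Submodule.mkQ_surjective _ x
    refine congrArg (Submodule.mkQ _) ?_
    exact Subtype.ext (Prod.ext rfl (map_zero (VpRep m y)).symm)

/-- `E_λ → V_𝔭`. -/
def extProj : BornHom (extB m l) (VpB m) where
  lin := Submodule.liftQ _ (LinearMap.snd Ω _ _ ∘ₗ (pullMod m l).subtype) (by
    rintro _ ⟨w, rfl⟩
    rfl)
  bdd := by
    rintro S ⟨T, hT, hST⟩
    obtain ⟨n, v, C, h⟩ := hT.2
    refine ⟨n, v, C, ?_⟩
    rintro _ ⟨x, hx, rfl⟩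
    obtain ⟨t, ht, rfl⟩ := hST hx
    exact h _ ⟨t, ht, rfl⟩
  equivariant y x := by
    obtain ⟨f, rfl⟩ := Submodule.mkQ_surjective _ x
    rfl

lemma onMatrices_mul (f h : PGL2 Fp → Ω) : onMatrices (f * h) = onMatrices f * onMatrices h := by
  funext X
  by_cases hX : IsUnit (Matrix.of X)
  · simp [onMatrices_of _ _ hX]
  · simp [onMatrices_of_not _ _ hX]

lemma IsLocAn.mul {f h : PGL2 Fp → Ω} (hf : IsLocAn p f) (hh : IsLocAn p h) :
    IsLocAn p (f * h) := fun g => by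
  rw [onMatrices_mul]; exact (hf g).mul (hh g)

lemma ext_split_aux (hl : IsLocAnUnits p fun y => l (Additive.ofMul y)) :
    ∃ (t0 : pullMod m l →ₗ[Ω] Ind p (charRep (oneK m))) (r0 : Vp m →ₗ[Ω] pullMod m l),
      (∀ f, t0 (inclPull m l f) = f) ∧ (∀ w, (r0 w).1.2 = w) ∧
      (∀ x, inclPull m l (t0 x) + r0 x.1.2 = x) ∧
      (∀ S, (pullB m l).IsBdd S → (indOne m).IsBdd (t0 '' S)) ∧
      ∀ S, (VpB m).IsBdd S → (pullB m l).IsBdd (r0 '' S) := by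
  obtain ⟨L, hL, hLb⟩ := exists_log p l hl
  -- `w ↦ Λ · β(w)`
  let T : Vp m →ₗ[Ω] (PGL2 Fp → Ω) :=
    { toFun := fun w => L * (beta m w).1
      map_add' := fun v w => by
        funext g
        simp [mul_add]
      map_smul' := fun c w => by
        funext g
        simp [mul_left_comm] }
  have hT : ∀ w, IsLocAn p (T w) := fun w => hL.mul (beta m w).2.1
  -- `w ↦ (Λ · β(w), β(w))`
  let T2 : Vp m →ₗ[Ω] (PGL2 Fp → Ω × Ω) :=
    { toFun := fun w g => (T w g, (beta m w).1 g)
      map_add' := fun v w => by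
        funext g
        simp
      map_smul' := fun c w => by
        funext g
        simp }
  have hT2 : ∀ w, IsLocAn p (T2 w) := fun w => by
    have h := ((hT w).comp (ContinuousLinearMap.inl ℚ_[p] Ω Ω)).add
      ((beta m w).2.1.comp (ContinuousLinearMap.inr ℚ_[p] Ω Ω))
    refine (congrArg (IsLocAn p) (funext fun g => ?_)).mpr h
    simp [T2]
  have hbeta : ∀ w a d u g, (beta m w).1 (borel a d u * g) = oneK m (a / d) * (beta m w).1 g :=
    fun w a d u g => (beta m w).2.2 a d u g
  -- the section `V_𝔭 → P`
  let r0 : Vp m →ₗ[Ω] pullMod m l :=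
    { toFun := fun w => ⟨(⟨T2 w, hT2 w, fun a d u g => by
        refine Prod.ext ?_ ?_
        · rw [tauRep_fst]
          change L (borel a d u * g) * (beta m w).1 (borel a d u * g) = _
          rw [hLb, hbeta]
          change _ = _ * (L g * (beta m w).1 g + _ * (beta m w).1 g)
          ring
        · rw [tauRep_snd]
          exact hbeta w a d u g⟩, w), fun g => rfl⟩
      map_add' := fun v w => Subtype.ext (Prod.ext (Subtype.ext (map_add T2 v w)) rfl)
      map_smul' := fun c w => Subtype.ext (Prod.ext (Subtype.ext (map_smul T2 c w)) rfl) }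
  -- the retraction `P → I_B(1_k)`
  let t0 : pullMod m l →ₗ[Ω] Ind p (charRep (oneK m)) :=
    { toFun := fun x => ⟨fun g => (x.1.1.1 g).1 - T x.1.2 g, by
        have h := (x.1.1.2.1.comp (ContinuousLinearMap.fst ℚ_[p] Ω Ω)).add
          ((hT x.1.2).smul (-1 : Ω))
        refine (congrArg (IsLocAn p) (funext fun g => ?_)).mpr h
        simp [sub_eq_add_neg], fun a d u g => by
        change (x.1.1.1 (borel a d u * g)).1 - L (borel a d u * g) *
          (beta m x.1.2).1 (borel a d u * g)
          = oneK m (a / d) * ((x.1.1.1 g).1 - L g * (beta m x.1.2).1 g)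
        rw [x.1.1.2.2, tauRep_fst, hLb, hbeta, x.2 g]
        ring⟩
      map_add' := fun x y => Subtype.ext (funext fun g => by
        have h : T (x.1.2 + y.1.2) g = T x.1.2 g + T y.1.2 g := by rw [map_add]; rfl
        change ((x.1.1.1 g).1 + (y.1.1.1 g).1) - T (x.1.2 + y.1.2) g
          = ((x.1.1.1 g).1 - T x.1.2 g) + ((y.1.1.1 g).1 - T y.1.2 g)
        rw [h]
        ring)
      map_smul' := fun c x => Subtype.ext (funext fun g => by
        have h : T (c • x.1.2) g = c * T x.1.2 g := by rw [map_smul]; rfl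
        change c * (x.1.1.1 g).1 - T (c • x.1.2) g = c * ((x.1.1.1 g).1 - T x.1.2 g)
        rw [h]
        ring) }
  have ht0 : ∀ f, t0 (inclPull m l f) = f := fun f => Subtype.ext (funext fun g => by
    change f.1 g - T 0 g = f.1 g
    rw [map_zero]
    exact sub_zero _)
  have hsum : ∀ x, inclPull m l (t0 x) + r0 x.1.2 = x := fun x => by
    refine Subtype.ext (Prod.ext (Subtype.ext (funext fun g => Prod.ext ?_ ?_)) ?_)
    · exact sub_add_cancel _ _
    · exact (zero_add _).trans (x.2 g).symm
    · exact zero_add _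
  refine ⟨t0, r0, ht0, fun w => rfl, hsum, fun U hU => ?_, fun S hS => ⟨?_, ?_⟩⟩
  · have h1 := IsLocBdd.comp (ContinuousLinearMap.fst ℚ_[p] Ω Ω) hU.1
    have h2 := VpB_image m ((-1 : Ω) • T) (fun w => (hT w).smul (-1 : Ω)) hU.2
    refine (h1.add h2).mono ?_
    rintro _ ⟨_, ⟨x, hx, rfl⟩, rfl⟩
    refine ⟨_, ⟨x.1.1.1, ⟨_, ⟨x, hx, rfl⟩, rfl⟩, rfl⟩, _, ⟨x.1.2, ⟨x, hx, rfl⟩, rfl⟩, ?_⟩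
    funext g
    change (x.1.1.1 g).1 + (-1 : Ω) * T x.1.2 g = (x.1.1.1 g).1 - T x.1.2 g
    ring
  · refine (VpB_image m T2 hT2 hS).mono ?_
    rintro _ ⟨_, ⟨_, ⟨w, hw, rfl⟩, rfl⟩, rfl⟩
    exact ⟨w, hw, rfl⟩
  · refine VpB_mono m hS ?_
    rintro _ ⟨_, ⟨w, hw, rfl⟩, rfl⟩
    exact hw

lemma ext_split (hl : IsLocAnUnits p fun y => l (Additive.ofMul y)) :
    ∃ (t : BornLin (extB m l) (steinberg m)) (r : BornLin (VpB m) (extB m l)),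
      (∀ x, t.lin ((extIncl m l).lin x) = x) ∧ (∀ z, (extProj m l).lin (r.lin z) = z) ∧
        ∀ y, (extIncl m l).lin (t.lin y) + r.lin ((extProj m l).lin y) = y := by
  obtain ⟨t0, r0, ht0, hr0, hsum, ht, hr⟩ := ext_split_aux m l hl
  exact BornRep.quot_split (A := indOne m) (P := pullB m l) (Z := VpB m) (extIncl m l) (extProj m l)
    (inclPull m l) (LinearMap.snd Ω _ _ ∘ₗ (pullMod m l).subtype) (fun _ => rfl) (fun _ => rfl)
    ⟨t0, ht⟩ ⟨r0, hr⟩ (by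
      rintro _ ⟨w, rfl⟩
      exact ⟨w, (ht0 _).symm⟩) ht0 hr0 hsum

/-- The short exact sequence `0 → St^an → E_λ → V_𝔭 → 0`. -/
def extSES (hl : IsLocAnUnits p fun y => l (Additive.ofMul y)) :
    StrictSES (steinberg m) (extB m l) (VpB m) where
  i := extIncl m l
  q := extProj m l
  comp_eq_zero x := by
    obtain ⟨f, rfl⟩ := Submodule.mkQ_surjective _ x
    rfl
  exists_split := ext_split m l hl

end Ext

/-! ### Deformations of characters -/

section Deform

variable {p : ℕ} [Fact p.Prime] {Fp : Type} [NormedField Fp] [NormedAlgebra ℚ_[p] Fp]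
  [FiniteDimensional ℚ_[p] Fp] {Ω : Type} [NormedField Ω] [NormedAlgebra ℚ_[p] Ω]
  {A : Type} [NormedCommRing A] [NormedAlgebra ℚ_[p] A] [NormedAlgebra Ω A]
  [IsScalarTower ℚ_[p] Ω A]

/-- The derivative `∂_v(χ)` of a character `χ : F_𝔭ˣ → Aˣ` along a tangent vector
`v : A → Ω[ε]`: the homomorphism with `v ∘ χ = χ̄ (1 + ∂_v(χ) ε)`, where `χ̄` is the reduction of
`v ∘ χ` modulo `ε`. -/
def derivAlong (v : A →A[Ω] DualNumber Ω) (χ : Fpˣ →* Aˣ) : Additive Fpˣ →+ Ω where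
  toFun y := (v (χ y.toMul)).fst⁻¹ * (v (χ y.toMul)).snd
  map_zero' := by simp
  map_add' y z := by
    have h : ∀ u : Fpˣ, (v (χ u)).fst ≠ 0 := fun u =>
      ((χ u).isUnit.map ((TrivSqZeroExt.fstHom Ω Ω Ω : DualNumber Ω →ₐ[Ω] Ω).toRingHom.comp
        (v : A →+* DualNumber Ω))).ne_zero
    have hy := h y.toMul
    have hz := h z.toMul
    simp only [toMul_add, map_mul, Units.val_mul, TrivSqZeroExt.fst_mul, TrivSqZeroExt.snd_mul,
      smul_eq_mul, MulOpposite.smul_eq_mul_unop, MulOpposite.unop_op]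
    field_simp
    ring

/-- The ring homomorphism underlying an `Ω`-valued point of `A`. -/
abbrev ptHom (x : A →A[Ω] Ω) : A →+* Ω := (x : A →ₐ[Ω] Ω).toRingHom

/-- An `Ω`-valued point as a continuous `ℚ_p`-linear map. -/
def ptLin (x : A →A[Ω] Ω) : A →L[ℚ_[p]] Ω where
  toFun := x
  map_add' := map_add x
  map_smul' c a := by
    rw [← algebraMap_smul Ω c a, map_smul, algebraMap_smul]
    rfl
  cont := x.cont

variable {V : Type} [AddCommMonoid V] [Module Ω V] {Γ Γ' : Type} [Group Γ] [Group Γ']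

/-- `Hom_A(X, V^∨ ⊗ A) → Hom_A(X, V^∨)`, the reduction of values along `x : A → Ω`. -/
def redValues (p : ℕ) [Fact p.Prime] [NormedAlgebra ℚ_[p] Ω] [NormedAlgebra ℚ_[p] A]
    [IsScalarTower ℚ_[p] Ω A] (x : A →A[Ω] Ω) (X : BornRep A Γ) :
    CHom (Ω := Ω) (RingHom.id A) X V →ₗ[Ω] CHom (Ω := Ω) (ptHom x) X V where
  toFun φ := ⟨
    { toFun := fun m => (x : A →ₐ[Ω] Ω).toLinearMap ∘ₗ φ.1 m
      map_add' := fun m m' => by rw [map_add, LinearMap.comp_add]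
      map_smul' := fun a m => LinearMap.ext fun w => by
        rw [map_smul]
        exact map_mul x a (φ.1 m w) }, fun S hS w => by
    obtain ⟨C, hC⟩ := φ.2 S hS w
    exact ⟨‖ptLin (p := p) x‖ * C, fun m hm =>
      ((ptLin (p := p) x).le_opNorm _).trans (by gcongr; exact hC m hm)⟩⟩
  map_add' φ ψ := Subtype.ext (LinearMap.ext fun m => LinearMap.ext fun w => map_add x _ _)
  map_smul' c φ := Subtype.ext (LinearMap.ext fun m => LinearMap.ext fun w => map_smul x c _)

variable (m : (Fp →ₐ[ℚ_[p]] Ω) → ℕ)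

/-- The reduction map `I_B(χ) → I_B(1_k)`, `f ↦ x ∘ f`. -/
def redInd (x : A →A[Ω] Ω) (χ : Fpˣ →* Aˣ) (hχ : ∀ y, x (χ y) = oneK m y)
    (f : Ind p (charRep χ)) : Ind p (charRep (oneK m)) :=
  ⟨fun g => x (f.1 g), f.2.1.comp (ptLin (p := p) x), fun a d u g => by
    change x (f.1 (borel a d u * g)) = _
    rw [f.2.2]
    change x ((χ (a / d) : A) * f.1 g) = (oneK m (a / d) : Ω) * x (f.1 g)
    rw [map_mul, hχ]⟩

/-- `Hom_Ω(I_B(1_k), V^∨) → Hom_A(I_B(χ), V^∨)`, the pullback along `I_B(χ) → I_B(1_k)`. -/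
def redPull (x : A →A[Ω] Ω) (χ : Fpˣ →* Aˣ) (hχ : ∀ y, x (χ y) = oneK m y) :
    CHom (Ω := Ω) (RingHom.id Ω) (indOne m) V →ₗ[Ω]
      CHom (Ω := Ω) (ptHom x) (indB (p := p) (charRep χ)) V where
  toFun ψ := ⟨
    { toFun := fun f => ψ.1 (redInd m x χ hχ f)
      map_add' := fun f h => by
        refine Eq.trans ?_ (map_add ψ.1 (redInd m x χ hχ f) (redInd m x χ hχ h))
        exact congrArg ψ.1 (Subtype.ext (funext fun g => map_add x _ _))
      map_smul' := fun a f => by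
        refine Eq.trans ?_ (map_smul ψ.1 (x a) (redInd m x χ hχ f))
        exact congrArg ψ.1 (Subtype.ext (funext fun g => map_mul x a (f.1 g))) }, fun S hS w => by
    obtain ⟨C, hC⟩ := ψ.2 (redInd m x χ hχ '' S) ((hS.comp (ptLin (p := p) x)).mono (by
      rintro _ ⟨_, ⟨f, hf, rfl⟩, rfl⟩
      exact ⟨f.1, ⟨f, hf, rfl⟩, rfl⟩)) w
    exact ⟨C, fun f hf => hC _ ⟨f, hf, rfl⟩⟩⟩
  map_add' _ _ := rfl
  map_smul' _ _ := rfl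

end Deform

/-! ### Localized cohomology -/

section Loc

variable {T : Type} [CommRing T] {Γ : Type} [Group Γ] (N : Subgroup Γ) [N.Normal] (e : Γ →* ℤˣ)
  (I : Ideal T)

/-- The multiplicative set at which one localizes, for the localization at the maximal
ideal `I`: the submonoid generated by (and, for a prime ideal, equal to) the complement
of `I`. -/
def locSet : Submonoid T := Submonoid.closure {t | t ∉ I}

/-- The localization `Hⁿ(N, M)_I`. -/
abbrev LocCoh (M : Rep T Γ) (n : ℕ) : Type := LocalizedModule (locSet I) (coh N M n)

/-- The localization `Hⁿ(N, M)^e_I`. -/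
abbrev LocSignCoh (M : Rep T Γ) (n : ℕ) : Type := LocalizedModule (locSet I) (signPart N e M n)

/-- The map `Hⁿ(N, M)^e_I → Hᵐ(N, M')_I` induced by a linear map. -/
def locMap {M M' : Rep T Γ} {n n' : ℕ} (f : coh N M n →ₗ[T] coh N M' n') :
    LocSignCoh N e I M n →ₗ[T] LocCoh N I M' n' :=
  IsLocalizedModule.map (locSet I) (LocalizedModule.mkLinearMap (locSet I) (signPart N e M n))
    (LocalizedModule.mkLinearMap (locSet I) (coh N M' n')) (f ∘ₗ (signPart N e M n).subtype)

end Loc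

/-! ### The `𝓛`-invariant -/

/-- The arithmetic data: `F_𝔭` is the completion of the number field `F` at a prime `𝔭` above `p`,
`Ω` contains the images of all embeddings of `F`, `D` is split at `𝔭` and over `Ω`, `k = 2 m` is a
weight, `K = ∏ K_v` is a compact open subgroup of the adelic points of `G` away from `𝔭`, and `S`
is a finite set of primes that contains `𝔭` and every `v` such that `K_v` is not a maximal compact
subgroup. -/
structure Datum (F : Type) [Field F] [NumberField F] (D : Type) [Ring D] [Algebra F D] (p : ℕ)
    [Fact p.Prime] (Fp : Type) [NormedField Fp] [NormedAlgebra ℚ_[p] Fp] [Algebra F Fp]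
    (Ω : Type) [NormedField Ω] [NormedAlgebra ℚ_[p] Ω] where
  /-- the prime `𝔭` -/
  𝔭 : HeightOneSpectrum (𝓞 F)
  dense : DenseRange (algebraMap F Fp)
  norm_lt_one_iff : ∀ x : 𝓞 F, ‖algebraMap F Fp x‖ < 1 ↔ x ∈ 𝔭.asIdeal
  card_embeddings : Nat.card (F →+* Ω) = Module.finrank ℚ F
  /-- a splitting of `D` at `𝔭` -/
  φp : D →+* M2 Fp
  isSplitting_φp : IsSplitting (algebraMap F Fp) φp
  /-- splittings of `D` over `Ω` -/
  φ : (F →+* Ω) → (D →+* M2 Ω)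
  isSplitting_φ : ∀ σ, IsSplitting σ (φ σ)
  /-- half of the weight, `k_σ = 2 m_σ` -/
  m : (F →+* Ω) → ℕ
  /-- the local components of the level -/
  Kv : ∀ v : {v : HeightOneSpectrum (𝓞 F) // v ≠ 𝔭}, Subgroup (Gv F D v.1)
  isOpen_level : IsOpen (level F D 𝔭 Kv : Set (GA F D 𝔭))
  isCompact_level : IsCompact (level F D 𝔭 Kv : Set (GA F D 𝔭))
  /-- the finite set of primes -/
  S : Finset (HeightOneSpectrum (𝓞 F))
  mem_S : 𝔭 ∈ S
  maximal_Kv : ∀ v : {v : HeightOneSpectrum (𝓞 F) // v ≠ 𝔭}, v.1 ∉ S →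
    Maximal (fun U : Subgroup (Gv F D v.1) => IsCompact (U : Set (Gv F D v.1))) (Kv v)

namespace Datum

variable {F : Type} [Field F] [NumberField F] {D : Type} [Ring D] [Algebra F D] {p : ℕ}
  [Fact p.Prime] {Fp : Type} [NormedField Fp] [NormedAlgebra ℚ_[p] Fp] [Algebra F Fp]
  {Ω : Type} [NormedField Ω] [NormedAlgebra ℚ_[p] Ω] (d : Datum F D p Fp Ω)

/-- The group of adelic points of `G` away from `𝔭`. -/
abbrev Gad : Type := GA F D d.𝔭

/-- The level `K` away from `𝔭`. -/
abbrev K : Subgroup d.Gad := level F D d.𝔭 d.Kv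

/-- The Hecke algebra `𝕋^S` away from `S`. -/
abbrev TS : Type := HeckeT Ω d.K (awayFrom F D d.𝔭 d.S)

/-- The weight `k_𝔭`: the embeddings of `F_𝔭` are the embeddings of `F` that induce `𝔭`. -/
def mp (s : Fp →ₐ[ℚ_[p]] Ω) : ℕ := d.m ((s : Fp →+* Ω).comp (algebraMap F Fp))

/-- The embedding `G(F) → PGL₂(F_𝔭)`. -/
def toGp : GF F D →* PGL2 Fp := PU.map d.φp (algebraMap F Fp) d.isSplitting_φp

/-- The embeddings of `F` that do not induce the prime `𝔭`. -/
abbrev SigmaAway (_d : Datum F D p Fp Ω) : Type :=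
  {σ : F →+* Ω // ¬ ∃ s : Fp →ₐ[ℚ_[p]] Ω, (s : Fp →+* Ω).comp (algebraMap F Fp) = σ}

/-- The representation `V_{k^𝔭}` of `G(F)`: the tensor product of the `V_{k_σ}` over the embeddings
that do not induce `𝔭`. -/
abbrev Vaway : Type := ⨂[Ω] σ : d.SigmaAway, Vk Ω (d.m σ.1)

/-- The action of `G(F)` on `V_{k^𝔭}`. -/
def VawayRep : Representation Ω (GF F D) d.Vaway :=
  tensorRep (fun σ : d.SigmaAway => d.m σ.1) fun σ =>
    PU.map (d.φ σ.1) σ.1 (d.isSplitting_φ σ.1)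

/-- The coefficients `𝓕(G(𝔸^{𝔭,∞})/K, Hom_cont(X, V_{k^𝔭}^∨ ⊗ R'))`; their cohomology groups
`Hⁿ(G(F)⁺, ·)` are the groups `Hⁿ_cont(X_K^𝔭, X, V_{k^𝔭}^∨)`. -/
def cf {R R' : Type} [CommRing R] [NormedCommRing R'] [Algebra Ω R'] (s : R →+* R')
    (X : BornRep R (PGL2 Fp)) : Rep d.TS (GF F D) :=
  dualCoeff d.K (awayFrom F D d.𝔭 d.S) (GF.toGA F D d.𝔭) s X d.toGp d.VawayRep

variable [FiniteDimensional ℚ_[p] Fp] (ε : Pi0 F D →* ℤˣ) {W : Type} [AddCommGroup W] [Module Ω W]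
  (π : Representation Ω d.Gad W)

/-- The ideal `𝔪_π^S`: the kernel of the action of `𝕋^S` on `π^K`. -/
abbrev mS : Ideal d.TS := heckeIdeal Ω d.K (awayFrom F D d.𝔭 d.S) π

/-- The boundary map `c_λ^ε` from `H^q_cont(X_K^𝔭, St^an, V_{k^𝔭}^∨)^ε` to
`H^{q+1}(X_K^𝔭, V_𝔭, V_{k^𝔭}^∨)`, localized at `𝔪_π^S`, induced by the dual of the short exact
sequence `0 → St^an → E_λ → V_𝔭 → 0`. -/
def cLambda (l : Additive Fpˣ →+ Ω) (hl : IsLocAnUnits p fun y => l (Additive.ofMul y)) :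
    LocSignCoh (GFplus F D) (ε.comp (sgn F D)) (d.mS π)
        (d.cf (RingHom.id Ω) (steinberg d.mp)) (numSplit F D) →ₗ[d.TS]
      LocCoh (GFplus F D) (d.mS π) (d.cf (RingHom.id Ω) (VpB d.mp)) (numSplit F D + 1) :=
  locMap _ _ _ ((extSES d.mp l hl).boundary d.K (awayFrom F D d.𝔭 d.S) (GF.toGA F D d.𝔭)
    (RingHom.id Ω) d.toGp d.VawayRep (GFplus F D) (numSplit F D))

/-- The automorphic `𝓛`-invariant: the kernel of `λ ↦ c_λ^ε` on the continuous homomorphisms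
`λ : F_𝔭ˣ → Ω`, all of which are locally analytic. -/
def LInv : Set (Additive Fpˣ →+ Ω) := {l | ∃ hl, d.cLambda ε π l hl = 0}

section Red

variable {A : Type} [NormedCommRing A] [NormedAlgebra ℚ_[p] A] [NormedAlgebra Ω A]
  [IsScalarTower ℚ_[p] Ω A] (x : A →A[Ω] Ω) (χ : Fpˣ →* Aˣ)
  (hχ : ∀ y, x (χ y) = oneK d.mp y)

/-- The map `H^q_{A,cont}(X_K^𝔭, I_B(χ), V_{k^𝔭}^∨ ⊗ A)^ε → H^q_{A,cont}(X_K^𝔭, I_B(χ), V_{k^𝔭}^∨)`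
given by the reduction of values along `x : A → Ω`. -/
def redValuesCoh :
    LocSignCoh (GFplus F D) (ε.comp (sgn F D)) (d.mS π)
        (d.cf (RingHom.id A) (indB (p := p) (charRep χ))) (numSplit F D) →ₗ[d.TS]
      LocCoh (GFplus F D) (d.mS π)
        (d.cf (ptHom x) (indB (p := p) (charRep χ))) (numSplit F D) :=
  locMap _ _ _ (cohMap (GFplus F D) (coeffMap Ω d.K (awayFrom F D d.𝔭 d.S) (GF.toGA F D d.𝔭)
    (X := CHom (Ω := Ω) (RingHom.id A) (indB (p := p) (charRep χ)) d.Vaway)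
    (Y := CHom (Ω := Ω) (ptHom x) (indB (p := p) (charRep χ)) d.Vaway)
    (ρ := CHomRep (RingHom.id A) (indB (p := p) (charRep χ)) d.toGp d.VawayRep)
    (ρ' := CHomRep (ptHom x) (indB (p := p) (charRep χ)) d.toGp d.VawayRep)
    (redValues p x _) fun _ _ => rfl) _)

/-- The map `H^q_{Ω,cont}(X_K^𝔭, I_B(1_k), V_{k^𝔭}^∨)^ε → H^q_{A,cont}(X_K^𝔭, I_B(χ), V_{k^𝔭}^∨)`
induced by `I_B(χ) → I_B(1_k)`. -/
def redPullCoh :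
    LocSignCoh (GFplus F D) (ε.comp (sgn F D)) (d.mS π)
        (d.cf (RingHom.id Ω) (indOne d.mp)) (numSplit F D) →ₗ[d.TS]
      LocCoh (GFplus F D) (d.mS π)
        (d.cf (ptHom x) (indB (p := p) (charRep χ))) (numSplit F D) :=
  locMap _ _ _ (cohMap (GFplus F D) (coeffMap Ω d.K (awayFrom F D d.𝔭 d.S) (GF.toGA F D d.𝔭)
    (X := CHom (Ω := Ω) (RingHom.id Ω) (indOne d.mp) d.Vaway)
    (Y := CHom (Ω := Ω) (ptHom x) (indB (p := p) (charRep χ)) d.Vaway)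
    (ρ := CHomRep (RingHom.id Ω) (indOne d.mp) d.toGp d.VawayRep)
    (ρ' := CHomRep (ptHom x) (indB (p := p) (charRep χ)) d.toGp d.VawayRep)
    (redPull d.mp x χ hχ) fun _ _ => rfl) _)

/-- Surjectivity of the reduction map
`red_χ : H^q_{A,cont}(X_K^𝔭, I_B(χ), V_{k^𝔭}^∨ ⊗ A)^ε_𝔪 → H^q_{Ω,cont}(X_K^𝔭, I_B(1_k), V_{k^𝔭}^∨)^ε_𝔪`.
Reduction of values maps `Hom_A(I_B(χ), V^∨ ⊗ A)` to
`Hom_A(I_B(χ), V^∨) = Hom_Ω(I_B(χ) ⊗_A Ω, V^∨) = Hom_Ω(I_B(1_k), V^∨)`, where the last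
identification is the pullback along `I_B(χ) → I_B(1_k)`. Hence `red_χ(z) = y` means that the
reduction of values of `z` is the pullback of `y`. -/
def RedSurjective : Prop :=
  ∀ y, ∃ z, d.redValuesCoh ε π x χ z = d.redPullCoh ε π x χ hχ y

end Red

end Datum

end AutL

end

/-! Write λ for `derivAlong v χ`. The extension E_λ is a pushout along I_B(1_k) → St^an of the
pullback P of I_B(τ_λ) along V_𝔭 → I_B(1_k). By naturality (`StrictSES.boundary_naturality`), the
boundary map of E_λ is restriction of classes from St^an to I_B(1_k), followed by the boundary map
of 0 → I_B(1_k) → P → V_𝔭 → 0. The latter kills every class that extends to P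
(`StrictSES.boundary_cohMap`). It therefore suffices to extend classes from the dual of I_B(1_k) to
the dual of I_B(τ_λ), up to the denominators allowed by the localization.

The hypothesis supplies a lift with coefficients in Hom_A(I_B(χ), V^∨ ⊗ A), and the tangent vector
turns it into an extension. Identify Ω² with Ω[ε] by (w₁, w₂) ↦ w₂ + w₁ε. Then τ_λ is multiplication
by v ∘ χ = 1_k(1 + λε), so f ↦ v ∘ f maps I_B(χ) to I_B(τ_λ) (`tangentInd`). For an A-linear
functional φ on I_B(χ), the ε-component of v ∘ φ should factor through this map and give a
functional on I_B(τ_λ) (`firstOrder`). On the subspace εI_B(1_k) it must be x ∘ φ, which is the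
reduction of φ (`firstOrder_tauIncl`). So every reduction extends to I_B(τ_λ), hence to P.

The analytic content is that functionals factor in this way. A function with values in the kernel of
v, or of x, need not be a finite combination of elements of that kernel times elements of I_B(χ), so
linearity over A is not enough and continuity must enter. Let δ be det/c² or det/d², according to
which entry of the lower row (c, d) is larger. Multiplication by χ(δ)/1_k(δ) is an Ω-linear section
I_B(1_k) → I_B(χ) (`indSection`). The A-span of its image is dense (`exists_approx`): in coordinates
on B \ PGL₂(F_𝔭) = ℙ¹(F_𝔭), an element of I_B(χ) is χ(δ) times an A-valued function that is
piecewise a power series on finitely many balls, and truncating these series gives finite sums of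
A-multiples of elements in the image. The error lies in pᵉ times a fixed bounded set, so a bounded
functional that vanishes on the span is zero (`eq_zero_of_indSection`). This yields
`factor_redIndLin` and `factor_tangentInd`, which only have to be checked on a multiple of a
section, where they reduce to the product rule for v.

The section is not equivariant, but it is split off from canonical maps: I_B(τ_λ) is the sum of the
images of `tangentInd` and of εI_B(1_k), both maps are equivariant, and the extended functional is
determined on each of them. Hence `firstOrder` is equivariant and induces maps in cohomology. -/

noncomputable section

namespace AutL

set_option linter.unusedSectionVars false

/-! ### Power series with summable coefficients on a ball -/

section BoundedSeries

open Filter Topology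

variable {𝕜 E W W₁ W₂ W₃ : Type*} [NontriviallyNormedField 𝕜]
  [NormedAddCommGroup E] [NormedSpace 𝕜 E] [NormedAddCommGroup W] [NormedSpace 𝕜 W]
  [NormedAddCommGroup W₁] [NormedSpace 𝕜 W₁] [NormedAddCommGroup W₂] [NormedSpace 𝕜 W₂]
  [NormedAddCommGroup W₃] [NormedSpace 𝕜 W₃]

variable (𝕜) in
/-- `f` is given on the ball of radius `r` around `x` by a power series `∑ P_n` with
`∑ ‖P_n‖ rⁿ ≤ C`. -/
def HasBoundedSeries (f : E → W) (x : E) (r C : ℝ) : Prop :=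
  ∃ P : FormalMultilinearSeries 𝕜 E W,
    HasFPowerSeriesOnBall f P x (ENNReal.ofReal r) ∧ ∀ s : Finset ℕ, ∑ n ∈ s, ‖P n‖ * r ^ n ≤ C

lemma HasBoundedSeries.pos {f : E → W} {x : E} {r C : ℝ} (h : HasBoundedSeries 𝕜 f x r C) :
    0 < r := by
  obtain ⟨P, hP, -⟩ := h
  exact ENNReal.ofReal_pos.1 hP.r_pos

lemma HasBoundedSeries.nonneg {f : E → W} {x : E} {r C : ℝ} (h : HasBoundedSeries 𝕜 f x r C) :
    0 ≤ C := by
  obtain ⟨P, -, h⟩ := h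
  simpa using h ∅

lemma mem_eball_zero_ofReal {y : E} {r : ℝ} :
    y ∈ Metric.eball (0 : E) (ENNReal.ofReal r) ↔ ‖y‖ < r := by
  rw [Metric.mem_eball, edist_zero_right, ← ofReal_norm]
  exact ENNReal.ofReal_lt_ofReal_iff_of_nonneg (norm_nonneg _)

lemma HasBoundedSeries.mk' {f : E → W} {x : E} {r C : ℝ} (hr : 0 < r)
    (P : FormalMultilinearSeries 𝕜 E W) (hP : ∀ s : Finset ℕ, ∑ n ∈ s, ‖P n‖ * r ^ n ≤ C)
    (h : ∀ y : E, ‖y‖ < r → HasSum (fun n => P n fun _ => y) (f (x + y))) :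
    HasBoundedSeries 𝕜 f x r C := by
  refine ⟨P, ⟨?_, ENNReal.ofReal_pos.2 hr, fun {y} hy => h y (mem_eball_zero_ofReal.1 hy)⟩, hP⟩
  refine P.le_radius_of_bound (r := r.toNNReal) C fun n => ?_
  rw [Real.coe_toNNReal _ hr.le]
  simpa using hP {n}

lemma HasBoundedSeries.hasSum {f : E → W} {x : E} {r : ℝ} {P : FormalMultilinearSeries 𝕜 E W}
    (h : HasFPowerSeriesOnBall f P x (ENNReal.ofReal r)) {y : E} (hy : ‖y‖ < r) :
    HasSum (fun n => P n fun _ => y) (f (x + y)) :=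
  h.hasSum (mem_eball_zero_ofReal.2 hy)

lemma HasBoundedSeries.congr {f f' : E → W} {x : E} {r C : ℝ} (h : HasBoundedSeries 𝕜 f x r C)
    (hff : ∀ y : E, ‖y‖ < r → f (x + y) = f' (x + y)) : HasBoundedSeries 𝕜 f' x r C := by
  have hr := h.pos
  obtain ⟨P, hP, hC⟩ := h
  exact .mk' hr P hC fun y hy => hff y hy ▸ HasBoundedSeries.hasSum hP hy

lemma HasBoundedSeries.mono {f : E → W} {x : E} {r r' C C' : ℝ} (h : HasBoundedSeries 𝕜 f x r C)
    (hr' : 0 < r') (hr : r' ≤ r) (hC : C ≤ C') : HasBoundedSeries 𝕜 f x r' C' := by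
  obtain ⟨P, hP, hb⟩ := h
  refine .mk' hr' P (fun s => ?_) fun y hy => HasBoundedSeries.hasSum hP (hy.trans_le hr)
  refine le_trans ?_ ((hb s).trans hC)
  gcongr

lemma HasBoundedSeries.const (w : W) (x : E) {r : ℝ} (hr : 0 < r) :
    HasBoundedSeries 𝕜 (fun _ : E => w) x r ‖w‖ := by
  refine .mk' hr (constFormalMultilinearSeries 𝕜 E w) (fun s => ?_) fun y hy => ?_
  · calc ∑ n ∈ s, ‖constFormalMultilinearSeries 𝕜 E w n‖ * r ^ n
        ≤ ∑ n ∈ s, if n = 0 then ‖w‖ else 0 := by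
          refine Finset.sum_le_sum fun n _ => ?_
          rcases n with _ | n
          · simp [constFormalMultilinearSeries]
          · simp [constFormalMultilinearSeries]
      _ ≤ ‖w‖ := by
          rw [Finset.sum_ite_eq']
          split <;> simp
  · exact (hasFPowerSeriesOnBall_const (c := w) (e := x) (𝕜 := 𝕜)).hasSum (by simp)

/-- A power series with bounded coefficients on a ball has summable coefficients on the ball of
half the radius. -/
lemma HasBoundedSeries.of_bound {f : E → W} {x : E} {r C : ℝ} (hr : 0 < r)
    {P : FormalMultilinearSeries 𝕜 E W} (hP : HasFPowerSeriesOnBall f P x (ENNReal.ofReal r))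
    (hC : ∀ n, ‖P n‖ * r ^ n ≤ C) : HasBoundedSeries 𝕜 f x (r / 2) (2 * C) := by
  have hC0 : 0 ≤ C := le_trans (by positivity) (hC 0)
  refine .mk' (by positivity) P (fun s => ?_) fun y hy =>
    HasBoundedSeries.hasSum hP (hy.trans (half_lt_self hr))
  calc ∑ n ∈ s, ‖P n‖ * (r / 2) ^ n ≤ ∑ n ∈ s, C * (1 / 2) ^ n := by
        refine Finset.sum_le_sum fun n _ => ?_
        rw [div_eq_mul_one_div r, mul_pow, ← mul_assoc]
        gcongr
        exact hC n
    _ ≤ ∑' n : ℕ, C * (1 / 2) ^ n :=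
        (summable_geometric_two.mul_left C).sum_le_tsum _ fun n _ => by positivity
    _ = 2 * C := by rw [tsum_mul_left, tsum_geometric_two, mul_comm]

/-- The constant term of the series is f(x) and the remaining terms become arbitrarily small with
the radius, so any bound strictly above the value at the centre is attained. This sharpness is what
later allows one power series to be substituted into another: the inner function must be bounded by
a prescribed radius of convergence. -/
lemma HasBoundedSeries.of_analyticAt {f : E → W} {x : E} (hf : AnalyticAt 𝕜 f x) {C : ℝ}
    (hC : ‖f x‖ < C) : ∃ r₀ : ℝ, 0 < r₀ ∧ ∀ r, 0 < r → r ≤ r₀ → HasBoundedSeries 𝕜 f x r C := by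
  obtain ⟨P, ρ, hP⟩ := hf
  obtain ⟨r₁, hr0, hr⟩ := ENNReal.lt_iff_exists_nnreal_btwn.1 hP.r_pos
  obtain ⟨C₁, hC₁, hb⟩ := P.norm_mul_pow_le_of_lt_radius (hr.trans_le hP.r_le)
  have hr₁ : (0 : ℝ) < r₁ := by exact_mod_cast hr0
  have hP' : HasFPowerSeriesOnBall f P x (ENNReal.ofReal r₁) := by
    rw [ENNReal.ofReal_coe_nnreal]
    exact hP.mono hr0 hr.le
  -- With q = r / r₁, the terms of positive degree sum to at most C₁q · (1 + 1/2 + 1/4 + …) = 2C₁q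
  -- once q ≤ 1/2. This fits into the gap C - ‖f x‖ exactly when q is at most the quotient
  -- considered here.
  have hδ : 0 < (C - ‖f x‖) / (2 * C₁) := div_pos (sub_pos.2 hC) (by positivity)
  refine ⟨r₁ * min (1 / 2) ((C - ‖f x‖) / (2 * C₁)), by positivity, fun r hr' hrr => ?_⟩
  set q : ℝ := r / r₁ with hq
  have hrq : r = r₁ * q := by rw [hq]; field_simp
  have hq0 : 0 ≤ q := by positivity
  have hqm : q ≤ min (1 / 2) ((C - ‖f x‖) / (2 * C₁)) := by
    rw [hrq] at hrr
    exact le_of_mul_le_mul_left hrr hr₁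
  have hq1 : q ≤ 1 / 2 := hqm.trans (min_le_left _ _)
  have hq2 : 2 * C₁ * q ≤ C - ‖f x‖ := by
    have := hqm.trans (min_le_right _ _)
    rw [le_div_iff₀ (by positivity)] at this
    linarith
  refine .mk' hr' P (fun s => ?_) fun y hy => HasBoundedSeries.hasSum hP' (hy.trans_le ?_)
  · let c : ℕ → ℝ := fun n => Nat.casesOn n ‖f x‖ fun n => C₁ * q * (1 / 2) ^ n
    have hc0 : ∀ n, 0 ≤ c n := by
      rintro (_ | n)
      · exact norm_nonneg _
      · change 0 ≤ C₁ * q * (1 / 2) ^ n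
        positivity
    have hcs : Summable c := (summable_nat_add_iff 1).1 (summable_geometric_two.mul_left (C₁ * q))
    have hle : ∀ n, ‖P n‖ * r ^ n ≤ c n := by
      rintro (_ | n)
      · have h0 : ‖P 0‖ = ‖f x‖ := by
          rw [← hP.coeff_zero (fun i => i.elim0),
            ContinuousMultilinearMap.fin0_apply_norm]
        rw [pow_zero, mul_one, h0]
        exact le_rfl
      · change _ ≤ C₁ * q * (1 / 2) ^ n
        calc ‖P (n + 1)‖ * r ^ (n + 1) = (‖P (n + 1)‖ * r₁ ^ (n + 1)) * q * q ^ n := by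
              rw [hrq, mul_pow]; ring
          _ ≤ C₁ * q * (1 / 2) ^ n := by
              gcongr
              exact hb (n + 1)
    calc ∑ n ∈ s, ‖P n‖ * r ^ n ≤ ∑ n ∈ s, c n := Finset.sum_le_sum fun n _ => hle n
      _ ≤ ∑' n, c n := hcs.sum_le_tsum _ fun n _ => hc0 n
      _ = ‖f x‖ + C₁ * q * 2 := by
          rw [hcs.tsum_eq_zero_add]
          change ‖f x‖ + ∑' n : ℕ, C₁ * q * (1 / 2) ^ n = _
          rw [tsum_mul_left, tsum_geometric_two]
      _ ≤ C := by linarith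
  · rw [hrq]
    exact mul_le_of_le_one_right hr₁.le (by linarith)

lemma HasBoundedSeries.compCLM {f : E → W₁} {x : E} {r C : ℝ} (h : HasBoundedSeries 𝕜 f x r C)
    (T : W₁ →L[𝕜] W₂) : HasBoundedSeries 𝕜 (fun y => T (f y)) x r (‖T‖ * C) := by
  have hr := h.pos
  obtain ⟨P, hP, hb⟩ := h
  refine .mk' hr (T.compFormalMultilinearSeries P) (fun s => ?_) fun y hy =>
    (HasBoundedSeries.hasSum hP hy).mapL T
  calc ∑ n ∈ s, ‖T.compFormalMultilinearSeries P n‖ * r ^ n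
      ≤ ∑ n ∈ s, ‖T‖ * (‖P n‖ * r ^ n) := by
        refine Finset.sum_le_sum fun n _ => ?_
        rw [← mul_assoc]
        gcongr
        exact T.norm_compContinuousMultilinearMap_le (P n)
    _ ≤ ‖T‖ * C := by rw [← Finset.mul_sum]; gcongr; exact hb s

/-- The `(k + l)`-linear map `B(P, Q)` for a `k`-linear map `P` and an `l`-linear map `Q`. -/
def bilinTerm (B : W₁ →L[𝕜] W₂ →L[𝕜] W₃) {k l n : ℕ} (h : k + l = n) (P : E [×k]→L[𝕜] W₁)
    (Q : E [×l]→L[𝕜] W₂) : E [×n]→L[𝕜] W₃ :=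
  ContinuousMultilinearMap.domDomCongr (finSumFinEquiv.trans (finCongr h))
    (ContinuousMultilinearMap.uncurrySum
      ((((ContinuousLinearMap.compContinuousMultilinearMapL 𝕜 (fun _ : Fin l => E) W₂ W₃).flip
        Q).comp B).compContinuousMultilinearMap P))

lemma bilinTerm_apply (B : W₁ →L[𝕜] W₂ →L[𝕜] W₃) {k l n : ℕ} (h : k + l = n)
    (P : E [×k]→L[𝕜] W₁) (Q : E [×l]→L[𝕜] W₂) (y : E) :
    bilinTerm B h P Q (fun _ => y) = B (P fun _ => y) (Q fun _ => y) := rfl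

lemma norm_bilinTerm_le (B : W₁ →L[𝕜] W₂ →L[𝕜] W₃) {k l n : ℕ} (h : k + l = n)
    (P : E [×k]→L[𝕜] W₁) (Q : E [×l]→L[𝕜] W₂) :
    ‖bilinTerm B h P Q‖ ≤ ‖B‖ * ‖P‖ * ‖Q‖ := by
  refine ContinuousMultilinearMap.opNorm_le_bound (by positivity) fun m => ?_
  subst h
  change ‖B (P fun i => m (finSumFinEquiv (Sum.inl i))) (Q fun i => m (finSumFinEquiv (Sum.inr i)))‖
    ≤ _
  refine (B.le_opNorm₂ _ _).trans ?_
  rw [← finSumFinEquiv.prod_comp, Fintype.prod_sum_type]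
  calc _ ≤ ‖B‖ * (‖P‖ * ∏ i, ‖m (finSumFinEquiv (Sum.inl i))‖) *
        (‖Q‖ * ∏ i, ‖m (finSumFinEquiv (Sum.inr i))‖) := by
        gcongr
        · exact P.le_opNorm _
        · exact Q.le_opNorm _
    _ = _ := by ring

/-- The Cauchy product for a continuous bilinear map: the double series converges absolutely, so it
may be summed by rows, which identifies the value, or by antidiagonals, which gives the claim. -/
lemma hasSum_bilin [CompleteSpace W₃] (B : W₁ →L[𝕜] W₂ →L[𝕜] W₃) {a : ℕ → W₁} {b : ℕ → W₂}
    {a₀ : W₁} {b₀ : W₂} (ha : HasSum a a₀) (hb : HasSum b b₀) (ha' : Summable fun n => ‖a n‖)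
    (hb' : Summable fun n => ‖b n‖) :
    HasSum (fun n => ∑ kl : Finset.HasAntidiagonal.antidiagonal n, B (a kl.1.1) (b kl.1.2)) (B a₀ b₀) := by
  have hs : Summable fun kl : ℕ × ℕ => B (a kl.1) (b kl.2) := by
    refine Summable.of_norm_bounded (g := fun kl : ℕ × ℕ => ‖B‖ * (‖a kl.1‖ * ‖b kl.2‖))
      ((ha'.mul_of_nonneg hb' (fun _ => norm_nonneg _) fun _ => norm_nonneg _).mul_left _)
      fun kl => ?_
    rw [← mul_assoc]
    exact B.le_opNorm₂ _ _
  have h1 : HasSum (fun k => B (a k) b₀) (B a₀ b₀) := ha.mapL (B.flip b₀)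
  have h2 := hs.hasSum.prod_fiberwise fun k => hb.mapL (B (a k))
  have h3 := h1.unique h2
  have h4 := hs.hasSum
  rw [← h3, ← Finset.HasAntidiagonal.sigmaAntidiagonalEquivProd.hasSum_iff] at h4
  exact h4.sigma fun n => hasSum_fintype _

lemma sum_antidiagonal_le {a b : ℕ → ℝ} {C C' : ℝ} (ha : ∀ n, 0 ≤ a n) (hb : ∀ n, 0 ≤ b n)
    (hC : ∀ s : Finset ℕ, ∑ n ∈ s, a n ≤ C) (hC' : ∀ s : Finset ℕ, ∑ n ∈ s, b n ≤ C')
    (s : Finset ℕ) :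
    ∑ n ∈ s, ∑ kl : Finset.HasAntidiagonal.antidiagonal n, a kl.1.1 * b kl.1.2 ≤ C * C' := by
  have has : Summable a := summable_of_sum_le ha hC
  have hbs : Summable b := summable_of_sum_le hb hC'
  have hprod : Summable fun z : ℕ × ℕ => a z.1 * b z.2 := has.mul_of_nonneg hbs ha hb
  have hsig : Summable fun n => ∑ kl ∈ Finset.HasAntidiagonal.antidiagonal n, a kl.1 * b kl.2 :=
    summable_sum_mul_antidiagonal_of_summable_mul hprod
  have hCn : 0 ≤ C := by simpa using hC ∅
  calc ∑ n ∈ s, ∑ kl : Finset.HasAntidiagonal.antidiagonal n, a kl.1.1 * b kl.1.2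
      = ∑ n ∈ s, ∑ kl ∈ Finset.HasAntidiagonal.antidiagonal n, a kl.1 * b kl.2 :=
        Finset.sum_congr rfl fun n _ =>
          Finset.sum_coe_sort (Finset.HasAntidiagonal.antidiagonal n) fun kl => a kl.1 * b kl.2
    _ ≤ ∑' n, ∑ kl ∈ Finset.HasAntidiagonal.antidiagonal n, a kl.1 * b kl.2 :=
        hsig.sum_le_tsum _ fun n _ => Finset.sum_nonneg fun kl _ => mul_nonneg (ha _) (hb _)
    _ = (∑' n, a n) * ∑' n, b n :=
        (has.tsum_mul_tsum_eq_tsum_sum_antidiagonal hbs hprod).symm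
    _ ≤ C * C' :=
        mul_le_mul (has.tsum_le_of_sum_le hC) (hbs.tsum_le_of_sum_le hC') (tsum_nonneg hb) hCn

lemma norm_apply_diag_le {n : ℕ} (R : E [×n]→L[𝕜] W) {y : E} {r : ℝ} (hy : ‖y‖ ≤ r) :
    ‖R fun _ => y‖ ≤ ‖R‖ * r ^ n := by
  refine (R.le_opNorm _).trans ?_
  simp only [Finset.prod_const, Finset.card_univ, Fintype.card_fin]
  gcongr

/-- The norm ∑ ‖P_n‖ rⁿ is submultiplicative under the Cauchy product. This is the reason for
working with sums of coefficients instead of the suprema in `IsLocBdd`: no radius is lost in a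
product. -/
lemma HasBoundedSeries.bilin [CompleteSpace W₃] (B : W₁ →L[𝕜] W₂ →L[𝕜] W₃) {f : E → W₁}
    {g : E → W₂} {x : E} {r C C' : ℝ} (hf : HasBoundedSeries 𝕜 f x r C)
    (hg : HasBoundedSeries 𝕜 g x r C') :
    HasBoundedSeries 𝕜 (fun y => B (f y) (g y)) x r (‖B‖ * C * C') := by
  have hr := hf.pos
  obtain ⟨P, hP, hC⟩ := hf
  obtain ⟨Q, hQ, hC'⟩ := hg
  have hPs : Summable fun n => ‖P n‖ * r ^ n := summable_of_sum_le (fun n => by positivity) hC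
  have hQs : Summable fun n => ‖Q n‖ * r ^ n := summable_of_sum_le (fun n => by positivity) hC'
  -- The sum runs over the antidiagonal as a type, so that each index carries the proof of k + l = n
  -- needed to regard the product of a k-linear and an l-linear map as n-linear.
  refine .mk' hr (fun n => ∑ kl : Finset.HasAntidiagonal.antidiagonal n,
    bilinTerm B (Finset.HasAntidiagonal.mem_antidiagonal.1 kl.2) (P kl.1.1) (Q kl.1.2))
    (fun s => ?_) fun y hy => ?_
  · have key : ∀ n, ‖∑ kl : Finset.HasAntidiagonal.antidiagonal n,
        bilinTerm B (Finset.HasAntidiagonal.mem_antidiagonal.1 kl.2) (P kl.1.1) (Q kl.1.2)‖ * r ^ n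
        ≤ ‖B‖ * ∑ kl : Finset.HasAntidiagonal.antidiagonal n,
          (‖P kl.1.1‖ * r ^ kl.1.1) * (‖Q kl.1.2‖ * r ^ kl.1.2) := fun n => by
      rw [Finset.mul_sum]
      refine (mul_le_mul_of_nonneg_right (norm_sum_le _ _) (by positivity)).trans ?_
      rw [Finset.sum_mul]
      refine Finset.sum_le_sum fun kl _ => ?_
      have h : r ^ n = r ^ kl.1.1 * r ^ kl.1.2 := by
        rw [← pow_add, Finset.HasAntidiagonal.mem_antidiagonal.1 kl.2]
      calc _ ≤ (‖B‖ * ‖P kl.1.1‖ * ‖Q kl.1.2‖) * r ^ n := by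
            gcongr; exact norm_bilinTerm_le B _ _ _
        _ = _ := by rw [h]; ring
    refine (Finset.sum_le_sum fun n _ => key n).trans ?_
    rw [← Finset.mul_sum, mul_assoc]
    exact mul_le_mul_of_nonneg_left (sum_antidiagonal_le (a := fun n => ‖P n‖ * r ^ n)
      (b := fun n => ‖Q n‖ * r ^ n) (fun n => by positivity) (fun n => by positivity) hC hC' s)
      (norm_nonneg B)
  · have h := hasSum_bilin B (HasBoundedSeries.hasSum hP hy) (HasBoundedSeries.hasSum hQ hy)
      (hPs.of_nonneg_of_le (fun _ => norm_nonneg _) fun n => norm_apply_diag_le (P n) hy.le)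
      (hQs.of_nonneg_of_le (fun _ => norm_nonneg _) fun n => norm_apply_diag_le (Q n) hy.le)
    refine (congrArg (fun F => HasSum F _) (funext fun n => ?_)).mp h
    simp only [sum_apply, bilinTerm_apply]

lemma hasSum_apply_diag {ι : Type*} {n : ℕ} {R : ι → E [×n]→L[𝕜] W} (hR : Summable R) (y : E) :
    HasSum (fun i => R i fun _ => y) ((∑' i, R i) fun _ => y) :=
  (ContinuousMultilinearMap.apply 𝕜 (fun _ : Fin n => E) W fun _ => y).hasSum hR.hasSum

/-- Infinite sums of power series. -/
lemma HasBoundedSeries.tsum [CompleteSpace W] {f : ℕ → E → W} {F : E → W} {x : E} {r : ℝ}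
    {C : ℕ → ℝ} (hf : ∀ i, HasBoundedSeries 𝕜 (f i) x r (C i)) (hC : Summable C)
    (hF : ∀ y : E, ‖y‖ < r → HasSum (fun i => f i (x + y)) (F (x + y))) :
    HasBoundedSeries 𝕜 F x r (∑' i, C i) := by
  have hr := (hf 0).pos
  choose P hP hb using hf
  have hPs : ∀ i, Summable fun n => ‖P i n‖ * r ^ n := fun i =>
    summable_of_sum_le (fun n => by positivity) (hb i)
  have hle : ∀ i, ∑' n, ‖P i n‖ * r ^ n ≤ C i := fun i => (hPs i).tsum_le_of_sum_le (hb i)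
  -- Absolute summability over all pairs (index of the function, degree) justifies every interchange
  -- below: the coefficients of the sum are the columnwise sums of coefficients.
  have hsum : Summable fun z : ℕ × ℕ => ‖P z.1 z.2‖ * r ^ z.2 := by
    rw [summable_prod_of_nonneg fun z => by positivity]
    exact ⟨hPs, hC.of_nonneg_of_le (fun i => tsum_nonneg fun n => by positivity) hle⟩
  have hsum' : Summable fun z : ℕ × ℕ => ‖P z.2 z.1‖ * r ^ z.1 :=
    (Equiv.prodComm ℕ ℕ).summable_iff.2 hsum
  have hcol : ∀ n, Summable fun i => ‖P i n‖ := fun n => by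
    have h := hsum'.prod_factor n
    exact (summable_mul_right_iff (pow_pos hr n).ne').1 h
  have hcolP : ∀ n, Summable fun i => P i n := fun n => (hcol n).of_norm
  refine .mk' hr (fun n => ∑' i, P i n) (fun s => ?_) fun y hy => ?_
  · calc ∑ n ∈ s, ‖∑' i, P i n‖ * r ^ n ≤ ∑ n ∈ s, ∑' i, ‖P i n‖ * r ^ n := by
          refine Finset.sum_le_sum fun n _ => ?_
          rw [tsum_mul_right]
          gcongr
          exact norm_tsum_le_tsum_norm (hcol n)
      _ ≤ ∑' n, ∑' i, ‖P i n‖ * r ^ n :=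
          hsum'.prod.sum_le_tsum _ fun n _ => tsum_nonneg fun i => by positivity
      _ = ∑' i, ∑' n, ‖P i n‖ * r ^ n :=
          Summable.tsum_comm (f := fun i n => ‖P i n‖ * r ^ n) hsum
      _ ≤ ∑' i, C i := Summable.tsum_le_tsum hle hsum.prod hC
  · have hs : Summable fun z : ℕ × ℕ => P z.1 z.2 fun _ => y :=
      Summable.of_norm_bounded hsum fun z =>
        norm_apply_diag_le (P z.1 z.2) hy.le
    have h1 := hs.hasSum.prod_fiberwise fun i => HasBoundedSeries.hasSum (hP i) hy
    have h2 := (Equiv.prodComm ℕ ℕ).hasSum_iff.2 hs.hasSum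
    rw [h1.unique (hF y hy)] at h2
    refine h2.prod_fiberwise (g := fun n => (∑' i, P i n) fun _ => y) fun n => ?_
    exact hasSum_apply_diag (hcolP n) y

set_option maxSynthPendingDepth 5 in
/-- The diagonal values of a multilinear map along a power series. -/
lemma HasBoundedSeries.multilin [CompleteSpace W] {τ : E → W₁} {x : E} {r C : ℝ}
    (hτ : HasBoundedSeries 𝕜 τ x r C) :
    ∀ (n : ℕ) {φ : E → (W₁ [×n]→L[𝕜] W)} {C' : ℝ}, HasBoundedSeries 𝕜 φ x r C' →
      HasBoundedSeries 𝕜 (fun y => φ y fun _ => τ y) x r (C' * C ^ n)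
  | 0, φ, C', hφ => by
      have h := hφ.compCLM (ContinuousMultilinearMap.apply 𝕜 (fun _ : Fin 0 => W₁) W fun i => i.elim0)
      have h1 : ‖ContinuousMultilinearMap.apply 𝕜 (fun _ : Fin 0 => W₁) W fun i => i.elim0‖ ≤ 1 :=
        ContinuousLinearMap.opNorm_le_bound _ zero_le_one fun m => by
          simp
      refine (h.mono h.pos le_rfl ?_).congr fun y _ => ?_
      · simpa using mul_le_of_le_one_left hφ.nonneg h1
      · exact congrArg _ (funext fun i => i.elim0)
  | n + 1, φ, C', hφ => by
      -- Currying is an isometry, so inserting τ into the first argument is a bilinear operation of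
      -- norm at most 1 and costs exactly one factor C. The remaining n arguments are handled by
      -- induction.
      let e := (continuousMultilinearCurryLeftEquiv 𝕜 (fun _ : Fin (n + 1) => W₁) W)
      let B : (W₁ [×(n + 1)]→L[𝕜] W) →L[𝕜] W₁ →L[𝕜] (W₁ [×n]→L[𝕜] W) :=
        e.toContinuousLinearEquiv.toContinuousLinearMap
      have hB : ‖B‖ ≤ 1 := ContinuousLinearMap.opNorm_le_bound _ zero_le_one fun m => by
        rw [one_mul]
        exact (e.norm_map m).le
      have h := HasBoundedSeries.multilin hτ n (hφ.bilin B hτ)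
      refine (h.mono h.pos le_rfl ?_).congr fun y _ => ?_
      · have h0 := hτ.nonneg
        have h0' := hφ.nonneg
        calc ‖B‖ * C' * C * C ^ n ≤ 1 * C' * C * C ^ n := by gcongr
          _ = C' * C ^ (n + 1) := by ring
      · change φ (x + y) (Fin.cons (τ (x + y)) fun _ => τ (x + y)) = _
        congr 1
        funext i
        refine Fin.cases rfl (fun _ => rfl) i

end BoundedSeries

/-! ### Products of locally analytic functions -/

section LocBddBilin

variable {p : ℕ} [Fact p.Prime] {Fp : Type} [NormedField Fp] [NormedAlgebra ℚ_[p] Fp]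
  {W W₁ W₂ W₃ : Type} [NormedAddCommGroup W] [NormedSpace ℚ_[p] W]
  [NormedAddCommGroup W₁] [NormedSpace ℚ_[p] W₁] [NormedAddCommGroup W₂] [NormedSpace ℚ_[p] W₂]
  [NormedAddCommGroup W₃] [NormedSpace ℚ_[p] W₃]

/-- Bounded coefficients on a ball become summable on the ball of half the radius, and the radius in
the definition of boundedness is free. -/
lemma isLocBdd_iff {S : Set (PGL2 Fp → W)} : IsLocBdd p S ↔ ∀ g : (M2 Fp)ˣ, ∃ r : ℝ, 0 < r ∧
    ∃ C : ℝ, ∀ f ∈ S, HasBoundedSeries ℚ_[p] (onMatrices f) (entries g) r C := by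
  refine ⟨fun h g => ?_, fun h g => ?_⟩
  · obtain ⟨r, hr, C, hC⟩ := h g
    refine ⟨r / 2, by positivity, 2 * C, fun f hf => ?_⟩
    obtain ⟨P, hP, hPC⟩ := hC f hf
    exact .of_bound hr hP hPC
  · obtain ⟨r, hr, C, hC⟩ := h g
    refine ⟨r, hr, C, fun f hf => ?_⟩
    obtain ⟨P, hP, hPC⟩ := hC f hf
    exact ⟨P, hP, fun n => by simpa using hPC {n}⟩

/-- This allows statements about single locally analytic functions, such as stability under
products, to be deduced from the statements about bounded sets. -/
lemma isLocBdd_singleton {f : PGL2 Fp → W} : IsLocBdd p {f} ↔ IsLocAn p f := by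
  refine ⟨fun h g => ?_, fun h => isLocBdd_iff.2 fun g => ?_⟩
  · obtain ⟨r, hr, C, hC⟩ := h g
    obtain ⟨P, hP, -⟩ := hC f rfl
    exact ⟨P, _, hP⟩
  · obtain ⟨r, hr, h⟩ := HasBoundedSeries.of_analyticAt (h g) (lt_add_one _)
    refine ⟨r, hr, ‖onMatrices f (entries g)‖ + 1, ?_⟩
    rintro _ rfl
    exact h r hr le_rfl

lemma onMatrices_bilin (B : W₁ →L[ℚ_[p]] W₂ →L[ℚ_[p]] W₃) (e : PGL2 Fp → W₁) (f : PGL2 Fp → W₂) :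
    onMatrices (fun k => B (e k) (f k)) = fun X => B (onMatrices e X) (onMatrices f X) := by
  funext X
  by_cases hX : IsUnit (Matrix.of X)
  · simp [onMatrices_of _ _ hX]
  · simp [onMatrices_of_not _ _ hX]

lemma IsLocBdd.bilin [CompleteSpace W₃] (B : W₁ →L[ℚ_[p]] W₂ →L[ℚ_[p]] W₃) {e : PGL2 Fp → W₁}
    (he : IsLocAn p e) {S : Set (PGL2 Fp → W₂)} (hS : IsLocBdd p S) :
    IsLocBdd p ((fun f k => B (e k) (f k)) '' S) := by
  rw [isLocBdd_iff] at hS ⊢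
  intro g
  obtain ⟨r, hr, C, hC⟩ := hS g
  obtain ⟨r', hr', h'⟩ := HasBoundedSeries.of_analyticAt (he g) (lt_add_one _)
  refine ⟨min r r', lt_min hr hr', ‖B‖ * (‖onMatrices e (entries g)‖ + 1) * C, ?_⟩
  rintro _ ⟨f, hf, rfl⟩
  rw [onMatrices_bilin]
  exact (h' _ (lt_min hr hr') (min_le_right _ _)).bilin B
    ((hC f hf).mono (lt_min hr hr') (min_le_left _ _) le_rfl)

lemma IsLocAn.bilin [CompleteSpace W₃] (B : W₁ →L[ℚ_[p]] W₂ →L[ℚ_[p]] W₃) {e : PGL2 Fp → W₁}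
    (he : IsLocAn p e) {f : PGL2 Fp → W₂} (hf : IsLocAn p f) :
    IsLocAn p fun k => B (e k) (f k) := by
  have h := IsLocBdd.bilin B he (isLocBdd_singleton.2 hf)
  rwa [Set.image_singleton, isLocBdd_singleton] at h

/-- A criterion that avoids the extension by zero in `onMatrices`: since the invertible matrices
form an open set, only a formula in the entries of invertible matrices is needed. -/
lemma isLocAn_of_entries {e : PGL2 Fp → W} {φ : (Fin 2 → Fin 2 → Fp) → W}
    (h : ∀ g : (M2 Fp)ˣ, e (QuotientGroup.mk g) = φ (entries g))
    (hφ : ∀ g : (M2 Fp)ˣ, AnalyticAt ℚ_[p] φ (entries g)) : IsLocAn p e := fun g => by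
  refine (hφ g).congr ?_
  filter_upwards [isOpen_unitSet.mem_nhds (isUnit_of_entries g)] with X hX
  rw [onMatrices_of _ _ hX, h]
  rfl

end LocBddBilin

/-! ### Coordinates on `B \ PGL₂(F_𝔭)` -/

section Coordinates

variable {Fp : Type} [NormedField Fp]

open Classical in
/-- The entry of larger norm in the lower row. -/
def pivot (X : Fin 2 → Fin 2 → Fp) : Fp := if ‖X 1 1‖ ≤ ‖X 1 0‖ then X 1 0 else X 1 1

open Classical in
/-- The quotient of the entries of the lower row, with the pivot as denominator. -/
def rowCoord (X : Fin 2 → Fin 2 → Fp) : Fp :=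
  if ‖X 1 1‖ ≤ ‖X 1 0‖ then X 1 1 / X 1 0 else X 1 0 / X 1 1

/-- The determinant divided by the square of the pivot. -/
def detPivot (X : Fin 2 → Fin 2 → Fp) : Fp :=
  (X 0 0 * X 1 1 - X 0 1 * X 1 0) * (pivot X)⁻¹ ^ 2

lemma det_entries_ne_zero (g : (M2 Fp)ˣ) :
    entries g 0 0 * entries g 1 1 - entries g 0 1 * entries g 1 0 ≠ 0 := by
  have h := (Matrix.isUnit_iff_isUnit_det _).1 g.isUnit
  rw [Matrix.det_fin_two] at h
  exact h.ne_zero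

lemma entry_ne_zero_of_le {g : (M2 Fp)ˣ} (h : ‖entries g 1 1‖ ≤ ‖entries g 1 0‖) :
    entries g 1 0 ≠ 0 := fun hc => by
  have h1 : entries g 1 1 = 0 := by
    rw [hc, norm_zero, norm_le_zero_iff] at h
    exact h
  exact det_entries_ne_zero g (by rw [hc, h1]; ring)

lemma entry_ne_zero_of_not_le {g : (M2 Fp)ˣ} (h : ¬ ‖entries g 1 1‖ ≤ ‖entries g 1 0‖) :
    entries g 1 1 ≠ 0 := fun hd => h (by rw [hd, norm_zero]; exact norm_nonneg _)

lemma pivot_ne_zero (g : (M2 Fp)ˣ) : pivot (entries g) ≠ 0 := by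
  by_cases h : ‖entries g 1 1‖ ≤ ‖entries g 1 0‖
  · rw [pivot, if_pos h]
    exact entry_ne_zero_of_le h
  · rw [pivot, if_neg h]
    exact entry_ne_zero_of_not_le h

lemma detPivot_ne_zero (g : (M2 Fp)ˣ) : detPivot (entries g) ≠ 0 :=
  mul_ne_zero (det_entries_ne_zero g) (pow_ne_zero _ (inv_ne_zero (pivot_ne_zero g)))

/-- Dividing by the larger entry puts both charts of ℙ¹ inside the closed unit ball, whose
compactness provides the finite covering used for the approximation. -/
lemma norm_rowCoord_le (X : Fin 2 → Fin 2 → Fp) : ‖rowCoord X‖ ≤ 1 := by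
  by_cases h : ‖X 1 1‖ ≤ ‖X 1 0‖
  · rw [rowCoord, if_pos h, norm_div]
    exact div_le_one_of_le₀ h (norm_nonneg _)
  · rw [rowCoord, if_neg h, norm_div]
    exact div_le_one_of_le₀ (not_le.1 h).le (norm_nonneg _)

section Borel

variable (a d : Fpˣ) (u : Fp) (g : (M2 Fp)ˣ)

lemma entries_borel_one (j : Fin 2) : entries (borelUnit a d u * g) 1 j = d * entries g 1 j := by
  simp [entries, borelUnit, Matrix.mul_apply, Fin.sum_univ_two]

lemma entries_borel_zero (j : Fin 2) :
    entries (borelUnit a d u * g) 0 j = a * entries g 0 j + u * entries g 1 j := by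
  simp [entries, borelUnit, Matrix.mul_apply, Fin.sum_univ_two]

lemma norm_entries_borel_le_iff :
    ‖entries (borelUnit a d u * g) 1 1‖ ≤ ‖entries (borelUnit a d u * g) 1 0‖ ↔
      ‖entries g 1 1‖ ≤ ‖entries g 1 0‖ := by
  rw [entries_borel_one, entries_borel_one, norm_mul, norm_mul,
    mul_le_mul_iff_right₀ (norm_pos_iff.2 d.ne_zero)]

lemma pivot_borel : pivot (entries (borelUnit a d u * g)) = d * pivot (entries g) := by
  rw [pivot, pivot, entries_borel_one, entries_borel_one]
  refine (if_congr ?_ rfl rfl).trans (mul_ite _ _ _ _).symm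
  rw [← entries_borel_one a d u g, ← entries_borel_one a d u g, norm_entries_borel_le_iff]

lemma rowCoord_borel : rowCoord (entries (borelUnit a d u * g)) = rowCoord (entries g) := by
  have hd : (d : Fp) ≠ 0 := d.ne_zero
  rw [rowCoord, rowCoord]
  refine if_congr (norm_entries_borel_le_iff a d u g) ?_ ?_ <;>
    rw [entries_borel_one, entries_borel_one, mul_div_mul_left _ _ hd]

/-- Left translation by the Borel subgroup multiplies the determinant by ad and the pivot by d, so
this function transforms by a/d. Composing it with a character χ gives a function with the
transformation law of I_B(χ), and composing it with λ gives the additive analogue. -/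
lemma detPivot_borel :
    detPivot (entries (borelUnit a d u * g)) = (a / d : Fpˣ) * detPivot (entries g) := by
  have hd : (d : Fp) ≠ 0 := d.ne_zero
  have hp := pivot_ne_zero g
  rw [detPivot, detPivot, pivot_borel]
  simp only [entries_borel_one, entries_borel_zero, Units.val_div_eq_div_val]
  field_simp
  ring

end Borel

lemma borelUnit_scalar (z : Fpˣ) :
    borelUnit z z 0 = Units.map (algebraMap Fp (M2 Fp) : Fp →* M2 Fp) z := by
  ext i j
  fin_cases i <;> fin_cases j <;> simp [borelUnit, Matrix.algebraMap_matrix_apply]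

/-- A representative of a class in `PGL₂` is a multiple of every other one. -/
lemma exists_out_eq (g : (M2 Fp)ˣ) : ∃ z : Fpˣ,
    (Quotient.out (QuotientGroup.mk g : PGL2 Fp) : (M2 Fp)ˣ) = borelUnit z z 0 * g := by
  obtain ⟨⟨_, ⟨z, rfl⟩⟩, hz⟩ := QuotientGroup.mk_out_eq_mul (scalarUnits Fp (M2 Fp)) g
  refine ⟨z, hz.trans ?_⟩
  rw [borelUnit_scalar]
  ext1
  exact (Algebra.commutes (z : Fp) g.1).symm

/-- The entries of a representative. -/
def reprEntries (k : PGL2 Fp) : Fin 2 → Fin 2 → Fp := entries (Quotient.out k : (M2 Fp)ˣ)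

/-- The chart of `B \ PGL₂(F_𝔭) = ℙ¹(F_𝔭)` that contains the class of `k`. -/
def InChart (k : PGL2 Fp) : Prop := ‖reprEntries k 1 1‖ ≤ ‖reprEntries k 1 0‖

/-- The coordinate in this chart. -/
def chartCoord (k : PGL2 Fp) : Fp := rowCoord (reprEntries k)

/-- The function `det / c²` or `det / d²`. -/
def delta (k : PGL2 Fp) : Fpˣ := Units.mk0 (detPivot (reprEntries k)) (detPivot_ne_zero _)

lemma inChart_mk (g : (M2 Fp)ˣ) :
    InChart (QuotientGroup.mk g : PGL2 Fp) ↔ ‖entries g 1 1‖ ≤ ‖entries g 1 0‖ := by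
  obtain ⟨z, hz⟩ := exists_out_eq g
  rw [InChart, reprEntries, hz, norm_entries_borel_le_iff]

lemma chartCoord_mk (g : (M2 Fp)ˣ) :
    chartCoord (QuotientGroup.mk g : PGL2 Fp) = rowCoord (entries g) := by
  obtain ⟨z, hz⟩ := exists_out_eq g
  rw [chartCoord, reprEntries, hz, rowCoord_borel]

lemma delta_mk (g : (M2 Fp)ˣ) :
    (delta (QuotientGroup.mk g : PGL2 Fp) : Fp) = detPivot (entries g) := by
  obtain ⟨z, hz⟩ := exists_out_eq g
  change detPivot (reprEntries _) = _
  rw [reprEntries, hz, detPivot_borel, div_self', Units.val_one, one_mul]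

lemma inChart_borel (a d : Fpˣ) (u : Fp) (k : PGL2 Fp) : InChart (borel a d u * k) ↔ InChart k := by
  obtain ⟨g, rfl⟩ := QuotientGroup.mk_surjective k
  exact (inChart_mk _).trans ((norm_entries_borel_le_iff a d u g).trans (inChart_mk g).symm)

lemma chartCoord_borel (a d : Fpˣ) (u : Fp) (k : PGL2 Fp) :
    chartCoord (borel a d u * k) = chartCoord k := by
  obtain ⟨g, rfl⟩ := QuotientGroup.mk_surjective k
  exact (chartCoord_mk _).trans ((rowCoord_borel a d u g).trans (chartCoord_mk g).symm)

lemma delta_borel (a d : Fpˣ) (u : Fp) (k : PGL2 Fp) :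
    delta (borel a d u * k) = a / d * delta k := by
  obtain ⟨g, rfl⟩ := QuotientGroup.mk_surjective k
  ext1
  rw [Units.val_mul, delta_mk]
  exact (delta_mk _).trans (detPivot_borel a d u g)

/-- A representative of the point with coordinate `t` in the chart `|d| ≤ |c|`. -/
def chartPoint₁ (t : Fp) : (M2 Fp)ˣ where
  val := !![0, -1; 1, t]
  inv := !![t, 1; -1, 0]
  val_inv := by
    ext i j
    fin_cases i <;> fin_cases j <;> simp [Matrix.mul_apply, Fin.sum_univ_two]
  inv_val := by
    ext i j
    fin_cases i <;> fin_cases j <;> simp [Matrix.mul_apply, Fin.sum_univ_two]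

/-- A representative of the point with coordinate `t` in the chart `|c| < |d|`. -/
def chartPoint₂ (t : Fp) : (M2 Fp)ˣ where
  val := !![1, 0; t, 1]
  inv := !![1, 0; -t, 1]
  val_inv := by
    ext i j
    fin_cases i <;> fin_cases j <;> simp [Matrix.mul_apply, Fin.sum_univ_two]
  inv_val := by
    ext i j
    fin_cases i <;> fin_cases j <;> simp [Matrix.mul_apply, Fin.sum_univ_two]

/-- The Bruhat-type decomposition over the first chart, with the torus part equal to `delta`. It
shows that a function in the induced space is determined by its values on the section `chartPoint₁`.
-/
lemma exists_eq_borel_mul₁ {k : PGL2 Fp} (hk : InChart k) : ∃ a d u, a / d = delta k ∧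
    k = borel a d u * QuotientGroup.mk (chartPoint₁ (chartCoord k)) := by
  obtain ⟨g, rfl⟩ := QuotientGroup.mk_surjective k
  rw [inChart_mk] at hk
  have hc := entry_ne_zero_of_le hk
  have hdet := det_entries_ne_zero g
  -- Multiplying out, (a, u; 0, d)(0, -1; 1, t) = (u, ut - a; d, dt). Comparison with g forces d to
  -- be its lower left entry, u its upper left entry, and a its determinant divided by d.
  refine ⟨Units.mk0 _ hdet / Units.mk0 _ hc, Units.mk0 _ hc, entries g 0 0, ?_, ?_⟩
  · ext1
    rw [delta_mk, detPivot, pivot, if_pos hk]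
    simp only [Units.val_div_eq_div_val, Units.val_mk0]
    field_simp
  · rw [chartCoord_mk, rowCoord, if_pos hk, borel, ← QuotientGroup.mk_mul]
    congr 1
    ext i j
    simp only [entries] at hc ⊢
    fin_cases i <;> fin_cases j <;>
      simp [Matrix.mul_apply, Fin.sum_univ_two, borelUnit, chartPoint₁] <;> field_simp
    ring

lemma exists_eq_borel_mul₂ {k : PGL2 Fp} (hk : ¬ InChart k) : ∃ a d u, a / d = delta k ∧
    k = borel a d u * QuotientGroup.mk (chartPoint₂ (chartCoord k)) := by
  obtain ⟨g, rfl⟩ := QuotientGroup.mk_surjective k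
  rw [inChart_mk] at hk
  have hd := entry_ne_zero_of_not_le hk
  have hdet := det_entries_ne_zero g
  refine ⟨Units.mk0 _ hdet / Units.mk0 _ hd, Units.mk0 _ hd, entries g 0 1, ?_, ?_⟩
  · ext1
    rw [delta_mk, detPivot, pivot, if_neg hk]
    simp only [Units.val_div_eq_div_val, Units.val_mk0]
    field_simp
  · rw [chartCoord_mk, rowCoord, if_neg hk, borel, ← QuotientGroup.mk_mul]
    congr 1
    ext i j
    simp only [entries] at hd ⊢
    fin_cases i <;> fin_cases j <;>
      simp [Matrix.mul_apply, Fin.sum_univ_two, borelUnit, chartPoint₂] <;> field_simp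
    ring

end Coordinates

/-! ### Analyticity of the coordinates and of the determinant function -/

section CoordinatesAnalytic

open Filter Topology

variable {p : ℕ} [Fact p.Prime] {Fp : Type} [NormedField Fp] [NormedAlgebra ℚ_[p] Fp]

/-- In an ultrametric field the norm is locally constant away from 0 and closed balls of nonzero
radius are open. So both the condition defining the first chart and its negation are open on
invertible matrices, and functions defined by cases on it are locally given by one of the two
formulas. -/
lemma eventually_norm_entries_le_iff (p : ℕ) [Fact p.Prime] {Fp : Type} [NormedField Fp]
    [NormedAlgebra ℚ_[p] Fp] (g : (M2 Fp)ˣ) :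
    ∀ᶠ X in 𝓝 (entries g), ‖X 1 1‖ ≤ ‖X 1 0‖ ↔ ‖entries g 1 1‖ ≤ ‖entries g 1 0‖ := by
  have : IsUltrametricDist Fp := isUltra p Fp
  have hcont : ∀ j : Fin 2, Continuous fun X : Fin 2 → Fin 2 → Fp => X 1 j := fun j => by fun_prop
  have hloc : ∀ z : Fp, z ≠ 0 → ∀ᶠ y in 𝓝 z, ‖y‖ = ‖z‖ := fun z hz => by
    filter_upwards [Metric.ball_mem_nhds z (norm_pos_iff.2 hz)] with y hy
    rw [Metric.mem_ball, dist_eq_norm] at hy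
    have h : ‖y + -z‖ < max ‖y‖ ‖-z‖ := by
      rw [← sub_eq_add_neg, norm_neg]
      exact lt_max_of_lt_right hy
    simpa using IsUltrametricDist.norm_eq_of_add_norm_lt_max h
  by_cases hcd : ‖entries g 1 1‖ ≤ ‖entries g 1 0‖
  · have hc := entry_ne_zero_of_le hcd
    have h2 : ∀ᶠ y in 𝓝 (entries g 1 1), ‖y‖ ≤ ‖entries g 1 0‖ := by
      have := (IsUltrametricDist.isOpen_closedBall (0 : Fp) (norm_ne_zero_iff.2 hc)).mem_nhds
        (show entries g 1 1 ∈ Metric.closedBall 0 ‖entries g 1 0‖ by simpa using hcd)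
      filter_upwards [this] with y hy
      simpa using hy
    filter_upwards [(hcont 0).continuousAt.eventually (hloc _ hc),
      (hcont 1).continuousAt.eventually h2] with X hX1 hX2
    simp only [hcd, iff_true]
    rw [hX1]
    exact hX2
  · have hd := entry_ne_zero_of_not_le hcd
    have h2 : ∀ᶠ y in 𝓝 (entries g 1 0), ‖y‖ < ‖entries g 1 1‖ :=
      continuous_norm.continuousAt.eventually (gt_mem_nhds (not_le.1 hcd))
    filter_upwards [(hcont 1).continuousAt.eventually (hloc _ hd),
      (hcont 0).continuousAt.eventually h2] with X hX1 hX2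
    simp only [hcd, iff_false, not_le]
    rw [hX1]
    exact hX2

lemma rowCoord_analyticAt (g : (M2 Fp)ˣ) : AnalyticAt ℚ_[p] rowCoord (entries g) := by
  have key : ∀ i j : Fin 2, entries g 1 j ≠ 0 →
      AnalyticAt ℚ_[p] (fun X : Fin 2 → Fin 2 → Fp => X 1 i / X 1 j) (entries g) :=
    fun i j hj => by
      simp only [div_eq_mul_inv]
      exact (analyticAt_entry 1 i _).mul (AnalyticAt.fun_inv
        (f := fun X : Fin 2 → Fin 2 → Fp => X 1 j) (analyticAt_entry 1 j _) hj)
  by_cases hcd : ‖entries g 1 1‖ ≤ ‖entries g 1 0‖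
  · refine (key 1 0 (entry_ne_zero_of_le hcd)).congr ?_
    filter_upwards [eventually_norm_entries_le_iff p g] with X hX
    rw [rowCoord, if_pos (hX.2 hcd)]
  · refine (key 0 1 (entry_ne_zero_of_not_le hcd)).congr ?_
    filter_upwards [eventually_norm_entries_le_iff p g] with X hX
    rw [rowCoord, if_neg (mt hX.1 hcd)]

lemma pivot_analyticAt (g : (M2 Fp)ˣ) : AnalyticAt ℚ_[p] pivot (entries g) := by
  by_cases hcd : ‖entries g 1 1‖ ≤ ‖entries g 1 0‖
  · refine (analyticAt_entry 1 0 _).congr ?_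
    filter_upwards [eventually_norm_entries_le_iff p g] with X hX
    rw [pivot, if_pos (hX.2 hcd)]
  · refine (analyticAt_entry 1 1 _).congr ?_
    filter_upwards [eventually_norm_entries_le_iff p g] with X hX
    rw [pivot, if_neg (mt hX.1 hcd)]

lemma detPivot_analyticAt (g : (M2 Fp)ˣ) : AnalyticAt ℚ_[p] detPivot (entries g) :=
  (((analyticAt_entry 0 0 _).mul (analyticAt_entry 1 1 _)).sub
    ((analyticAt_entry 0 1 _).mul (analyticAt_entry 1 0 _))).mul
      ((AnalyticAt.fun_inv (f := pivot) (pivot_analyticAt g) (pivot_ne_zero g)).pow 2)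

lemma isLocAn_comp_delta {W : Type} [NormedAddCommGroup W] [NormedSpace ℚ_[p] W] {f : Fpˣ → W}
    (hf : IsLocAnUnits p f) : IsLocAn p fun k : PGL2 Fp => f (delta k) := by
  refine isLocAn_of_entries (φ := fun X => onField f (detPivot X)) (fun g => ?_) fun g => ?_
  · exact (onField_unit f _ _ (delta_mk g).symm).symm
  · refine AnalyticAt.comp (g := onField f) (f := detPivot) ?_ (detPivot_analyticAt g)
    exact hf (Units.mk0 _ (detPivot_ne_zero g))

end CoordinatesAnalytic

/-! ### Approximation in locally analytic principal series -/

section Approximation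

open Filter Topology

/-- The i-th term of a series with coefficients bounded at radius R, evaluated along a function of
size R/2, has size at most C · 2⁻ⁱ in the norm of power series in the new variable. The tail from
degree M onwards is therefore a geometric series of size 2C · 2⁻ᴹ. -/
lemma HasBoundedSeries.tail {𝕜 E W W₁ : Type*} [NontriviallyNormedField 𝕜]
    [NormedAddCommGroup E] [NormedSpace 𝕜 E] [NormedAddCommGroup W] [NormedSpace 𝕜 W]
    [NormedAddCommGroup W₁] [NormedSpace 𝕜 W₁] [CompleteSpace W]
    {P : FormalMultilinearSeries 𝕜 W₁ W} {R C : ℝ} (hP : ∀ n, ‖P n‖ * R ^ n ≤ C)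
    {τ : E → W₁} {x : E} {r : ℝ} (hτ : HasBoundedSeries 𝕜 τ x r (R / 2)) {G : E → W} (M : ℕ)
    (hG : ∀ y : E, ‖y‖ < r → HasSum (fun i => P (i + M) fun _ => τ (x + y)) (G (x + y))) :
    HasBoundedSeries 𝕜 G x r (2 * C * (1 / 2) ^ M) := by
  have hsum : HasSum (fun i => C * (1 / 2) ^ M * (1 / 2) ^ i) (C * (1 / 2) ^ M * 2) :=
    hasSum_geometric_two.mul_left _
  have h := HasBoundedSeries.tsum (𝕜 := 𝕜) (x := x) (r := r) (f := fun i y => P (i + M) fun _ => τ y) (F := G)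
    (C := fun i => C * (1 / 2) ^ M * (1 / 2) ^ i) (fun i => ?_) hsum.summable hG
  · rw [hsum.tsum_eq] at h
    exact h.mono h.pos le_rfl (by ring_nf; rfl)
  · have h1 := hτ.multilin (i + M) (HasBoundedSeries.const (𝕜 := 𝕜) (P (i + M)) x hτ.pos)
    refine h1.mono h1.pos le_rfl ?_
    calc ‖P (i + M)‖ * (R / 2) ^ (i + M) = (‖P (i + M)‖ * R ^ (i + M)) * (1 / 2) ^ (i + M) := by
          rw [div_pow, div_pow, one_pow]; ring
      _ ≤ C * (1 / 2) ^ (i + M) := by gcongr; exact hP _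
      _ = C * (1 / 2) ^ M * (1 / 2) ^ i := by rw [pow_add]; ring

/-- A covering of the unit ball of a non-Archimedean local field by finitely many balls of given
radii, with a locally constant choice of a ball that contains a given point. -/
lemma exists_locally_constant_cover {K : Type*} [NormedField K] [ProperSpace K]
    [IsUltrametricDist K] (R : K → ℝ) (hR : ∀ t, 0 < R t) :
    ∃ (T : Finset K) (c : K → K), (∀ t, ∀ᶠ t' in 𝓝 t, c t' = c t) ∧
      ∀ t, ‖t‖ ≤ 1 → c t ∈ T ∧ ‖t - c t‖ < R (c t) := by
  classical
  obtain ⟨T, -, hT⟩ := (isCompact_closedBall (0 : K) 1).elim_nhds_subcover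
    (fun t => Metric.ball t (R t)) fun t _ => Metric.ball_mem_nhds t (hR t)
  -- The chosen centre depends only on the set of balls of the covering that contain t. This set is
  -- locally constant because balls are both open and closed. The default value 0 can only occur
  -- outside the unit ball, where nothing is claimed about the centre.
  let sel : Finset K → K := fun S => if h : S.Nonempty then h.choose else 0
  refine ⟨T, fun t => sel (T.filter fun s => t ∈ Metric.ball s (R s)), fun t => ?_, fun t ht => ?_⟩
  · have h : ∀ᶠ t' in 𝓝 t, ∀ s ∈ T, t' ∈ Metric.ball s (R s) ↔ t ∈ Metric.ball s (R s) := by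
      rw [Finset.eventually_all]
      intro s _
      by_cases hs : t ∈ Metric.ball s (R s)
      · filter_upwards [Metric.isOpen_ball.mem_nhds hs] with t' ht'
        simp only [hs, ht']
      · filter_upwards [(IsUltrametricDist.isClosed_ball s (R s)).isOpen_compl.mem_nhds hs]
          with t' ht'
        simp only [hs, iff_false]
        exact ht'
    filter_upwards [h] with t' ht'
    exact congrArg sel (Finset.filter_congr ht')
  · have hne : (T.filter fun s => t ∈ Metric.ball s (R s)).Nonempty := by
      obtain ⟨s, hs, hts⟩ := Set.mem_iUnion₂.1 (hT (mem_closedBall_zero_iff.2 ht))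
      exact ⟨s, Finset.mem_filter.2 ⟨hs, hts⟩⟩
    have hsel : sel (T.filter fun s => t ∈ Metric.ball s (R s)) = hne.choose := dif_pos hne
    have hmem := Finset.mem_filter.1 hne.choose_spec
    change sel _ ∈ T ∧ ‖t - sel _‖ < R (sel _)
    rw [hsel]
    exact ⟨hmem.1, by simpa [dist_eq_norm] using hmem.2⟩

variable {p : ℕ} [Fact p.Prime] {Fp : Type} [NormedField Fp] [NormedAlgebra ℚ_[p] Fp]

section

variable {W : Type} [NormedAddCommGroup W] [NormedSpace ℚ_[p] W]

lemma chartPoint₁_entries_analyticAt (t : Fp) :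
    AnalyticAt ℚ_[p] (fun t : Fp => entries (chartPoint₁ t)) t := by
  refine AnalyticAt.pi fun i => AnalyticAt.pi fun j => ?_
  fin_cases i <;> fin_cases j
  · exact analyticAt_const
  · exact analyticAt_const
  · exact analyticAt_const
  · exact analyticAt_id

lemma chartPoint₂_entries_analyticAt (t : Fp) :
    AnalyticAt ℚ_[p] (fun t : Fp => entries (chartPoint₂ t)) t := by
  refine AnalyticAt.pi fun i => AnalyticAt.pi fun j => ?_
  fin_cases i <;> fin_cases j
  · exact analyticAt_const
  · exact analyticAt_const
  · exact analyticAt_id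
  · exact analyticAt_const

/-- Local analyticity on the group is tested on matrices, so it pulls back along any analytic family
of matrices, in particular along the two sections of the charts. -/
lemma IsLocAn.comp_entries {f : PGL2 Fp → W} (hf : IsLocAn p f) {σ : Fp → (M2 Fp)ˣ} {t : Fp}
    (hσ : AnalyticAt ℚ_[p] (fun t => entries (σ t)) t) :
    AnalyticAt ℚ_[p] (fun t => f (QuotientGroup.mk (σ t))) t := by
  have h := AnalyticAt.comp (g := onMatrices f) (f := fun t => entries (σ t)) (hf (σ t)) hσ
  refine h.congr (Eventually.of_forall fun s => ?_)
  exact (onMatrices_of f _ (isUnit_of_entries (σ s))).trans (congrArg f (congrArg _ (Units.ext rfl)))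

end

open Classical in
/-- The number of the chart that contains the class of `k`. -/
def chartIdx (k : PGL2 Fp) : Bool := decide (InChart k)

open Classical in
lemma chartIdx_mk (g : (M2 Fp)ˣ) :
    chartIdx (QuotientGroup.mk g : PGL2 Fp) = decide (‖entries g 1 1‖ ≤ ‖entries g 1 0‖) := by
  simp only [chartIdx, inChart_mk]

lemma chartIdx_borel (a d : Fpˣ) (u : Fp) (k : PGL2 Fp) :
    chartIdx (borel a d u * k) = chartIdx k := by
  unfold chartIdx
  congr 1
  exact propext (inChart_borel a d u k)

/-- Near a given matrix neither the chart nor the centre of the expansion changes, so a function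
defined region by region coincides locally with a single power series in `rowCoord`. -/
lemma eventually_chart_const (p : ℕ) [Fact p.Prime] {Fp : Type} [NormedField Fp]
    [NormedAlgebra ℚ_[p] Fp] {c : Fp → Fp} (hc : ∀ t, ∀ᶠ t' in 𝓝 t, c t' = c t)
    (g : (M2 Fp)ˣ) :
    ∀ᶠ X in 𝓝 (entries g), ∀ h : (M2 Fp)ˣ, entries h = X →
      chartIdx (QuotientGroup.mk h : PGL2 Fp) = chartIdx (QuotientGroup.mk g : PGL2 Fp) ∧
      c (chartCoord (QuotientGroup.mk h : PGL2 Fp))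
        = c (chartCoord (QuotientGroup.mk g : PGL2 Fp)) := by
  have h1 := (rowCoord_analyticAt (p := p) g).continuousAt.eventually (hc _)
  filter_upwards [eventually_norm_entries_le_iff p g, h1] with X hX hX'
  rintro h rfl
  refine ⟨?_, ?_⟩
  · simp only [chartIdx_mk, hX]
  · rw [chartCoord_mk, chartCoord_mk, hX']

end Approximation

/-! ### The section `I_B(1_k) → I_B(χ)` and its density -/

section IndSection

variable {p : ℕ} [Fact p.Prime] {Fp : Type} [NormedField Fp] [NormedAlgebra ℚ_[p] Fp]
  {Ω : Type} [NormedField Ω] [NormedAlgebra ℚ_[p] Ω]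
  {A : Type} [NormedCommRing A] [NormedAlgebra ℚ_[p] A] [NormedAlgebra Ω A]
  [IsScalarTower ℚ_[p] Ω A]

/-- Locally analytic characters. -/
structure LocAnChar (p : ℕ) [Fact p.Prime] (Fp : Type) [NormedField Fp] [NormedAlgebra ℚ_[p] Fp]
    (R : Type) [NormedCommRing R] [NormedAlgebra ℚ_[p] R] where
  /-- the character -/
  char : Fpˣ →* Rˣ
  isLocAn : IsLocAnUnits p fun y => (char y : R)

lemma IsLocAnUnits.inv {χ : Fpˣ →* Ωˣ} (h : IsLocAnUnits p fun y => (χ y : Ω)) :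
    IsLocAnUnits p fun y => ((χ y)⁻¹ : Ωˣ).1 := fun y => by
  have hy : onField (fun y => (χ y : Ω)) (y : Fp) = χ y := onField_unit _ _ _ rfl
  refine ((h y).fun_inv (by rw [hy]; exact (χ y).ne_zero)).congr ?_
  filter_upwards [isOpen_ne.mem_nhds y.ne_zero] with z hz
  rw [onField_unit _ z (Units.mk0 z hz) rfl, onField_unit _ z (Units.mk0 z hz) rfl,
    Units.val_inv_eq_inv_val]

variable (χ₀ : LocAnChar p Fp Ω) (χ : LocAnChar p Fp A)

/-- `I_B(χ)` contains the products of `χ ∘ δ` with invariant functions. -/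
lemma mem_ind_of_invariant [CompleteSpace Ω] {u : PGL2 Fp → Ω} (hu : IsLocAn p u)
    (hinv : ∀ a d y k, u (borel a d y * k) = u k) :
    (fun k => (χ₀.char (delta k) : Ω) * u k) ∈ Ind p (charRep χ₀.char) :=
  ⟨IsLocAn.bilin (ContinuousLinearMap.mul ℚ_[p] Ω) (isLocAn_comp_delta χ₀.isLocAn) hu, fun a d y k => by
    change (χ₀.char (delta (borel a d y * k)) : Ω) * u (borel a d y * k)
      = (χ₀.char (a / d) : Ω) * ((χ₀.char (delta k) : Ω) * u k)
    rw [delta_borel, hinv, map_mul, Units.val_mul, mul_assoc]⟩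

/-- The function `χ(δ) / χ₀(δ)`. -/
def charQuot (k : PGL2 Fp) : A := ((χ₀.char (delta k))⁻¹ : Ωˣ).1 • (χ.char (delta k) : A)

lemma charQuot_isLocAn [CompleteSpace A] : IsLocAn p (charQuot χ₀ χ) :=
  IsLocAn.bilin (ContinuousLinearMap.lsmul ℚ_[p] Ω)
    (isLocAn_comp_delta χ₀.isLocAn.inv) (isLocAn_comp_delta χ.isLocAn)

variable [CompleteSpace A]

/-- The map `I_B(χ₀) → I_B(χ)`, `f ↦ f χ(δ) / χ₀(δ)`. -/
def indSection : Ind p (charRep χ₀.char) →ₗ[Ω] Ind p (charRep χ.char) where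
  toFun f := ⟨fun k => f.1 k • charQuot χ₀ χ k,
    IsLocAn.bilin (ContinuousLinearMap.lsmul ℚ_[p] Ω) f.2.1 (charQuot_isLocAn χ₀ χ),
    fun a d u k => by
      change f.1 (borel a d u * k) • charQuot χ₀ χ (borel a d u * k)
        = (χ.char (a / d) : A) * (f.1 k • charQuot χ₀ χ k)
      rw [f.2.2]
      change ((χ₀.char (a / d) : Ω) * f.1 k) • charQuot χ₀ χ (borel a d u * k) = _
      rw [charQuot, charQuot, delta_borel, map_mul, map_mul, mul_inv, Units.val_mul, Units.val_mul,
        smul_smul, mul_smul_comm, mul_smul_comm, smul_smul]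
      congr 1
      have h := (χ₀.char (a / d)).mul_inv
      linear_combination f.1 k * ((χ₀.char (delta k))⁻¹ : Ωˣ).1 * h⟩
  map_add' f h := Subtype.ext (funext fun k => add_smul _ _ _)
  map_smul' c f := Subtype.ext (funext fun k => mul_smul _ _ _)

lemma indSection_apply (f : Ind p (charRep χ₀.char)) (k : PGL2 Fp) :
    (indSection χ₀ χ f).1 k = f.1 k • charQuot χ₀ χ k := rfl

lemma indSection_isLocBdd {S : Set (Ind p (charRep χ₀.char))}
    (hS : IsLocBdd p (Subtype.val '' S)) :
    IsLocBdd p (Subtype.val '' (indSection χ₀ χ '' S)) := by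
  refine (IsLocBdd.bilin (ContinuousLinearMap.lsmul ℚ_[p] Ω).flip (charQuot_isLocAn χ₀ χ) hS).mono ?_
  rintro _ ⟨_, ⟨f, hf, rfl⟩, rfl⟩
  exact ⟨f.1, ⟨f, hf, rfl⟩, rfl⟩

/-- The factor χ₀(δ) cancels, so functions on ℙ¹ with values in Ω, multiplied by χ(δ), lie in the
image of the section. These are the building blocks of the approximation. -/
lemma indSection_invariant [CompleteSpace Ω] {u : PGL2 Fp → Ω} (hu : IsLocAn p u)
    (hinv : ∀ a d y k, u (borel a d y * k) = u k) (k : PGL2 Fp) :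
    (indSection χ₀ χ ⟨_, mem_ind_of_invariant χ₀ hu hinv⟩).1 k = u k • (χ.char (delta k) : A) := by
  rw [indSection_apply, charQuot, smul_smul]
  congr 1
  have h := (χ₀.char (delta k)).mul_inv
  change (χ₀.char (delta k) : Ω) * u k * ((χ₀.char (delta k))⁻¹ : Ωˣ).1 = u k
  linear_combination u k * h

end IndSection

/-! ### Density of the A-span of the section, by truncating power series -/

section Density

open Filter Topology

variable {p : ℕ} [Fact p.Prime] {Fp : Type} [NormedField Fp] [NormedAlgebra ℚ_[p] Fp]
  [FiniteDimensional ℚ_[p] Fp]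
  {Ω : Type} [NormedField Ω] [NormedAlgebra ℚ_[p] Ω] [CompleteSpace Ω]
  {A : Type} [NormedCommRing A] [NormedAlgebra ℚ_[p] A] [NormedAlgebra Ω A]
  [IsScalarTower ℚ_[p] Ω A] [CompleteSpace A]

/-- A monomial of the coordinates of `chartCoord - s`, on the region where `chartIdx` is `b` and
the centre chosen by `c` is `s`. -/
def regionMonomial (Ω : Type) [NormedField Ω] [NormedAlgebra ℚ_[p] Ω] (c : Fp → Fp) (b : Bool)
    (s : Fp) {n : ℕ} (idx : Fin n → Fin (Module.finrank ℚ_[p] Fp)) (k : PGL2 Fp) : Ω :=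
  open Classical in
  if chartIdx k = b ∧ c (chartCoord k) = s then
    ∏ j, algebraMap ℚ_[p] Ω ((Module.finBasis ℚ_[p] Fp).coord (idx j) (chartCoord k - s)) else 0

lemma regionMonomial_borel (c : Fp → Fp) (b : Bool) (s : Fp) {n : ℕ}
    (idx : Fin n → Fin (Module.finrank ℚ_[p] Fp)) (a d : Fpˣ) (u : Fp) (k : PGL2 Fp) :
    regionMonomial Ω c b s idx (borel a d u * k) = regionMonomial Ω c b s idx k := by
  unfold regionMonomial
  rw [chartCoord_borel, chartIdx_borel]

/-- The regions are open and closed, so cutting off a polynomial in the coordinates at the boundary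
of a region preserves local analyticity. -/
lemma regionMonomial_isLocAn {c : Fp → Fp} (hc : ∀ t, ∀ᶠ t' in 𝓝 t, c t' = c t) (b : Bool)
    (s : Fp) {n : ℕ} (idx : Fin n → Fin (Module.finrank ℚ_[p] Fp)) :
    IsLocAn p (regionMonomial (Fp := Fp) Ω c b s idx) := fun g => by
  have hev := eventually_chart_const p hc g
  have hU := isOpen_unitSet.mem_nhds (isUnit_of_entries g)
  by_cases hg : chartIdx (QuotientGroup.mk g : PGL2 Fp) = b ∧
      c (chartCoord (QuotientGroup.mk g : PGL2 Fp)) = s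
  · have h : AnalyticAt ℚ_[p] (fun X : Fin 2 → Fin 2 → Fp => ∏ j, algebraMap ℚ_[p] Ω
        ((Module.finBasis ℚ_[p] Fp).coord (idx j) (rowCoord X - s))) (entries g) := by
      refine Finset.analyticAt_fun_prod _ fun j _ => ?_
      let T : Fp →L[ℚ_[p]] Ω := (algebraMapCLM ℚ_[p] Ω).comp
        (LinearMap.toContinuousLinearMap ((Module.finBasis ℚ_[p] Fp).coord (idx j)))
      exact AnalyticAt.comp (g := T) (f := fun X => rowCoord X - s) (T.analyticAt _)
        ((rowCoord_analyticAt g).sub analyticAt_const)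
    refine h.congr ?_
    filter_upwards [hev, hU] with X hX hXu
    have h1 := hX hXu.unit rfl
    rw [onMatrices_of _ _ hXu, regionMonomial, if_pos (by rw [h1.1, h1.2]; exact hg), chartCoord_mk]
    rfl
  · refine (analyticAt_const (v := (0 : Ω))).congr ?_
    filter_upwards [hev, hU] with X hX hXu
    have h1 := hX hXu.unit rfl
    rw [onMatrices_of _ _ hXu, regionMonomial, if_neg (by rw [h1.1, h1.2]; exact hg)]

/-- A homogeneous term is only multilinear over ℚ_p, so it is expanded in a ℚ_p-basis of F_𝔭. This
separates the coefficients, which lie in A, from the monomials, which have values in ℚ_p and hence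
may be viewed as Ω-valued invariant functions. -/
lemma multilinear_diag_expand {n : ℕ} (P : Fp [×n]→L[ℚ_[p]] A) (t : Fp) :
    P (fun _ => t) = ∑ idx : Fin n → Fin (Module.finrank ℚ_[p] Fp),
      (∏ j, algebraMap ℚ_[p] Ω ((Module.finBasis ℚ_[p] Fp).coord (idx j) t)) •
        P fun j => Module.finBasis ℚ_[p] Fp (idx j) := by
  have h : (fun _ : Fin n => t) = fun _ => ∑ i, (Module.finBasis ℚ_[p] Fp).coord i t •
      Module.finBasis ℚ_[p] Fp i := funext fun _ => ((Module.finBasis ℚ_[p] Fp).sum_repr t).symm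
  rw [h, ContinuousMultilinearMap.map_sum]
  refine Finset.sum_congr rfl fun idx _ => ?_
  rw [ContinuousMultilinearMap.map_smul_univ, ← map_prod, algebraMap_smul]

variable (χ₀ : LocAnChar p Fp Ω) (χ : LocAnChar p Fp A)

/-- The truncations of a function given by power series on finitely many regions lie in the span of
the image of the section. -/
lemma exists_truncation {c : Fp → Fp} (hc : ∀ t, ∀ᶠ t' in 𝓝 t, c t' = c t) (T : Finset Fp)
    (hT : ∀ t, ‖t‖ ≤ 1 → c t ∈ T) (P : Bool → Fp → FormalMultilinearSeries ℚ_[p] Fp A) (M : ℕ) :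
    ∃ F ∈ Submodule.span Ω {x | ∃ (a : A) (f : Ind p (charRep χ₀.char)),
        x = a • indSection χ₀ χ f}, ∀ k, F.1 k = (χ.char (delta k) : A) *
      ∑ n ∈ Finset.range M, P (chartIdx k) (c (chartCoord k)) n
        fun _ => chartCoord k - c (chartCoord k) := by
  classical
  -- One summand for each chart b, centre s, degree n and multi-index: the coefficient in A times
  -- the section applied to 1_k-type factor χ₀(δ) times the region monomial.
  let x : Bool → Fp → (n : ℕ) → (Fin n → Fin (Module.finrank ℚ_[p] Fp)) →
      Ind p (charRep χ.char) := fun b s n idx =>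
    (P b s n fun j => Module.finBasis ℚ_[p] Fp (idx j)) • indSection χ₀ χ
      ⟨_, mem_ind_of_invariant χ₀ (regionMonomial_isLocAn hc b s idx)
        (regionMonomial_borel c b s idx)⟩
  have hx : ∀ b s n idx k, (x b s n idx).1 k = (P b s n fun j => Module.finBasis ℚ_[p] Fp (idx j)) *
      (regionMonomial Ω c b s idx k • (χ.char (delta k) : A)) := fun b s n idx k =>
    congrArg (fun z => (P b s n fun j => Module.finBasis ℚ_[p] Fp (idx j)) * z)
      (indSection_invariant χ₀ χ (regionMonomial_isLocAn hc b s idx)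
        (regionMonomial_borel c b s idx) k)
  refine ⟨∑ b, ∑ s ∈ T, ∑ n ∈ Finset.range M, ∑ idx, x b s n idx, ?_, fun k => ?_⟩
  · exact sum_mem fun b _ => sum_mem fun s _ => sum_mem fun n _ => sum_mem fun idx _ =>
      Submodule.subset_span ⟨_, _, rfl⟩
  · have hk : ‖chartCoord k‖ ≤ 1 := norm_rowCoord_le _
    simp only [Submodule.coe_sum, Finset.sum_apply, hx]
    -- At a given point only the summands of its own chart and its own centre survive; the centre
    -- belongs to T because the coordinate has norm at most 1.
    rw [Finset.sum_eq_single (chartIdx k), Finset.sum_eq_single (c (chartCoord k)),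
      Finset.mul_sum]
    · refine Finset.sum_congr rfl fun n _ => ?_
      rw [multilinear_diag_expand (Ω := Ω), Finset.mul_sum]
      refine Finset.sum_congr rfl fun idx _ => ?_
      rw [regionMonomial, if_pos ⟨rfl, rfl⟩, mul_smul_comm, mul_smul_comm, mul_comm]
    · intro s _ hs
      refine Finset.sum_eq_zero fun n _ => Finset.sum_eq_zero fun idx _ => ?_
      rw [regionMonomial, if_neg fun h => hs h.2.symm, zero_smul, mul_zero]
    · exact fun h => (h (hT _ hk)).elim
    · intro b _ hb
      refine Finset.sum_eq_zero fun s _ => Finset.sum_eq_zero fun n _ =>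
        Finset.sum_eq_zero fun idx _ => ?_
      rw [regionMonomial, if_neg fun h => hb h.1.symm, zero_smul, mul_zero]
    · exact fun h => (h (Finset.mem_univ _)).elim

/-- The restriction of a function to the representatives of the points of the charts. -/
def onCharts (f : PGL2 Fp → A) (b : Bool) (t : Fp) : A :=
  f (QuotientGroup.mk (if b then chartPoint₁ t else chartPoint₂ t))

lemma onCharts_analyticAt {f : PGL2 Fp → A} (hf : IsLocAn p f) (b : Bool) (t : Fp) :
    AnalyticAt ℚ_[p] (onCharts f b) t := by
  cases b
  · exact hf.comp_entries (chartPoint₂_entries_analyticAt t)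
  · exact hf.comp_entries (chartPoint₁_entries_analyticAt t)

/-- The transformation law applied to the decomposition of k into a Borel element and a chart point:
an element of I_B(χ) is χ(δ) times an analytic function of the coordinate on each chart. -/
lemma ind_eq_onCharts (f : Ind p (charRep χ.char)) (k : PGL2 Fp) :
    f.1 k = (χ.char (delta k) : A) * onCharts f.1 (chartIdx k) (chartCoord k) := by
  have key : ∀ (h : (M2 Fp)ˣ) (a d u), a / d = delta k → k = borel a d u * QuotientGroup.mk h →
      f.1 k = (χ.char (delta k) : A) * f.1 (QuotientGroup.mk h) := fun h a d u had hk => by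
    have h1 := f.2.2 a d u (QuotientGroup.mk h)
    rw [← hk, had] at h1
    exact h1
  by_cases hk : InChart k
  · obtain ⟨a, d, u, had, h⟩ := exists_eq_borel_mul₁ hk
    simpa [onCharts, chartIdx, hk] using key _ a d u had h
  · obtain ⟨a, d, u, had, h⟩ := exists_eq_borel_mul₂ hk
    simpa [onCharts, chartIdx, hk] using key _ a d u had h

/-- A common radius and bound for the two charts at each centre, so that a single covering of the
unit ball serves both. -/
lemma exists_series_of_analyticAt {h : Bool → Fp → A}
    (hh : ∀ b t, AnalyticAt ℚ_[p] (h b) t) :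
    ∃ (R : Fp → ℝ) (C : Fp → ℝ) (P : Bool → Fp → FormalMultilinearSeries ℚ_[p] Fp A), ∀ t,
      0 < R t ∧ ∀ b, HasFPowerSeriesOnBall (h b) (P b t) t (ENNReal.ofReal (R t)) ∧
        ∀ n, ‖P b t n‖ * R t ^ n ≤ C t := by
  have key : ∀ t, ∃ (R : ℝ) (C : ℝ), 0 < R ∧ ∀ b, HasBoundedSeries ℚ_[p] (h b) t R C := fun t => by
    obtain ⟨r₁, hr₁, h₁⟩ := HasBoundedSeries.of_analyticAt (hh true t) (lt_add_one _)
    obtain ⟨r₂, hr₂, h₂⟩ := HasBoundedSeries.of_analyticAt (hh false t) (lt_add_one _)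
    refine ⟨min r₁ r₂, max (‖h true t‖ + 1) (‖h false t‖ + 1), lt_min hr₁ hr₂, fun b => ?_⟩
    cases b
    · exact (h₂ r₂ hr₂ le_rfl).mono (lt_min hr₁ hr₂) (min_le_right _ _) (le_max_right _ _)
    · exact (h₁ r₁ hr₁ le_rfl).mono (lt_min hr₁ hr₂) (min_le_left _ _) (le_max_left _ _)
  choose R C hR hP using key
  choose P hP hC using hP
  exact ⟨R, C, fun b t => P t b, fun t => ⟨hR t, fun b => ⟨hP t b, fun n => by
    simpa using hC t b {n}⟩⟩⟩

/-- This is p ≤ 2ᵖ raised to the power e. It says that truncation in degree pe beats division by pᵉ.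
-/
lemma pow_mul_half_pow_le_one (p : ℕ) (e : ℕ) : (p : ℝ) ^ e * (1 / 2) ^ (p * e) ≤ 1 := by
  rw [pow_mul, ← mul_pow]
  refine pow_le_one₀ (by positivity) ?_
  rw [div_pow, one_pow, mul_one_div]
  refine div_le_one_of_le₀ ?_ (by positivity)
  exact_mod_cast Nat.lt_two_pow_self.le

/-- The `A`-span of the image of `I_B(χ₀)` is dense in `I_B(χ)`: a function in `I_B(χ)` can be
approximated by elements of this span with an error that lies in `pᵉ S`, for a fixed bounded
set `S`. -/
lemma exists_approx (f : Ind p (charRep χ.char)) : ∃ F : ℕ → Ind p (charRep χ.char),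
    (∀ e, F e ∈ Submodule.span Ω {x | ∃ (a : A) (f : Ind p (charRep χ₀.char)),
      x = a • indSection χ₀ χ f}) ∧
    IsLocBdd p (Subtype.val '' Set.range fun e =>
      algebraMap ℚ_[p] Ω ((p : ℚ_[p]) ^ e)⁻¹ • (f - F e)) := by
  have : ProperSpace Fp := FiniteDimensional.proper ℚ_[p] Fp
  have : IsUltrametricDist Fp := isUltra p Fp
  obtain ⟨R, C, P, hRP⟩ := exists_series_of_analyticAt (onCharts_analyticAt f.2.1)
  -- Balls of half the radius are used because `HasBoundedSeries.tail` needs the coordinate relative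
  -- to the centre to be bounded by R/2.
  obtain ⟨T, c, hc, hcT⟩ := exists_locally_constant_cover (fun t => R t / 2)
    fun t => half_pos (hRP t).1
  -- The e-th approximation keeps the terms of degree less than pe, so its tail is of size 2^(-pe) ≤
  -- p^(-e) up to a constant.
  choose F hF hFk using fun e => exists_truncation χ₀ χ hc T (fun t ht => (hcT t ht).1) P (p * e)
  refine ⟨F, hF, isLocBdd_iff.2 fun g => ?_⟩
  set b := chartIdx (QuotientGroup.mk g : PGL2 Fp) with hb
  set s := c (chartCoord (QuotientGroup.mk g : PGL2 Fp)) with hs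
  have hτg : ‖rowCoord (entries g) - s‖ < R s / 2 := by
    have h := (hcT (chartCoord (QuotientGroup.mk g : PGL2 Fp)) (norm_rowCoord_le _)).2
    rwa [← hs, chartCoord_mk] at h
  have hRs := (hRP s).1
  have hτan : AnalyticAt ℚ_[p] (fun X => rowCoord X - s) (entries g) :=
    (rowCoord_analyticAt g).sub analyticAt_const
  -- The strict inequality at the centre gives a radius on which the power series of `rowCoord` - s
  -- has norm at most R s / 2, as required for substitution.
  obtain ⟨r₁, hr₁, h₁⟩ := HasBoundedSeries.of_analyticAt hτan hτg
  obtain ⟨r₂, hr₂, h₂⟩ := HasBoundedSeries.of_analyticAt (isLocAn_comp_delta χ.isLocAn g)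
    (lt_add_one _)
  -- On this ball the chart and the centre are constant, all matrices are invertible, and the
  -- coordinate stays in the disc on which the expansion around s converges.
  obtain ⟨r₃, hr₃, h₃⟩ := Metric.eventually_nhds_iff_ball.1
    ((eventually_chart_const p hc g).and ((isOpen_unitSet.eventually_mem (isUnit_of_entries g)).and
      (hτan.continuousAt.norm.eventually (gt_mem_nhds (hτg.trans (half_lt_self hRs))))))
  set r := min r₁ (min r₂ r₃) with hr
  have hr0 : 0 < r := lt_min hr₁ (lt_min hr₂ hr₃)
  set C₂ := ‖onMatrices (fun k : PGL2 Fp => (χ.char (delta k) : A)) (entries g)‖ + 1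
  -- Neither the radius nor the constant depends on e; this uniformity is the content of the claim.
  refine ⟨r, hr0, ‖ContinuousLinearMap.mul ℚ_[p] A‖ * C₂ * (2 * C s), ?_⟩
  rintro _ ⟨_, ⟨e, rfl⟩, rfl⟩
  -- Near g, the error f - F e is χ(δ) times this tail of the expansion around s.
  let G : (Fin 2 → Fin 2 → Fp) → A := fun X => onCharts f.1 b (rowCoord X) -
    ∑ n ∈ Finset.range (p * e), P b s n fun _ => rowCoord X - s
  have hball : ∀ y, ‖y‖ < r → entries g + y ∈ Metric.ball (entries g) r₃ := fun y hy => by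
    rw [mem_ball_iff_norm, add_sub_cancel_left]
    exact hy.trans_le ((min_le_right _ _).trans (min_le_right _ _))
  have hG : HasBoundedSeries ℚ_[p] G (entries g) r (2 * C s * (1 / 2) ^ (p * e)) := by
    refine HasBoundedSeries.tail ((hRP s).2 b).2 (h₁ r hr0 (min_le_left _ _)) (p * e)
      fun y hy => ?_
    have h := HasBoundedSeries.hasSum ((hRP s).2 b).1 (h₃ _ (hball y hy)).2.2
    rw [add_sub_cancel] at h
    exact (hasSum_nat_add_iff' (p * e)).2 h
  have hprod := (h₂ r hr0 ((min_le_right _ _).trans (min_le_left _ _))).bilin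
    (ContinuousLinearMap.mul ℚ_[p] A) hG
  have hsc := hprod.compCLM ((((p : ℚ_[p]) ^ e)⁻¹) • ContinuousLinearMap.id ℚ_[p] A)
  refine (hsc.mono hr0 le_rfl ?_).congr fun y hy => ?_
  · have hn : ‖(((p : ℚ_[p]) ^ e)⁻¹) • ContinuousLinearMap.id ℚ_[p] A‖ ≤ (p : ℝ) ^ e := by
      refine (norm_smul_le (((p : ℚ_[p]) ^ e)⁻¹) (ContinuousLinearMap.id ℚ_[p] A)).trans ?_
      rw [norm_inv, norm_pow, Padic.norm_p, inv_pow, inv_inv]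
      exact mul_le_of_le_one_right (by positivity) ContinuousLinearMap.norm_id_le
    have h0 : 0 ≤ ‖ContinuousLinearMap.mul ℚ_[p] A‖ * C₂ * (2 * C s * (1 / 2) ^ (p * e)) :=
      hprod.nonneg
    have hC0 : 0 ≤ C s := by
      have := ((hRP s).2 b).2 0
      exact le_trans (by positivity) this
    have hC₂ : 0 ≤ C₂ := by positivity
    calc _ ≤ (p : ℝ) ^ e * (‖ContinuousLinearMap.mul ℚ_[p] A‖ * C₂ *
          (2 * C s * (1 / 2) ^ (p * e))) := by gcongr
      _ = ‖ContinuousLinearMap.mul ℚ_[p] A‖ * C₂ * (2 * C s) *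
          ((p : ℝ) ^ e * (1 / 2) ^ (p * e)) := by ring
      _ ≤ ‖ContinuousLinearMap.mul ℚ_[p] A‖ * C₂ * (2 * C s) * 1 := by
          gcongr
          exact pow_mul_half_pow_le_one p e
      _ = _ := mul_one _
  · obtain ⟨hX1, hXu, -⟩ := h₃ _ (hball y hy)
    obtain ⟨hX2, hX3⟩ := hX1 hXu.unit rfl
    have hk : rowCoord (entries g + y)
        = chartCoord (QuotientGroup.mk hXu.unit : PGL2 Fp) := (chartCoord_mk hXu.unit).symm
    rw [onMatrices_of _ _ hXu, onMatrices_of _ _ hXu]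
    change ((p : ℚ_[p]) ^ e)⁻¹ • (_ * G (entries g + y)) =
      algebraMap ℚ_[p] Ω ((p : ℚ_[p]) ^ e)⁻¹ • (f.1 _ - (F e).1 _)
    rw [algebraMap_smul, hFk, ind_eq_onCharts, ← mul_sub, hX2, hX3, ← hk]

/-- A bounded functional on `I_B(χ)` that vanishes on the multiples of the elements of the image of
`I_B(χ₀)` is zero. -/
theorem eq_zero_of_indSection (θ : Ind p (charRep χ.char) →ₗ[Ω] Ω)
    (hθ : ∀ S : Set (Ind p (charRep χ.char)), IsLocBdd p (Subtype.val '' S) →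
      ∃ C : ℝ, ∀ f ∈ S, ‖θ f‖ ≤ C)
    (h0 : ∀ (a : A) (f : Ind p (charRep χ₀.char)), θ (a • indSection χ₀ χ f) = 0)
    (f : Ind p (charRep χ.char)) : θ f = 0 := by
  obtain ⟨F, hF, hb⟩ := exists_approx χ₀ χ f
  obtain ⟨C, hC⟩ := hθ _ hb
  have hFe : ∀ e, θ (F e) = 0 := fun e => by
    have h : Submodule.span Ω {x | ∃ (a : A) (f : Ind p (charRep χ₀.char)),
        x = a • indSection χ₀ χ f} ≤ LinearMap.ker θ := by
      rw [Submodule.span_le]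
      rintro _ ⟨a, f, rfl⟩
      exact h0 a f
    exact h (hF e)
  -- As the functional kills the approximations, its value on p⁻ᵉ(f - F e) is p⁻ᵉ times its value on
  -- f. These values stay bounded while |p⁻ᵉ| = pᵉ grows without bound.
  have hle : ∀ e : ℕ, (p : ℝ) ^ e * ‖θ f‖ ≤ C := fun e => by
    have h := hC _ ⟨e, rfl⟩
    rw [map_smul, map_sub, hFe, sub_zero, norm_smul, norm_algebraMap', norm_inv, norm_pow,
      Padic.norm_p, inv_pow, inv_inv] at h
    exact h
  by_contra hne
  have hpos : 0 < ‖θ f‖ := norm_pos_iff.2 hne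
  have hp : (1 : ℝ) < p := by exact_mod_cast (Fact.out : p.Prime).one_lt
  obtain ⟨e, he⟩ := pow_unbounded_of_one_lt (C / ‖θ f‖) hp
  rw [div_lt_iff₀ hpos] at he
  exact absurd (hle e) (not_le.2 he)

end Density

/-! ### Tangent vectors and the induced representations `I_B(τ_λ)` -/

section Tangent

variable {p : ℕ} [Fact p.Prime] {Fp : Type} [NormedField Fp] [NormedAlgebra ℚ_[p] Fp]
  [FiniteDimensional ℚ_[p] Fp]
  {Ω : Type} [NormedField Ω] [NormedAlgebra ℚ_[p] Ω]
  {A : Type} [NormedCommRing A] [NormedAlgebra ℚ_[p] A] [NormedAlgebra Ω A]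
  [IsScalarTower ℚ_[p] Ω A]

/-- The `ε`-component of a tangent vector. -/
def tangentLin (v : A →A[Ω] DualNumber Ω) : A →ₗ[Ω] Ω where
  toFun a := (v a).snd
  map_add' a b := by rw [map_add]; rfl
  map_smul' c a := by rw [map_smul]; rfl

/-- The `ε`-component of a tangent vector, as a continuous `ℚ_p`-linear map. -/
def tangentCLM (p : ℕ) [Fact p.Prime] {Ω : Type} [NormedField Ω] [NormedAlgebra ℚ_[p] Ω]
    {A : Type} [NormedCommRing A] [NormedAlgebra ℚ_[p] A] [NormedAlgebra Ω A]
    [IsScalarTower ℚ_[p] Ω A] (v : A →A[Ω] DualNumber Ω) : A →L[ℚ_[p]] Ω where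
  toLinearMap := (tangentLin v).restrictScalars ℚ_[p]
  cont := TrivSqZeroExt.continuous_snd.comp v.cont

lemma tangentLin_mul {v : A →A[Ω] DualNumber Ω} {x : A →A[Ω] Ω} (hv : ∀ a, (v a).fst = x a)
    (a b : A) : tangentLin v (a * b) = x a * tangentLin v b + tangentLin v a * x b := by
  change (v (a * b)).snd = x a * (v b).snd + (v a).snd * x b
  rw [map_mul, TrivSqZeroExt.snd_mul, hv, hv, smul_eq_mul, MulOpposite.smul_eq_mul_unop,
    MulOpposite.unop_op]

variable (m : (Fp →ₐ[ℚ_[p]] Ω) → ℕ)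

lemma isLocAnUnits_oneK : IsLocAnUnits p fun y => (oneK m y : Ω) := fun y => by
  have h : AnalyticAt ℚ_[p] (fun z : Fp => ∏ σ : Fp →ₐ[ℚ_[p]] Ω, (σ z)⁻¹ ^ m σ) (y : Fp) := by
    refine Finset.analyticAt_fun_prod _ fun σ _ => AnalyticAt.pow ?_ _
    refine AnalyticAt.fun_inv ((LinearMap.toContinuousLinearMap σ.toLinearMap).analyticAt _) ?_
    exact (map_ne_zero σ).2 y.ne_zero
  refine h.congr ?_
  filter_upwards [isOpen_ne.mem_nhds y.ne_zero] with z hz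
  rw [onField_unit _ z (Units.mk0 z hz) rfl]
  simp [oneK]

/-- The locally analytic character `1_k`. -/
abbrev oneKChar : LocAnChar p Fp Ω := ⟨oneK m, isLocAnUnits_oneK m⟩

variable {m} {x : A →A[Ω] Ω} {χ : LocAnChar p Fp A} {v : A →A[Ω] DualNumber Ω}

lemma derivAlong_apply (hχ : ∀ y, x (χ.char y) = oneK m y) (hv : ∀ a, (v a).fst = x a) (y : Fpˣ) :
    derivAlong v χ.char (Additive.ofMul y)
      = ((oneK m y)⁻¹ : Ωˣ).1 * tangentLin v (χ.char y : A) := by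
  change (v (χ.char y)).fst⁻¹ * (v (χ.char y)).snd = _
  rw [hv, hχ, Units.val_inv_eq_inv_val]
  rfl

lemma derivAlong_isLocAnUnits (hχ : ∀ y, x (χ.char y) = oneK m y) (hv : ∀ a, (v a).fst = x a) :
    IsLocAnUnits p fun y => derivAlong v χ.char (Additive.ofMul y) := fun y => by
  have h := ((isLocAnUnits_oneK m).inv y).mul
    (((tangentCLM p v).analyticAt _).comp (χ.isLocAn y))
  refine h.congr ?_
  filter_upwards [isOpen_ne.mem_nhds y.ne_zero] with z hz
  rw [onField_unit _ z (Units.mk0 z hz) rfl, derivAlong_apply hχ hv, Pi.mul_apply,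
    onField_unit _ z (Units.mk0 z hz) rfl, Function.comp_apply,
    onField_unit _ z (Units.mk0 z hz) rfl]
  rfl

/-- Together with `tangentLin_charQuot`, this says that v sends χ(δ)/1_k(δ) to 1 + λ(δ)ε; here is
the constant term. -/
lemma pt_charQuot (hχ : ∀ y, x (χ.char y) = oneK m y) (k : PGL2 Fp) :
    x (charQuot (oneKChar m) χ k) = 1 := by
  rw [charQuot, map_smul, hχ, smul_eq_mul, Units.inv_mul]

lemma tangentLin_charQuot (hχ : ∀ y, x (χ.char y) = oneK m y) (hv : ∀ a, (v a).fst = x a)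
    (k : PGL2 Fp) : tangentLin v (charQuot (oneKChar m) χ k)
      = derivAlong v χ.char (Additive.ofMul (delta k)) := by
  rw [charQuot, map_smul, derivAlong_apply hχ hv]
  rfl

end Tangent

/-- A function on a representation that is bounded on bounded sets. -/
def BddOn {R Γ E : Type} [CommRing R] [Group Γ] [Norm E] (X : BornRep R Γ) (θ : X.M → E) : Prop :=
  ∀ S, X.IsBdd S → ∃ C : ℝ, ∀ f ∈ S, ‖θ f‖ ≤ C

/-- A map of representations that maps bounded sets to bounded sets. -/
def BddMap {R R' Γ : Type} [CommRing R] [CommRing R'] [Group Γ] (X : BornRep R Γ)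
    (Y : BornRep R' Γ) (f : X.M → Y.M) : Prop :=
  ∀ S, X.IsBdd S → Y.IsBdd (f '' S)

/-! ### Permanence properties of boundedness -/

section Bdd

variable {R R' Γ : Type} [CommRing R] [CommRing R'] [Group Γ] {X : BornRep R Γ} {Y : BornRep R' Γ}

lemma BddOn.comp {E : Type} [Norm E] {θ : Y.M → E} (hθ : BddOn Y θ) {f : X.M → Y.M}
    (hf : BddMap X Y f) : BddOn X fun y => θ (f y) := fun S hS => by
  obtain ⟨C, hC⟩ := hθ _ (hf S hS)
  exact ⟨C, fun y hy => hC _ ⟨y, hy, rfl⟩⟩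

lemma BddMap.comp {R'' : Type} [CommRing R''] {Z : BornRep R'' Γ} {g : Y.M → Z.M}
    (hg : BddMap Y Z g) {f : X.M → Y.M} (hf : BddMap X Y f) : BddMap X Z fun y => g (f y) :=
  fun S hS => by
    have h := hg _ (hf S hS)
    rwa [Set.image_image] at h

lemma BddOn.add {E : Type} [SeminormedAddCommGroup E] {θ η : X.M → E} (hθ : BddOn X θ)
    (hη : BddOn X η) : BddOn X fun y => θ y + η y := fun S hS => by
  obtain ⟨C, hC⟩ := hθ S hS
  obtain ⟨C', hC'⟩ := hη S hS
  exact ⟨C + C', fun y hy => (norm_add_le _ _).trans (add_le_add (hC y hy) (hC' y hy))⟩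

lemma BddOn.sub {E : Type} [SeminormedAddCommGroup E] {θ η : X.M → E} (hθ : BddOn X θ)
    (hη : BddOn X η) : BddOn X fun y => θ y - η y := fun S hS => by
  obtain ⟨C, hC⟩ := hθ S hS
  obtain ⟨C', hC'⟩ := hη S hS
  exact ⟨C + C', fun y hy => (norm_sub_le _ _).trans (add_le_add (hC y hy) (hC' y hy))⟩

lemma BddOn.clm {𝕜 E E' : Type} [NontriviallyNormedField 𝕜] [SeminormedAddCommGroup E]
    [NormedSpace 𝕜 E] [SeminormedAddCommGroup E'] [NormedSpace 𝕜 E'] {θ : X.M → E}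
    (hθ : BddOn X θ) (T : E →L[𝕜] E') : BddOn X fun y => T (θ y) := fun S hS => by
  obtain ⟨C, hC⟩ := hθ S hS
  exact ⟨‖T‖ * C, fun y hy => (T.le_opNorm _).trans (by gcongr; exact hC y hy)⟩

end Bdd

/-! ### The splitting of I_B(τ_λ) by the logarithm λ ∘ δ -/

section InducedTau

variable {p : ℕ} [Fact p.Prime] {Fp : Type} [NormedField Fp] [NormedAlgebra ℚ_[p] Fp]
  [FiniteDimensional ℚ_[p] Fp]
  {Ω : Type} [NormedField Ω] [NormedAlgebra ℚ_[p] Ω] [CompleteSpace Ω]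
  (m : (Fp →ₐ[ℚ_[p]] Ω) → ℕ) (l : Additive Fpˣ →+ Ω)

/-- The projection `I_B(τ_λ) → I_B(1_k)`. -/
def tauProj : Ind p (tauRep m l) →ₗ[Ω] Ind p (charRep (oneK m)) where
  toFun F := ⟨fun k => (F.1 k).2, F.2.1.comp (ContinuousLinearMap.snd ℚ_[p] Ω Ω),
    fun a d u k => by
      change (F.1 (borel a d u * k)).2 = _
      rw [F.2.2, tauRep_snd]
      rfl⟩
  map_add' _ _ := rfl
  map_smul' _ _ := rfl

lemma tauProj_bddMap : BddMap (indB (p := p) (tauRep m l)) (indOne m) (tauProj m l) :=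
  fun S hS => (hS.comp (ContinuousLinearMap.snd ℚ_[p] Ω Ω)).mono (by
    rintro _ ⟨_, ⟨F, hF, rfl⟩, rfl⟩
    exact ⟨F.1, ⟨F, hF, rfl⟩, rfl⟩)

/-- The inclusion `I_B(1_k) → I_B(τ_λ)`. -/
def tauIncl : Ind p (charRep (oneK m)) →ₗ[Ω] Ind p (tauRep m l) :=
  LinearMap.fst Ω _ _ ∘ₗ (pullMod m l).subtype ∘ₗ inclPull m l

lemma delta_log_isLocAn {l : Additive Fpˣ →+ Ω} (hl : IsLocAnUnits p fun y => l (Additive.ofMul y)) :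
    IsLocAn p fun k : PGL2 Fp => l (Additive.ofMul (delta k)) := isLocAn_comp_delta hl

lemma delta_log_borel (a d : Fpˣ) (u : Fp) (k : PGL2 Fp) :
    l (Additive.ofMul (delta (borel a d u * k)))
      = l (Additive.ofMul (a / d)) + l (Additive.ofMul (delta k)) := by
  rw [delta_borel, ofMul_mul, map_add]

variable {l} (hl : IsLocAnUnits p fun y => l (Additive.ofMul y))

/-- The retraction `I_B(τ_λ) → I_B(1_k)`, `(f₁, f₂) ↦ f₁ - λ(δ) f₂`. -/
def tauRetr : Ind p (tauRep m l) →ₗ[Ω] Ind p (charRep (oneK m)) where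
  toFun F := ⟨fun k => (F.1 k).1 + -1 * (l (Additive.ofMul (delta k)) * (F.1 k).2),
    (F.2.1.comp (ContinuousLinearMap.fst ℚ_[p] Ω Ω)).add
      ((IsLocAn.bilin (ContinuousLinearMap.mul ℚ_[p] Ω) (delta_log_isLocAn hl)
        (F.2.1.comp (ContinuousLinearMap.snd ℚ_[p] Ω Ω))).smul (-1 : Ω)),
    fun a d u k => by
      change (F.1 (borel a d u * k)).1 + -1 * (l (Additive.ofMul (delta (borel a d u * k))) *
        (F.1 (borel a d u * k)).2) = (oneK m (a / d) : Ω) *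
          ((F.1 k).1 + -1 * (l (Additive.ofMul (delta k)) * (F.1 k).2))
      rw [F.2.2, tauRep_snd, tauRep_fst, delta_log_borel]
      ring⟩
  map_add' F F' := Subtype.ext (funext fun k => by
    change ((F.1 k).1 + (F'.1 k).1) + -1 * (_ * ((F.1 k).2 + (F'.1 k).2))
      = ((F.1 k).1 + _) + ((F'.1 k).1 + _)
    ring)
  map_smul' c F := Subtype.ext (funext fun k => by
    change c * (F.1 k).1 + -1 * (_ * (c * (F.1 k).2)) = c * ((F.1 k).1 + _)
    ring)

lemma tauRetr_bddMap : BddMap (indB (p := p) (tauRep m l)) (indOne m) (tauRetr m hl) :=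
  fun S hS => by
    have h₁ := hS.comp (ContinuousLinearMap.fst ℚ_[p] Ω Ω)
    have h₂ := (IsLocBdd.bilin (ContinuousLinearMap.mul ℚ_[p] Ω) (delta_log_isLocAn hl)
      (hS.comp (ContinuousLinearMap.snd ℚ_[p] Ω Ω))).comp (scal p Ω (-1 : Ω))
    refine (h₁.add h₂).mono ?_
    rintro _ ⟨_, ⟨F, hF, rfl⟩, rfl⟩
    exact ⟨_, ⟨F.1, ⟨F, hF, rfl⟩, rfl⟩, _, ⟨_, ⟨_, ⟨F.1, ⟨F, hF, rfl⟩, rfl⟩, rfl⟩, rfl⟩, rfl⟩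

lemma tauRetr_tauIncl (f : Ind p (charRep (oneK m))) : tauRetr m hl (tauIncl m l f) = f :=
  Subtype.ext (funext fun k => by
    change f.1 k + -1 * (_ * 0) = f.1 k
    ring)

lemma tauProj_tauIncl (f : Ind p (charRep (oneK m))) : tauProj m l (tauIncl m l f) = 0 := rfl

end InducedTau

/-! ### Reduction and first-order maps on I_B(χ), and factorization of functionals -/

section Reduction

variable {p : ℕ} [Fact p.Prime] {Fp : Type} [NormedField Fp] [NormedAlgebra ℚ_[p] Fp]
  [FiniteDimensional ℚ_[p] Fp]
  {Ω : Type} [NormedField Ω] [NormedAlgebra ℚ_[p] Ω] [CompleteSpace Ω]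
  {A : Type} [NormedCommRing A] [NormedAlgebra ℚ_[p] A] [NormedAlgebra Ω A]
  [IsScalarTower ℚ_[p] Ω A] [CompleteSpace A]
  {m : (Fp →ₐ[ℚ_[p]] Ω) → ℕ} {x : A →A[Ω] Ω} {χ : LocAnChar p Fp A} {v : A →A[Ω] DualNumber Ω}
  (hχ : ∀ y, x (χ.char y) = oneK m y) (hv : ∀ a, (v a).fst = x a)

variable (m χ) in
lemma indSection_bddMap : BddMap (indOne m) (indB (p := p) (charRep χ.char))
    (indSection (oneKChar m) χ) := fun _ hS => indSection_isLocBdd (oneKChar m) χ hS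

/-- The reduction `I_B(χ) → I_B(1_k)` as an `Ω`-linear map. -/
def redIndLin : Ind p (charRep χ.char) →ₗ[Ω] Ind p (charRep (oneK m)) where
  toFun := redInd m x χ.char hχ
  map_add' _ _ := Subtype.ext (funext fun _ => map_add x _ _)
  map_smul' c f := Subtype.ext (funext fun k => map_smul x c (f.1 k))

lemma redIndLin_bddMap : BddMap (indB (p := p) (charRep χ.char)) (indOne m) (redIndLin hχ) :=
  fun S hS => (hS.comp (ptLin (p := p) x)).mono (by
    rintro _ ⟨_, ⟨f, hf, rfl⟩, rfl⟩
    exact ⟨f.1, ⟨f, hf, rfl⟩, rfl⟩)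

/-- The reduction of χ(δ)/1_k(δ) is 1, so only the coefficient a is reduced. With a = 1 this is the
section property; general a is what the density argument tests. -/
lemma redIndLin_smul_indSection (a : A) (f : Ind p (charRep (oneK m))) :
    redIndLin hχ (a • indSection (oneKChar m) χ f) = x a • f := Subtype.ext (funext fun k => by
  change x (a * (f.1 k • charQuot (oneKChar m) χ k)) = x a * f.1 k
  rw [map_mul, map_smul, pt_charQuot hχ, smul_eq_mul, mul_one])

lemma redIndLin_indSection (f : Ind p (charRep (oneK m))) :
    redIndLin hχ (indSection (oneKChar m) χ f) = f := by
  have h := redIndLin_smul_indSection hχ 1 f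
  rwa [one_smul, map_one, one_smul] at h

/-- The map `I_B(χ) → I_B(τ_λ)` for `λ = ∂_v(χ)`, given by `v`. -/
def tangentInd : Ind p (charRep χ.char) →ₗ[Ω] Ind p (tauRep m (derivAlong v χ.char)) where
  toFun f := ⟨fun k => (tangentLin v (f.1 k), x (f.1 k)),
    f.2.1.comp ((tangentCLM p v).prod (ptLin (p := p) x)), fun a d u k => by
      have h : f.1 (borel a d u * k) = (χ.char (a / d) : A) * f.1 k := f.2.2 a d u k
      refine Prod.ext ?_ ?_
      · change tangentLin v (f.1 (borel a d u * k)) = _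
        rw [tauRep_fst, derivAlong_apply hχ hv, h, tangentLin_mul hv, hχ]
        have := (oneK m (a / d)).mul_inv
        linear_combination -(tangentLin v (χ.char (a / d) : A) * x (f.1 k)) * this
      · change x (f.1 (borel a d u * k)) = _
        rw [tauRep_snd, h, map_mul, hχ]⟩
  map_add' _ _ := Subtype.ext (funext fun _ => Prod.ext (map_add (tangentLin v) _ _) (map_add x _ _))
  map_smul' c f := Subtype.ext (funext fun k =>
    Prod.ext (map_smul (tangentLin v) c (f.1 k)) (map_smul x c (f.1 k)))

lemma tangentInd_bddMap : BddMap (indB (p := p) (charRep χ.char))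
    (indB (p := p) (tauRep m (derivAlong v χ.char))) (tangentInd hχ hv) :=
  fun S hS => (hS.comp ((tangentCLM p v).prod (ptLin (p := p) x))).mono (by
    rintro _ ⟨_, ⟨f, hf, rfl⟩, rfl⟩
    exact ⟨f.1, ⟨f, hf, rfl⟩, rfl⟩)

/-- Under Ω² = Ω[ε], the image of a • s(f) is v(a)(1 + λ(δ)ε)f. Its retraction subtracts λ(δ) times
the constant term, leaving the ε-component of v(a). -/
lemma tauRetr_tangentInd_smul_indSection (a : A) (f : Ind p (charRep (oneK m))) :
    tauRetr m (derivAlong_isLocAnUnits hχ hv)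
      (tangentInd hχ hv (a • indSection (oneKChar m) χ f)) = tangentLin v a • f :=
  Subtype.ext (funext fun k => by
    change tangentLin v (a * (f.1 k • charQuot (oneKChar m) χ k)) + -1 *
      (derivAlong v χ.char (Additive.ofMul (delta k)) *
        x (a * (f.1 k • charQuot (oneKChar m) χ k))) = tangentLin v a * f.1 k
    rw [tangentLin_mul hv, map_mul, map_smul, map_smul, pt_charQuot hχ, tangentLin_charQuot hχ hv,
      smul_eq_mul, smul_eq_mul]
    ring)

/-- Since `tangentInd` sends s(f) to (λ(δ)f, f), it lifts the quotient I_B(1_k) of I_B(τ_λ); the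
remainder lies in the subspace I_B(1_k). So the two equivariant maps `tangentInd` and `tauIncl`
together exhaust I_B(τ_λ). -/
lemma tangentInd_indSection_add (F : Ind p (tauRep m (derivAlong v χ.char))) :
    tangentInd hχ hv (indSection (oneKChar m) χ (tauProj m _ F)) +
      tauIncl m _ (tauRetr m (derivAlong_isLocAnUnits hχ hv) F) = F :=
  Subtype.ext (funext fun k => by
    refine Prod.ext ?_ ?_
    · change tangentLin v ((F.1 k).2 • charQuot (oneKChar m) χ k) + ((F.1 k).1 + -1 *
        (derivAlong v χ.char (Additive.ofMul (delta k)) * (F.1 k).2)) = (F.1 k).1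
      rw [map_smul, tangentLin_charQuot hχ hv, smul_eq_mul]
      ring
    · change x ((F.1 k).2 • charQuot (oneKChar m) χ k) + 0 = (F.1 k).2
      rw [map_smul, pt_charQuot hχ, smul_eq_mul, mul_one, add_zero])

/-- A bounded `x`-semilinear functional on `I_B(χ)` factors through `I_B(1_k)`. -/
lemma factor_redIndLin (θ : Ind p (charRep χ.char) →ₗ[Ω] Ω) (hs : ∀ (a : A) f, θ (a • f) = x a * θ f)
    (hθ : BddOn (indB (p := p) (charRep χ.char)) θ) (f : Ind p (charRep χ.char)) :
    θ (indSection (oneKChar m) χ (redIndLin hχ f)) = θ f := by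
  refine (sub_eq_zero.1 ?_).symm
  -- The difference of the two sides is bounded, so by density it need only vanish on a • s(f),
  -- where both sides equal x(a)θ(s(f)).
  refine eq_zero_of_indSection (oneKChar m) χ
    (θ - θ ∘ₗ indSection (oneKChar m) χ ∘ₗ redIndLin hχ) ?_ (fun a f => ?_) f
  · exact hθ.sub (hθ.comp ((indSection_bddMap m χ).comp (redIndLin_bddMap hχ)))
  · rw [LinearMap.sub_apply, LinearMap.comp_apply, LinearMap.comp_apply,
      redIndLin_smul_indSection hχ, hs, map_smul, map_smul, smul_eq_mul, sub_self]

/-- The first-order part of a bounded linear functional on `I_B(χ)` factors through `I_B(τ_λ)`. -/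
lemma factor_tangentInd (φ : Ind p (charRep χ.char) →ₗ[A] A)
    (hφ : BddOn (indB (p := p) (charRep χ.char)) φ) (f : Ind p (charRep χ.char)) :
    tangentLin v (φ (indSection (oneKChar m) χ (redIndLin hχ f))) +
      x (φ (indSection (oneKChar m) χ (tauRetr m (derivAlong_isLocAnUnits hχ hv)
        (tangentInd hχ hv f)))) = tangentLin v (φ f) := by
  refine (sub_eq_zero.1 ?_).symm
  let s := indSection (oneKChar m) χ
  let t : A →ₗ[Ω] Ω := tangentLin v
  -- By density it suffices to test on a • s(f). There the identity is the product rule for the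
  -- ε-component of v(aφ(s(f))): the first summand contributes x(a) times the ε-component of
  -- v(φ(s(f))), the second the ε-component of v(a) times x(φ(s(f))).
  refine eq_zero_of_indSection (oneKChar m) χ
    (t ∘ₗ φ.restrictScalars Ω - (t ∘ₗ φ.restrictScalars Ω ∘ₗ s ∘ₗ redIndLin hχ +
      (x : A →ₐ[Ω] Ω).toLinearMap ∘ₗ φ.restrictScalars Ω ∘ₗ s ∘ₗ
        tauRetr m (derivAlong_isLocAnUnits hχ hv) ∘ₗ tangentInd hχ hv)) ?_ (fun a f => ?_) f
  · have h₁ := hφ.clm (tangentCLM p v)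
    have h₂ := hφ.clm (ptLin (p := p) x)
    exact h₁.sub ((h₁.comp ((indSection_bddMap m χ).comp (redIndLin_bddMap hχ))).add
      (h₂.comp ((indSection_bddMap m χ).comp ((tauRetr_bddMap m
        (derivAlong_isLocAnUnits hχ hv)).comp (tangentInd_bddMap hχ hv)))))
  · change tangentLin v (φ (a • s f)) - (tangentLin v (φ (s (redIndLin hχ (a • s f)))) +
      x (φ (s (tauRetr m (derivAlong_isLocAnUnits hχ hv) (tangentInd hχ hv (a • s f)))))) = 0
    have e₁ : redIndLin hχ (a • s f) = x a • f := redIndLin_smul_indSection hχ a f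
    have e₂ : tauRetr m (derivAlong_isLocAnUnits hχ hv) (tangentInd hχ hv (a • s f))
      = tangentLin v a • f := tauRetr_tangentInd_smul_indSection hχ hv a f
    have e₃ : ∀ c : Ω, φ (s (c • f)) = c • φ (s f) := fun c =>
      map_smul (φ.restrictScalars Ω ∘ₗ s) c f
    have e₄ : φ (a • s f) = a * φ (s f) := map_smul φ a (s f)
    rw [e₁, e₂, e₃, e₃, e₄, tangentLin_mul hv, map_smul, map_smul, smul_eq_mul, smul_eq_mul, sub_self]

end Reduction

/-! ### First-order deformations of functionals -/

section Duals

variable {p : ℕ} [Fact p.Prime] {Fp : Type} [NormedField Fp] [NormedAlgebra ℚ_[p] Fp]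
  [FiniteDimensional ℚ_[p] Fp]
  {Ω : Type} [NormedField Ω] [NormedAlgebra ℚ_[p] Ω] [CompleteSpace Ω]
  {A : Type} [NormedCommRing A] [NormedAlgebra ℚ_[p] A] [NormedAlgebra Ω A]
  [IsScalarTower ℚ_[p] Ω A] [CompleteSpace A]
  {m : (Fp →ₐ[ℚ_[p]] Ω) → ℕ} {x : A →A[Ω] Ω} {χ : LocAnChar p Fp A} {v : A →A[Ω] DualNumber Ω}
  {V : Type} [AddCommMonoid V] [Module Ω V] {Γ' : Type} [Group Γ']
  (hχ : ∀ y, x (χ.char y) = oneK m y) (hv : ∀ a, (v a).fst = x a)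

/-- The values at a vector of a homomorphism that is semilinear along a point of `A`, as an
`Ω`-linear functional. -/
def evalPt (θ : CHom (Ω := Ω) (ptHom x) (indB (p := p) (charRep χ.char)) V) (w : V) :
    Ind p (charRep χ.char) →ₗ[Ω] Ω where
  toFun f := θ.1 f w
  map_add' f h := LinearMap.congr_fun (map_add θ.1 f h) w
  map_smul' c f := by
    have h : θ.1 (c • f : Ind p (charRep χ.char)) = x (algebraMap Ω A c) • θ.1 f := by
      rw [← algebraMap_smul A c f]
      exact LinearMap.map_smulₛₗ θ.1 (algebraMap Ω A c) f
    rw [h, AlgHomClass.commutes]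
    rfl

lemma evalPt_bddOn (θ : CHom (Ω := Ω) (ptHom x) (indB (p := p) (charRep χ.char)) V) (w : V) :
    BddOn (indB (p := p) (charRep χ.char)) (evalPt θ w) := fun S hS => θ.2 S hS w

/-- The values at a vector of an `A`-linear homomorphism. -/
def evalAt (φ : CHom (Ω := Ω) (RingHom.id A) (indB (p := p) (charRep χ.char)) V) (w : V) :
    Ind p (charRep χ.char) →ₗ[A] A where
  toFun f := φ.1 f w
  map_add' f h := LinearMap.congr_fun (map_add φ.1 f h) w
  map_smul' c f := LinearMap.congr_fun (map_smul φ.1 c f) w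

lemma evalAt_bddOn (φ : CHom (Ω := Ω) (RingHom.id A) (indB (p := p) (charRep χ.char)) V) (w : V) :
    BddOn (indB (p := p) (charRep χ.char)) (evalAt φ w) := fun S hS => φ.2 S hS w

/-- Restriction along the section `I_B(1_k) → I_B(χ)`. -/
def unpull (m : (Fp →ₐ[ℚ_[p]] Ω) → ℕ) (x : A →A[Ω] Ω) (χ : LocAnChar p Fp A) :
    CHom (Ω := Ω) (ptHom x) (indB (p := p) (charRep χ.char)) V →ₗ[Ω]
      CHom (Ω := Ω) (RingHom.id Ω) (indOne m) V where
  toFun θ := ⟨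
    { toFun := fun f => θ.1 (indSection (oneKChar m) χ f)
      map_add' := fun f h => by
        refine Eq.trans ?_ (map_add θ.1 _ _)
        exact congrArg θ.1 (map_add (indSection (oneKChar m) χ) f h)
      map_smul' := fun c f => LinearMap.ext fun w =>
        map_smul (evalPt θ w ∘ₗ indSection (oneKChar m) χ) c f },
    fun S hS w => (evalPt_bddOn θ w).comp (indSection_bddMap m χ) S hS⟩
  map_add' _ _ := rfl
  map_smul' _ _ := rfl

/-- This direction is formal, because the section is followed by its own retraction. It recovers the
class on I_B(1_k) from its pullback to I_B(χ). -/
lemma unpull_redPull (ψ : CHom (Ω := Ω) (RingHom.id Ω) (indOne m) V) :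
    unpull m x χ (redPull m x χ.char hχ ψ) = ψ := by
  refine Subtype.ext (LinearMap.ext fun f => ?_)
  change ψ.1 (redInd m x χ.char hχ (indSection (oneKChar m) χ f)) = ψ.1 f
  refine congrArg ψ.1 ?_
  exact redIndLin_indSection hχ f

/-- This direction rests on density: it is the identification Hom_A(I_B(χ), V^∨) = Hom_Ω(I_B(1_k),
V^∨), in which continuity of θ is essential. -/
lemma redPull_unpull (θ : CHom (Ω := Ω) (ptHom x) (indB (p := p) (charRep χ.char)) V) :
    redPull m x χ.char hχ (unpull m x χ θ) = θ :=
  Subtype.ext (LinearMap.ext fun f => LinearMap.ext fun w =>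
    factor_redIndLin hχ (evalPt θ w)
      (fun a f => LinearMap.congr_fun (LinearMap.map_smulₛₗ θ.1 a f) w) (evalPt_bddOn θ w) f)

/-- The section itself is not assumed to commute with PGL₂(F_𝔭). Equivariance follows because
`unpull` is a two-sided inverse of the equivariant map `redPull`. -/
lemma unpull_equivariant (hχ : ∀ y, x (χ.char y) = oneK m y) (j : Γ' →* PGL2 Fp) (τ : Representation Ω Γ' V) (γ : Γ')
    (θ : CHom (Ω := Ω) (ptHom x) (indB (p := p) (charRep χ.char)) V) :
    unpull m x χ (CHomRep (ptHom x) (indB (p := p) (charRep χ.char)) j τ γ θ)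
      = CHomRep (RingHom.id Ω) (indOne m) j τ γ (unpull m x χ θ) := by
  conv_lhs => rw [← redPull_unpull hχ θ]
  exact unpull_redPull hχ (CHomRep (RingHom.id Ω) (indOne m) j τ γ (unpull m x χ θ))

/-- The first-order part `Hom_A(I_B(χ), V^∨ ⊗ A) → Hom_Ω(I_B(τ_λ), V^∨)` along `v`, for
`λ = ∂_v(χ)`. -/
def firstOrder : CHom (Ω := Ω) (RingHom.id A) (indB (p := p) (charRep χ.char)) V →ₗ[Ω]
    CHom (Ω := Ω) (RingHom.id Ω) (indB (p := p) (tauRep m (derivAlong v χ.char))) V where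
  toFun φ := ⟨
    -- The formula is forced by F = `tangentInd` (s(f₂)) + `tauIncl` (f₁ - λ(δ)f₂) for F = (f₁, f₂):
    -- the functional must be the ε-component of v ∘ φ on the first summand and x ∘ φ ∘ s on the
    -- second.
    { toFun := fun F => tangentLin v ∘ₗ φ.1 (indSection (oneKChar m) χ (tauProj m _ F)) +
        (x : A →ₐ[Ω] Ω).toLinearMap ∘ₗ φ.1 (indSection (oneKChar m) χ
          (tauRetr m (derivAlong_isLocAnUnits hχ hv) F))
      map_add' := fun F F' => LinearMap.ext fun w => map_add
        (tangentLin v ∘ₗ (evalAt φ w).restrictScalars Ω ∘ₗ indSection (oneKChar m) χ ∘ₗ tauProj m _ +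
          (x : A →ₐ[Ω] Ω).toLinearMap ∘ₗ (evalAt φ w).restrictScalars Ω ∘ₗ
            indSection (oneKChar m) χ ∘ₗ tauRetr m (derivAlong_isLocAnUnits hχ hv)) F F'
      map_smul' := fun c F => LinearMap.ext fun w => map_smul
        (tangentLin v ∘ₗ (evalAt φ w).restrictScalars Ω ∘ₗ indSection (oneKChar m) χ ∘ₗ tauProj m _ +
          (x : A →ₐ[Ω] Ω).toLinearMap ∘ₗ (evalAt φ w).restrictScalars Ω ∘ₗ
            indSection (oneKChar m) χ ∘ₗ tauRetr m (derivAlong_isLocAnUnits hχ hv)) c F },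
    fun S hS w => (((evalAt_bddOn φ w).clm (tangentCLM p v)).comp
      ((indSection_bddMap m χ).comp (tauProj_bddMap m _))).add
      (((evalAt_bddOn φ w).clm (ptLin (p := p) x)).comp
        ((indSection_bddMap m χ).comp (tauRetr_bddMap m (derivAlong_isLocAnUnits hχ hv)))) S hS⟩
  map_add' φ ψ := Subtype.ext (LinearMap.ext fun F => LinearMap.ext fun w => by
    change tangentLin v (φ.1 _ w + ψ.1 _ w) + x (φ.1 _ w + ψ.1 _ w)
      = (tangentLin v (φ.1 _ w) + x (φ.1 _ w)) + (tangentLin v (ψ.1 _ w) + x (ψ.1 _ w))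
    rw [map_add, map_add, add_add_add_comm])
  map_smul' c φ := Subtype.ext (LinearMap.ext fun F => LinearMap.ext fun w => by
    change tangentLin v (c • φ.1 _ w) + x (c • φ.1 _ w) = c • (tangentLin v (φ.1 _ w) + x (φ.1 _ w))
    rw [map_smul, map_smul, smul_add])

/-- Although `firstOrder` is defined through the section, its values on all of the image of
`tangentInd` are canonical. This is the second application of density. -/
lemma firstOrder_tangentInd (φ : CHom (Ω := Ω) (RingHom.id A) (indB (p := p) (charRep χ.char)) V)
    (f : Ind p (charRep χ.char)) (w : V) :
    (firstOrder hχ hv φ).1 (tangentInd hχ hv f) w = tangentLin v (φ.1 f w) :=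
  factor_tangentInd hχ hv (evalAt φ w) (evalAt_bddOn φ w) f

/-- The extension property: restricted to I_B(1_k), the first-order part is the reduction of φ. The
ε-component drops out because the projection kills the subspace. -/
lemma firstOrder_tauIncl (φ : CHom (Ω := Ω) (RingHom.id A) (indB (p := p) (charRep χ.char)) V)
    (f : Ind p (charRep (oneK m))) :
    (firstOrder hχ hv φ).1 (tauIncl m _ f) = (unpull m x χ (redValues p x _ φ)).1 f :=
  LinearMap.ext fun w => by
    change tangentLin v (evalAt φ w (indSection (oneKChar m) χ (tauProj m _ (tauIncl m _ f)))) +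
      x (evalAt φ w (indSection (oneKChar m) χ (tauRetr m (derivAlong_isLocAnUnits hχ hv)
        (tauIncl m _ f)))) = x (evalAt φ w (indSection (oneKChar m) χ f))
    rw [tauRetr_tauIncl, tauProj_tauIncl, map_zero, map_zero, map_zero, zero_add]

/-- Both summands of I_B(τ_λ) in `tangentInd_indSection_add` come from equivariant maps on which the
functional has a description independent of the section, so equivariance can be checked on each of
them. -/
lemma firstOrder_equivariant (j : Γ' →* PGL2 Fp) (τ : Representation Ω Γ' V) (γ : Γ')
    (φ : CHom (Ω := Ω) (RingHom.id A) (indB (p := p) (charRep χ.char)) V) :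
    firstOrder hχ hv (CHomRep (RingHom.id A) (indB (p := p) (charRep χ.char)) j τ γ φ)
      = CHomRep (RingHom.id Ω) (indB (p := p) (tauRep m (derivAlong v χ.char))) j τ γ
          (firstOrder hχ hv φ) := by
  set Φ := CHomRep (RingHom.id A) (indB (p := p) (charRep χ.char)) j τ γ φ with hΦ
  refine Subtype.ext (LinearMap.ext fun F => LinearMap.ext fun w => ?_)
  let D := indRep (p := p) (tauRep m (derivAlong v χ.char)) (j γ⁻¹)
  let f := indSection (oneKChar m) χ (tauProj m _ F)
  let h := tauRetr m (derivAlong_isLocAnUnits hχ hv) F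
  have hF : tangentInd hχ hv f + tauIncl m _ h = F := tangentInd_indSection_add hχ hv F
  have h₁ : (firstOrder hχ hv Φ).1 (tangentInd hχ hv f) w
      = (firstOrder hχ hv φ).1 (D (tangentInd hχ hv f)) (τ γ⁻¹ w) :=
    (firstOrder_tangentInd hχ hv Φ f w).trans
      (firstOrder_tangentInd hχ hv φ (indRep (charRep χ.char) (j γ⁻¹) f) (τ γ⁻¹ w)).symm
  have h₂ : (firstOrder hχ hv Φ).1 (tauIncl m _ h) w
      = (firstOrder hχ hv φ).1 (D (tauIncl m _ h)) (τ γ⁻¹ w) := by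
    -- On the subspace I_B(1_k) the functional is the reduction of φ, whose equivariance is already
    -- known.
    have e : unpull m x χ (redValues p x _ Φ) = _ :=
      unpull_equivariant hχ j τ γ (redValues p x _ φ)
    rw [firstOrder_tauIncl, e]
    exact (LinearMap.congr_fun (firstOrder_tauIncl hχ hv φ
      (indRep (charRep (oneK m)) (j γ⁻¹) h)) (τ γ⁻¹ w)).symm
  change (firstOrder hχ hv Φ).1 F w = (firstOrder hχ hv φ).1 (D F) (τ γ⁻¹ w)
  have hD : D (tangentInd hχ hv f) + D (tauIncl m _ h) = D F :=
    (map_add D _ _).symm.trans (congrArg D hF)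
  have e₁ : (firstOrder hχ hv Φ).1 F w = (firstOrder hχ hv Φ).1 (tangentInd hχ hv f) w +
      (firstOrder hχ hv Φ).1 (tauIncl m _ h) w :=
    (congrArg (fun G => (firstOrder hχ hv Φ).1 G w) hF.symm).trans
      (LinearMap.congr_fun (map_add (firstOrder hχ hv Φ).1 _ _) w)
  have e₂ : (firstOrder hχ hv φ).1 (D F) (τ γ⁻¹ w)
      = (firstOrder hχ hv φ).1 (D (tangentInd hχ hv f)) (τ γ⁻¹ w) +
        (firstOrder hχ hv φ).1 (D (tauIncl m _ h)) (τ γ⁻¹ w) :=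
    (congrArg (fun G => (firstOrder hχ hv φ).1 G (τ γ⁻¹ w)) hD.symm).trans
      (LinearMap.congr_fun (map_add (firstOrder hχ hv φ).1 _ _) (τ γ⁻¹ w))
  rw [e₁, e₂, h₁, h₂]

end Duals

/-! ### Maps in cohomology -/

section Cohomology

variable {k Γ : Type} [CommRing k] [Group Γ] (N : Subgroup Γ)

lemma cohMap_comp {M M' M'' : Rep k Γ} (f : M ⟶ M') (g : M' ⟶ M'') (n : ℕ) (c : coh N M n) :
    cohMap N (f ≫ g) n c = cohMap N g n (cohMap N f n c) := by
  have h := groupCohomology.map_id_comp ((Rep.resFunctor N.subtype).map f)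
    ((Rep.resFunctor N.subtype).map g) n
  rw [← Functor.map_comp] at h
  exact LinearMap.congr_fun (congrArg ModuleCat.Hom.hom h) c

lemma cohMap_id (M : Rep k Γ) (n : ℕ) (c : coh N M n) : cohMap N (𝟙 M) n c = c := by
  have h : groupCohomology.map (A := Rep.res N.subtype M) (B := Rep.res N.subtype M)
      (MonoidHom.id N) ((Rep.resFunctor N.subtype).map (𝟙 M)) n = 𝟙 _ := by
    rw [CategoryTheory.Functor.map_id]
    exact (groupCohomology.functor k N n).map_id _
  exact LinearMap.congr_fun (congrArg ModuleCat.Hom.hom h) c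

variable [N.Normal]

lemma conjAct_cohMap {M M' : Rep k Γ} (f : M ⟶ M') (n : ℕ) (γ : Γ) (c : coh N M n) :
    conjAct N M' n γ (cohMap N f n c) = cohMap N f n (conjAct N M n γ c) := by
  refine LinearMap.congr_fun (congrArg ModuleCat.Hom.hom (?_ :
    groupCohomology.map _ _ n ≫ groupCohomology.map _ _ n
      = groupCohomology.map _ _ n ≫ groupCohomology.map _ _ n)) c
  rw [← groupCohomology.map_comp, ← groupCohomology.map_comp]
  refine groupCohomology.map_congr rfl (LinearMap.ext fun y => ?_) n
  exact (Rep.hom_comm_apply f γ y).symm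

/-- Needed to apply surjectivity of the reduction, a statement about sign parts, to the restriction
of a class from St^an to I_B(1_k). -/
lemma cohMap_mem_signPart (e : Γ →* ℤˣ) {M M' : Rep k Γ} (f : M ⟶ M') {n : ℕ} {c : coh N M n}
    (hc : c ∈ signPart N e M n) : cohMap N f n c ∈ signPart N e M' n := by
  rw [signPart, Submodule.mem_iInf] at hc ⊢
  intro γ
  have h := hc γ
  rw [LinearMap.mem_ker, LinearMap.sub_apply, LinearMap.smul_apply, LinearMap.id_apply,
    sub_eq_zero] at h ⊢
  rw [conjAct_cohMap, h, map_zsmul]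

variable {T : Type} [CommRing T] (e : Γ →* ℤˣ) (I : Ideal T)

lemma locMap_mk {M M' : Rep T Γ} {n n' : ℕ} (f : coh N M n →ₗ[T] coh N M' n')
    (c : signPart N e M n) (s : locSet I) :
    locMap N e I f (LocalizedModule.mk c s) = LocalizedModule.mk (f c.1) s := by
  exact IsLocalizedModule.map_LocalizedModules _ _ _ _

/-- A map `bE` that factors as `bP ∘ res` is zero after localization if every class in the image of
`res` lifts along `red`, up to the identification `pull` with inverse `un`, and `bP` vanishes on the
classes that lift. -/
lemma locMap_eq_zero {M₀ M₁ M₂ M₃ M₄ : Rep T Γ} {n n' : ℕ} (res : M₀ ⟶ M₁)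
    (red : coh N M₃ n →ₗ[T] coh N M₂ n) (pull : coh N M₁ n →ₗ[T] coh N M₂ n)
    (un : coh N M₂ n →ₗ[T] coh N M₁ n) (bE : coh N M₀ n →ₗ[T] coh N M₄ n')
    (bP : coh N M₁ n →ₗ[T] coh N M₄ n') (hun : ∀ c, un (pull c) = c)
    (hres : ∀ c, bP (cohMap N res n c) = bE c) (hbP : ∀ z, bP (un (red z)) = 0)
    (hred : ∀ y, ∃ z, locMap N e I red z = locMap N e I pull y) : locMap N e I bE = 0 := by
  refine LinearMap.ext fun c => ?_
  induction c using LocalizedModule.induction_on with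
  | h c s =>
    obtain ⟨z, hz⟩ := hred (LocalizedModule.mk ⟨_, cohMap_mem_signPart N e res c.2⟩ 1)
    induction z using LocalizedModule.induction_on with
    | h z t =>
      rw [locMap_mk, locMap_mk, LocalizedModule.mk_eq] at hz
      -- Equality in the localization means u · `red` z = ut · `pull` (`res` c) for some u in the
      -- multiplicative set. Applying `bP` ∘ `un` makes the left side vanish and the right side ut ·
      -- `bE` c, so ut is the denominator that kills `bE` c.
      obtain ⟨u, hu⟩ := hz
      have h := congrArg (fun y => bP (un y)) hu
      simp only [Submonoid.smul_def, map_smul, hun, hbP, hres, smul_zero] at h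
      rw [locMap_mk, LinearMap.zero_apply, ← LocalizedModule.zero_mk 1, LocalizedModule.mk_eq]
      refine ⟨u * t, ?_⟩
      rw [smul_zero, smul_zero, one_smul, Submonoid.smul_def, Submonoid.coe_mul, mul_smul]
      exact h.symm

end Cohomology

/-! ### Functoriality of the boundary map -/

section Boundary

variable {R Γ : Type} [CommRing R] [Group Γ] {Ω : Type} [Field Ω] {R' Γ' : Type}
  [NormedCommRing R'] [Algebra Ω R'] [Group Γ'] {V : Type} [AddCommMonoid V] [Module Ω V]
  {G : Type} [Group G] {X Y Z X' Y' : BornRep R Γ}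

/-- Naturality of the boundary map in the first two terms of a short exact sequence. -/
lemma StrictSES.boundary_naturality (E : StrictSES X Y Z) (E' : StrictSES X' Y' Z)
    (a : BornHom X' X) (b : BornHom Y' Y) (hi : ∀ y, b.lin (E'.i.lin y) = E.i.lin (a.lin y))
    (hq : ∀ y, E.q.lin (b.lin y) = E'.q.lin y) (K H : Subgroup G) (j : Γ' →* G) (s : R →+* R')
    (jp : Γ' →* Γ) (τ : Representation Ω Γ' V) (N : Subgroup Γ') (n : ℕ)
    (c : coh N (dualCoeff K H j s X jp τ) n) :
    E'.boundary K H j s jp τ N n (cohMap N (dualCoeffMap K H j s a jp τ) n c)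
      = E.boundary K H j s jp τ N n c := by
  -- Dualizing reverses the sequences, so the common quotient Z becomes the common first term, on
  -- which the morphism is the identity.
  let F : E.dual K H j s jp τ ⟶ E'.dual K H j s jp τ :=
    { τ₁ := 𝟙 _
      τ₂ := dualCoeffMap K H j s b jp τ
      τ₃ := dualCoeffMap K H j s a jp τ
      comm₁₂ := by
        ext f
        refine dualCoeff.ext fun x y => ?_
        exact (congrArg (dualCoeff.lin f x).1 (hq y)).symm
      comm₂₃ := by
        ext f
        refine dualCoeff.ext fun x y => ?_
        exact congrArg (dualCoeff.lin f x).1 (hi y) }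
  have h := groupCohomology.δ_naturality
    ((Rep.shortExact_res N.subtype).2 (E.dual_shortExact K H j s jp τ))
    ((Rep.shortExact_res N.subtype).2 (E'.dual_shortExact K H j s jp τ))
    ((Rep.resFunctor N.subtype).mapShortComplex.map F) n (n + 1) rfl
  have h' := LinearMap.congr_fun (congrArg ModuleCat.Hom.hom h) c
  exact h'.symm.trans (cohMap_id N _ _ _)

/-- The boundary map vanishes on the classes that extend. -/
lemma StrictSES.boundary_cohMap (E : StrictSES X Y Z) (K H : Subgroup G) (j : Γ' →* G)
    (s : R →+* R') (jp : Γ' →* Γ) (τ : Representation Ω Γ' V) (N : Subgroup Γ') (n : ℕ)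
    (c : coh N (dualCoeff K H j s Y jp τ) n) :
    E.boundary K H j s jp τ N n (cohMap N (dualCoeffMap K H j s E.i jp τ) n c) = 0 :=
  LinearMap.congr_fun (congrArg ModuleCat.Hom.hom
    ((groupCohomology.map_cochainsFunctor_shortExact
      ((Rep.shortExact_res N.subtype).2 (E.dual_shortExact K H j s jp τ))).comp_δ n (n + 1) rfl)) c

end Boundary

/-! ### The pullback sequence and its map to the extension E_λ -/

section Pullback

variable {p : ℕ} [Fact p.Prime] {Fp : Type} [NormedField Fp] [NormedAlgebra ℚ_[p] Fp]
  [FiniteDimensional ℚ_[p] Fp] {Ω : Type} [NormedField Ω] [NormedAlgebra ℚ_[p] Ω]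
  (m : (Fp →ₐ[ℚ_[p]] Ω) → ℕ) (l : Additive Fpˣ →+ Ω)

/-- `I_B(1_k) → P`, where `P` is the pullback of `I_B(τ_λ)` along `V_𝔭 → I_B(1_k)`. -/
def pullIncl : BornHom (indOne m) (pullB m l) where
  lin := inclPull m l
  bdd T hT := by
    refine ⟨(IsLocBdd.comp (ContinuousLinearMap.inl ℚ_[p] Ω Ω) hT).mono ?_, 0, fun i => i.elim0, 0, ?_⟩
    · rintro _ ⟨_, ⟨_, ⟨f, hf, rfl⟩, rfl⟩, rfl⟩
      exact ⟨f.1, ⟨f, hf, rfl⟩, rfl⟩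
    · rintro _ ⟨_, ⟨f, hf, rfl⟩, rfl⟩
      exact ⟨fun i => i.elim0, fun i => i.elim0, rfl⟩
  equivariant y _ := Subtype.ext (Prod.ext rfl (map_zero (VpRep m y)).symm)

/-- `P → V_𝔭`. -/
def pullProj : BornHom (pullB m l) (VpB m) where
  lin := LinearMap.snd Ω _ _ ∘ₗ (pullMod m l).subtype
  bdd _ hS := hS.2
  equivariant _ _ := rfl

/-- `P → I_B(τ_λ)`. -/
def pullFst : BornHom (pullB m l) (indB (p := p) (tauRep m l)) where
  lin := LinearMap.fst Ω _ _ ∘ₗ (pullMod m l).subtype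
  bdd _ hS := hS.1
  equivariant _ _ := rfl

/-- The short exact sequence `0 → I_B(1_k) → P → V_𝔭 → 0`. -/
def pullSES (hl : IsLocAnUnits p fun y => l (Additive.ofMul y)) :
    StrictSES (indOne m) (pullB m l) (VpB m) where
  i := pullIncl m l
  q := pullProj m l
  comp_eq_zero _ := rfl
  exists_split := by
    obtain ⟨t, r, ht, hr, hsum, htb, hrb⟩ := ext_split_aux m l hl
    exact ⟨⟨t, htb⟩, ⟨r, hrb⟩, ht, hr, hsum⟩

/-- The projection to a quotient. -/
def BornRep.toQuot {R Γ : Type} [CommRing R] [Group Γ] (X : BornRep R Γ) (N : Submodule R X.M)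
    (hN : ∀ γ, N ≤ N.comap (X.ρ γ)) : BornHom X (X.quot N hN) where
  lin := N.mkQ
  bdd S hS := ⟨S, hS, subset_rfl⟩
  equivariant _ _ := rfl

/-- `I_B(1_k) → St^an`. -/
def toSteinberg : BornHom (indOne m) (steinberg m) := BornRep.toQuot _ _ _

/-- `P → E_λ`. -/
def toExt : BornHom (pullB m l) (extB m l) := BornRep.toQuot _ _ _

end Pullback

/-! ### The boundary map for `λ = ∂_v(χ)` -/

namespace Datum

variable {F : Type} [Field F] [NumberField F] {D : Type} [Ring D] [Algebra F D] {p : ℕ}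
  [Fact p.Prime] {Fp : Type} [NormedField Fp] [NormedAlgebra ℚ_[p] Fp] [Algebra F Fp]
  [FiniteDimensional ℚ_[p] Fp]
  {Ω : Type} [NormedField Ω] [NormedAlgebra ℚ_[p] Ω] [CompleteSpace Ω] (d : Datum F D p Fp Ω)
  {A : Type} [NormedCommRing A] [NormedAlgebra ℚ_[p] A] [NormedAlgebra Ω A]
  [IsScalarTower ℚ_[p] Ω A] [CompleteSpace A]
  {x : A →A[Ω] Ω} {χ : LocAnChar p Fp A} {v : A →A[Ω] DualNumber Ω}
  (hχ : ∀ y, x (χ.char y) = oneK d.mp y) (hv : ∀ a, (v a).fst = x a)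

/-- Homomorphisms of coefficients induced by equivariant maps of duals. -/
abbrev cfMap {R₁ R₁' R₂ R₂' : Type} [CommRing R₁] [NormedCommRing R₁'] [Algebra Ω R₁'] [CommRing R₂]
    [NormedCommRing R₂'] [Algebra Ω R₂'] {s₁ : R₁ →+* R₁'} {s₂ : R₂ →+* R₂'}
    {X₁ : BornRep R₁ (PGL2 Fp)} {X₂ : BornRep R₂ (PGL2 Fp)}
    (φ : CHom (Ω := Ω) s₁ X₁ d.Vaway →ₗ[Ω] CHom (Ω := Ω) s₂ X₂ d.Vaway)
    (hφ : ∀ γ y, φ (CHomRep s₁ X₁ d.toGp d.VawayRep γ y)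
      = CHomRep s₂ X₂ d.toGp d.VawayRep γ (φ y)) : d.cf s₁ X₁ ⟶ d.cf s₂ X₂ :=
  coeffMap Ω d.K (awayFrom F D d.𝔭 d.S) (GF.toGA F D d.𝔭) φ hφ

/-- Homomorphisms of coefficients induced by homomorphisms of representations. -/
abbrev cfPre {X Y : BornRep Ω (PGL2 Fp)} (f : BornHom X Y) :
    d.cf (RingHom.id Ω) Y ⟶ d.cf (RingHom.id Ω) X :=
  dualCoeffMap d.K (awayFrom F D d.𝔭 d.S) (GF.toGA F D d.𝔭) (RingHom.id Ω) f d.toGp d.VawayRep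

/-- The coefficient-level form of `unpull_redPull`; it makes the pullback to I_B(χ) split injective
on cohomology. -/
lemma cfMap_redPull_unpull :
    d.cfMap (redPull d.mp x χ.char hχ) (fun _ _ => rfl) ≫
      d.cfMap (unpull d.mp x χ) (unpull_equivariant hχ d.toGp d.VawayRep) = 𝟙 _ := by
  ext f
  refine dualCoeff.ext fun y w => ?_
  exact LinearMap.congr_fun (congrArg Subtype.val (unpull_redPull hχ (dualCoeff.lin f y))) w

/-- On coefficients, the reduction of a functional on I_B(χ) is the restriction to I_B(1_k) of a
functional on P, namely of its first-order part. Therefore reductions of cohomology classes extend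
to P. -/
lemma cfMap_redValues_unpull :
    d.cfMap (redValues p x _) (fun _ _ => rfl) ≫
      d.cfMap (unpull d.mp x χ) (unpull_equivariant hχ d.toGp d.VawayRep)
      = (d.cfMap (firstOrder hχ hv) (firstOrder_equivariant hχ hv d.toGp d.VawayRep) ≫
          d.cfPre (pullFst d.mp (derivAlong v χ.char))) ≫
        d.cfPre (pullIncl d.mp (derivAlong v χ.char)) := by
  ext f
  refine dualCoeff.ext fun y w => ?_
  exact (firstOrder_tauIncl hχ hv (dualCoeff.lin f y) w).symm

variable (ε : Pi0 F D →* ℤˣ) {W : Type} [AddCommGroup W] [Module Ω W]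
  (π : Representation Ω d.Gad W)

/-- The boundary map of a short exact sequence, on the cohomology of `G(F)⁺`. -/
abbrev cfBoundary {X Y Z : BornRep Ω (PGL2 Fp)} (E : StrictSES X Y Z) (n : ℕ) :
    coh (GFplus F D) (d.cf (RingHom.id Ω) X) n →ₗ[d.TS]
      coh (GFplus F D) (d.cf (RingHom.id Ω) Z) (n + 1) :=
  E.boundary d.K (awayFrom F D d.𝔭 d.S) (GF.toGA F D d.𝔭) (RingHom.id Ω) d.toGp d.VawayRep
    (GFplus F D) n

/-- The three inputs of `locMap_eq_zero` are that a class on I_B(1_k) is recovered from its pullback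
to I_B(χ), that c_λ factors through the boundary map of the pullback sequence, and that this
boundary map kills reductions because they extend to P. -/
lemma cLambda_derivAlong_eq_zero (hred : d.RedSurjective ε π x χ.char hχ) :
    d.cLambda ε π (derivAlong v χ.char) (derivAlong_isLocAnUnits hχ hv) = 0 := by
  set l := derivAlong v χ.char with hl'
  have hl : IsLocAnUnits p fun y => l (Additive.ofMul y) := derivAlong_isLocAnUnits hχ hv
  refine locMap_eq_zero (GFplus F D) (ε.comp (sgn F D)) (d.mS π) (d.cfPre (toSteinberg d.mp))
    (cohMap _ (d.cfMap (redValues p x (indB (p := p) (charRep χ.char))) fun _ _ => rfl) _)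
    (cohMap _ (d.cfMap (redPull d.mp x χ.char hχ) fun _ _ => rfl) _)
    (cohMap _ (d.cfMap (unpull d.mp x χ) (unpull_equivariant hχ d.toGp d.VawayRep)) _)
    (d.cfBoundary (extSES d.mp l hl) _) (d.cfBoundary (pullSES d.mp l hl) _)
    (fun c => ?_) (fun c => ?_) (fun z => ?_) hred
  · rw [← cohMap_comp, cfMap_redPull_unpull, cohMap_id]
  · exact StrictSES.boundary_naturality (extSES d.mp l hl) (pullSES d.mp l hl) (toSteinberg d.mp)
      (toExt d.mp l) (fun _ => rfl) (fun _ => rfl) _ _ _ _ _ _ _ _ c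
  · rw [← cohMap_comp, cfMap_redValues_unpull d hχ hv, cohMap_comp]
    exact StrictSES.boundary_cohMap (pullSES d.mp l hl) _ _ _ _ _ _ _ _ _

end Datum

end AutL

end

theorem mainTheorem10
    -- a number field `F` and a quaternion algebra `D` over `F`
    {F : Type} [Field F] [NumberField F]
    {D : Type} [Ring D] [Algebra F D] [Algebra.IsCentral F D] [IsSimpleRing D]
    (hD : Module.finrank F D = 4)
    -- the completion of `F` at `𝔭` and the coefficient field
    {p : ℕ} [Fact p.Prime]
    {Fp : Type} [NormedField Fp] [NormedAlgebra ℚ_[p] Fp] [FiniteDimensional ℚ_[p] Fp]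
    [Algebra F Fp]
    {Ω : Type} [NormedField Ω] [NormedAlgebra ℚ_[p] Ω] [FiniteDimensional ℚ_[p] Ω]
    -- the prime `𝔭`, the splittings of `D`, the weight, the level `K` and the set `S`
    (d : AutL.Datum F D p Fp Ω)
    -- the finite part of the representation away from `𝔭`
    {W : Type} [AddCommGroup W] [Module Ω W] (π : Representation Ω d.Gad W)
    (hirr : π.IsIrreducible) (hsm : ∀ w : W, IsOpen {g : d.Gad | π g w = w})
    (hfix : ∃ w : W, w ≠ 0 ∧ ∀ g ∈ d.K, π g w = w)
    -- the sign character
    (ε : AutL.Pi0 F D →* ℤˣ)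
    -- the affinoid algebra `A = 𝓞(U)` with the point `x` given by the weight
    {A : Type} [NormedCommRing A] [NormedAlgebra ℚ_[p] A] [NormedAlgebra Ω A]
    [IsScalarTower ℚ_[p] Ω A] [CompleteSpace A] [IsUltrametricDist A]
    (x : A →A[Ω] Ω)
    -- the locally analytic character `χ` that reduces to `1_k` at `x`
    (χ : Fpˣ →* Aˣ) (hχan : AutL.IsLocAnUnits p fun y => (χ y : A))
    (hχ : ∀ y, x (χ y) = AutL.oneK d.mp y)
    -- surjectivity of the reduction map
    (hred : d.RedSurjective ε π x χ hχ)
    -- a tangent vector at `x`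
    (v : A →A[Ω] DualNumber Ω) (hv : ∀ a, (v a).fst = x a) :
    AutL.derivAlong v χ ∈ d.LInv ε π := by
  -- Completeness of Ω is needed for products of Ω-valued power series.
  have : CompleteSpace Ω := FiniteDimensional.complete ℚ_[p] Ω
  exact ⟨_, d.cLambda_derivAlong_eq_zero (χ := ⟨χ, hχan⟩) hχ hv ε π hred⟩
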